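/- Work over an algebraically closed field of characteristic zero. A toric log del Pezzo surface is a complete normal toric surface $S$ with at worst log terminal singularities whose anticanonical divisor $-K_S$ is ample. All $(-1)$-curves, sections and fibers below are torus-invariant. **Notation.** Let $S$ be a toric log del Pezzo surface of Picard number one, with minimal resolution $S'\to S$. We call $S$ *basic* if $D^2\ge -2$ for every torus-invariant curve $D$ on $S'$ that meets a $(-1)$-curve. A *cascade* of $S$ to $S_0$ consists of toric log del Pezzo surfaces $S=S_t, S_{t-1},\dots,S_0$ ($t\ge 0$) of Picard number one, with minimal resolutions $S'_k\to S_k$, and of morphisms $S'_k\to S'_{k-1}$ for $1\le k\le t$, each the blow-down of one torus-invariant $(-1)$-curve, such that $S_0$ is basic; $S_0$ is then called the basic surface of $S$. We write $[[a,F,b,G]]$ for a smooth complete toric surface with a toric $\mathbb P^1$-fibration over $\mathbb P^1$ whose two torus-invariant sections have self-intersection numbers $a,b$ and whose two torus-invariant fibers are $F,G$. Here $F_0$ denotes a smooth fiber, $F_1^0$ a fiber of type $I_0$ (its components form a chain with self-intersection numbers $-2,-1,-2$), and $F_2^0$ a fiber of type $II_0$ (a chain with self-intersection numbers $-1,-2,-2,-1$).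 A fiber is of type $I$ (respectively $II$) if successive contractions of $(-1)$-curves in the fiber transform it into a fiber of type $I_0$ (respectively $II_0$). The surfaces $S(std^1_n)$, $S(std^2_n)$ ($n\ge 2$) and $S(3A_2)$ are the toric log del Pezzo surfaces of Picard number one with minimal resolutions $[[-n,F_0,n-1,F_1^0]]$, $[[-n,F_1^0,n-2,F_1^0]]$ and $[[-2,F_1^0,-2,F_2^0]]$, respectively. **Theorem.** Let $S$ be a toric log del Pezzo surface of Picard number one, with minimal resolution $S'$. 1. Either $S\cong\mathbb P(1,1,n)$ for some $n\ge 1$, or $S$ admits a cascade to $S(std^1_n)$ for some $n\ge 2$, to $S(std^2_n)$ for some $n\ge 2$, or to $S(3A_2)$. 2. Let $T$ be the basic surface of any cascade of $S$. (a) If $T=S(std^1_n)$ with $n\ge 2$, then $S'=[[-n,F_1,n-1,F_0]]$ with $F_1$ of type $I$ and $F_0$ smooth. (b) If $T=S(std^2_n)$ with $n\ge 2$, then $S'=[[-n,F_1,n-2,F_1']]$ with $F_1$ and $F_1'$ of type $I$. (c) If $T=S(3A_2)$, then $S'=[[-n,F_1,-m,F_2]]$ for some integers $n,m\ge 2$,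 with $F_1$ of type $I$ and $F_2$ of type $II$. 3. If $S$ is not basic, then $S$ admits a cascade to $S(std^1_n)$ or $S(std^2_n)$ for some $n\ge 2$, or to $S(3A_2)$. Moreover, writing $|\mathrm{Sing}(S)|$ for the number of singular points: (i) if $|\mathrm{Sing}(S)|=0$, then $S\cong\mathbb P^2$; (ii) if $|\mathrm{Sing}(S)|=1$, then $S\cong\mathbb P(1,1,n)$ for some $n\ge 2$; (iii) if $|\mathrm{Sing}(S)|=2$, then $S\cong\mathbb P(1,p,q)$ for some positive integers $p,q$, and $S$ admits a cascade to $S(std^1_n)$ for some $n\ge 2$; (iv) if $|\mathrm{Sing}(S)|=3$, then $S$ admits a cascade to $S(std^2_n)$ for some $n\ge 2$ or to $S(3A_2)$. -/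

import Mathlib

/-! Complete normal toric surfaces are given by their fans in the lattice `N = ℤ²`; torus-invariant
curves, divisors, intersection numbers and toric morphisms are read off the fan by the usual
dictionary of toric geometry. -/

namespace ToricCascade

/-- The lattice `N` of one-parameter subgroups of the torus. -/
abbrev NLat : Type := ℤ × ℤ

def det (u v : NLat) : ℤ := u.1 * v.2 - u.2 * v.1

def IsPrimitive (u : NLat) : Prop := Int.gcd u.1 u.2 = 1

/-- The lattice point `x` lies in the rational cone `ℝ≥0 u + ℝ≥0 v`. -/
def InCone (u v x : NLat) : Prop := ∃ a b c : ℕ, 0 < c ∧ c • x = a • u + b • v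

/-- `u`, `v` in `R` span a two-dimensional strongly convex cone, and this cone contains no other
member of `R`: it is a maximal cone of the fan with ray generators `R`. -/
def SpansCone (R : Finset NLat) (u v : NLat) : Prop :=
  u ∈ R ∧ v ∈ R ∧ det u v ≠ 0 ∧ ∀ w ∈ R, InCone u v w → w = u ∨ w = v

/-- A complete normal toric surface, given by its fan: the finite set of primitive ray generators
(one for each torus-invariant curve), the maximal cones being those spanned by neighbouring
generators. Completeness: the maximal cones cover the plane. -/
structure ToricSurface where
  rays : Finset NLat
  primitive : ∀ u ∈ rays, IsPrimitive u
  complete : ∀ x : NLat, ∃ u v : NLat, SpansCone rays u v ∧ InCone u v x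

namespace ToricSurface

/-- `cone(u, v)` is a maximal cone of the fan: a torus-fixed point, at which the torus-invariant
curves `D_u` and `D_v` meet. -/
def Cone (S : ToricSurface) (u v : NLat) : Prop := SpansCone S.rays u v

/-- Every torus-fixed point is smooth: every maximal cone is spanned by a basis of `N`. -/
def IsSmooth (S : ToricSurface) : Prop := ∀ u v : NLat, S.Cone u v → IsUnit (det u v)

/-- The number of singular points (torus-fixed points whose cone is not spanned by a basis). -/
noncomputable def singCount (S : ToricSurface) : ℕ :=
  Set.ncard {σ : Finset NLat | ∃ u v : NLat, S.Cone u v ∧ ¬ IsUnit (det u v) ∧ σ = {u, v}}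

/-- The map `M → ⊕ ℤ D_u`, `m ↦ div(χ^m) = ∑ ⟨m, u⟩ D_u`. -/
def divHom (S : ToricSurface) : (NLat →ₗ[ℤ] ℤ) →ₗ[ℤ] (S.rays → ℤ) where
  toFun m u := m u
  map_add' _ _ := rfl
  map_smul' _ _ := rfl

/-- Torus-invariant Cartier divisors: on each maximal affine chart they are `div(χ^m)`, `m ∈ M`. -/
def cartier (S : ToricSurface) : Submodule ℤ (S.rays → ℤ) where
  carrier := {D | ∀ u v : S.rays, S.Cone u v → ∃ m : NLat →ₗ[ℤ] ℤ, m u = D u ∧ m v = D v}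
  zero_mem' _ _ _ := ⟨0, rfl, rfl⟩
  add_mem' := by
    intro D E hD hE u v h
    obtain ⟨m, h1, h2⟩ := hD u v h
    obtain ⟨m', h1', h2'⟩ := hE u v h
    exact ⟨m + m', by simp [h1, h1'], by simp [h2, h2']⟩
  smul_mem' := by
    intro c D hD u v h
    obtain ⟨m, h1, h2⟩ := hD u v h
    exact ⟨c • m, by simp [h1], by simp [h2]⟩

/-- The Picard group: torus-invariant Cartier divisors modulo the divisors of characters. -/
abbrev Pic (S : ToricSurface) : Type :=
  S.cartier ⧸ (LinearMap.range S.divHom).submoduleOf S.cartier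

noncomputable def picardNumber (S : ToricSurface) : ℕ := Module.finrank ℤ S.Pic

/-- A torus-invariant `ℚ`-divisor `∑ D_u` is `ℚ`-Cartier and ample: its support function is
rational linear on each maximal cone and strictly convex. -/
def IsAmple (S : ToricSurface) (D : S.rays → ℚ) : Prop :=
  ∀ u v : S.rays, S.Cone u v →
    ∃ m : NLat →ₗ[ℤ] ℚ, m u = - D u ∧ m v = - D v ∧
      ∀ w : S.rays, w ≠ u → w ≠ v → - D w < m w

/-- The anticanonical divisor `-K = ∑ D_u`. -/
def antiCanonical (S : ToricSurface) : S.rays → ℚ := fun _ => 1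

/-- `K` is `ℚ`-Cartier with all (toric) discrepancies `> -1`: if `m = -1` at the generators of a
maximal cone, the exceptional divisor of a primitive `x` in the cone has discrepancy
`-1 - ⟨m, x⟩`. -/
def IsLogTerminal (S : ToricSurface) : Prop :=
  ∀ u v : NLat, S.Cone u v →
    ∃ m : NLat →ₗ[ℤ] ℚ, m u = -1 ∧ m v = -1 ∧
      ∀ x : NLat, IsPrimitive x → InCone u v x → -1 < -1 - m x

def IsLogDelPezzo (S : ToricSurface) : Prop := S.IsLogTerminal ∧ S.IsAmple S.antiCanonical

/-- A toric log del Pezzo surface of Picard number one. -/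
def IsLDP₁ (S : ToricSurface) : Prop := S.IsLogDelPezzo ∧ S.picardNumber = 1

/-- On a smooth surface: `D_u` has self-intersection number `d`, i.e. the two neighbours `v`, `w`
of `u` satisfy `v + w = -d u`. -/
def HasSelfInt (S : ToricSurface) (u : NLat) (d : ℤ) : Prop :=
  ∃ v w : NLat, v ≠ w ∧ S.Cone u v ∧ S.Cone u w ∧ v + w = (-d) • u

/-- The identity of `N` is a (proper birational) toric morphism `S' → S`. -/
def Refines (S' S : ToricSurface) : Prop :=
  ∀ u v : NLat, S'.Cone u v → ∃ a b : NLat, S.Cone a b ∧ ∀ x : NLat, InCone u v x → InCone a b x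

/-- `S'` is the minimal resolution of `S`: `S'` is smooth and no exceptional curve is a
`(-1)`-curve. -/
def IsMinRes (S' S : ToricSurface) : Prop :=
  S'.IsSmooth ∧ S'.Refines S ∧ ∀ u ∈ S'.rays, u ∉ S.rays → ¬ S'.HasSelfInt u (-1)

/-- `B` is obtained from `A` by contracting the torus-invariant `(-1)`-curve `D_u`. -/
def IsBlowDownAt (A B : ToricSurface) (u : NLat) : Prop :=
  A.HasSelfInt u (-1) ∧ B.rays = A.rays.erase u

def IsBlowDown (A B : ToricSurface) : Prop := ∃ u : NLat, IsBlowDownAt A B u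

/-- On the minimal resolution `S'`: every torus-invariant curve meeting a `(-1)`-curve has
self-intersection number at least `-2`. -/
def BasicCondition (S' : ToricSurface) : Prop :=
  ∀ u v : NLat, S'.HasSelfInt u (-1) → S'.Cone u v → ∀ d : ℤ, S'.HasSelfInt v d → -2 ≤ d

/-- `S` is basic. -/
def IsBasic (S : ToricSurface) : Prop := ∃ S' : ToricSurface, IsMinRes S' S ∧ BasicCondition S'

/-- `S` admits a cascade `S = X t, …, X 0 = S₀` to the basic surface `S₀`, with minimal
resolutions `X' k → X k` and blow-downs `X' (k + 1) → X' k` of `(-1)`-curves. -/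
def AdmitsCascadeTo (S S₀ : ToricSurface) : Prop :=
  ∃ (t : ℕ) (X X' : ℕ → ToricSurface), X t = S ∧ X 0 = S₀ ∧
    (∀ k ≤ t, (X k).IsLDP₁ ∧ IsMinRes (X' k) (X k)) ∧
    (∀ k < t, IsBlowDown (X' (k + 1)) (X' k)) ∧
    IsBasic (X 0)

/-- The weighted projective plane `P(a, b, c)`: the ray generators `u`, `v`, `w` generate `N` and
`a u + b v + c w = 0`. -/
def IsWeightedProjectivePlane (S : ToricSurface) (a b c : ℕ) : Prop :=
  ∃ u v w : NLat, u ≠ v ∧ v ≠ w ∧ u ≠ w ∧ S.rays = {u, v, w} ∧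
    a • u + b • v + c • w = 0 ∧ Submodule.span ℤ {u, v, w} = ⊤

/-- The surjection `π : N → ℤ` is a toric morphism from `S` onto `P¹` with connected fibres: every
cone is mapped into a cone of the fan of `P¹`. -/
def IsP1Fibration (S : ToricSurface) (π : NLat →ₗ[ℤ] ℤ) : Prop :=
  Function.Surjective π ∧
    ∀ u v : NLat, S.Cone u v → (0 ≤ π u ∧ 0 ≤ π v) ∨ (π u ≤ 0 ∧ π v ≤ 0)

/-- The dual graph of the torus-invariant fibre of `π` whose components are the `D_u` with
`π u > 0` is a chain with self-intersection numbers `l`. (The other torus-invariant fibre of `π`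
is the one of `-π`.) -/
def FiberChain (S : ToricSurface) (π : NLat →ₗ[ℤ] ℤ) (l : List ℤ) : Prop :=
  ∃ c : List NLat, c.Nodup ∧ (∀ u : NLat, u ∈ c ↔ u ∈ S.rays ∧ 0 < π u) ∧
    c.IsChain S.Cone ∧ List.Forall₂ S.HasSelfInt c l

/-- `B` is obtained from `A` by contracting a `(-1)`-curve in the fibre `π > 0`. -/
def FiberBlowDown (π : NLat →ₗ[ℤ] ℤ) (A B : ToricSurface) : Prop :=
  ∃ u : NLat, 0 < π u ∧ IsBlowDownAt A B u

/-- A smooth fibre `F_0`. -/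
def FiberF0 (S : ToricSurface) (π : NLat →ₗ[ℤ] ℤ) : Prop := S.FiberChain π [0]

/-- A fibre of type `I_0`. -/
def FiberI0 (S : ToricSurface) (π : NLat →ₗ[ℤ] ℤ) : Prop := S.FiberChain π [-2, -1, -2]

/-- A fibre of type `II_0`. -/
def FiberII0 (S : ToricSurface) (π : NLat →ₗ[ℤ] ℤ) : Prop := S.FiberChain π [-1, -2, -2, -1]

/-- A fibre of type `I`: it can be contracted to a fibre of type `I_0`. -/
def FiberI (S : ToricSurface) (π : NLat →ₗ[ℤ] ℤ) : Prop :=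
  ∃ B : ToricSurface, Relation.ReflTransGen (FiberBlowDown π) S B ∧ B.FiberI0 π

/-- A fibre of type `II`: it can be contracted to a fibre of type `II_0`. -/
def FiberII (S : ToricSurface) (π : NLat →ₗ[ℤ] ℤ) : Prop :=
  ∃ B : ToricSurface, Relation.ReflTransGen (FiberBlowDown π) S B ∧ B.FiberII0 π

/-- `S = [[a, F, b, G]]`: `S` is smooth with a `P¹`-fibration whose two torus-invariant sections
have self-intersection numbers `a`, `b` and whose two torus-invariant fibres are of the
kinds `F`, `G`. -/
def HasForm (S : ToricSurface) (a : ℤ) (F : ToricSurface → (NLat →ₗ[ℤ] ℤ) → Prop)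
    (b : ℤ) (G : ToricSurface → (NLat →ₗ[ℤ] ℤ) → Prop) : Prop :=
  S.IsSmooth ∧ ∃ (π : NLat →ₗ[ℤ] ℤ) (s₁ s₂ : NLat), S.IsP1Fibration π ∧ s₁ ≠ s₂ ∧
    π s₁ = 0 ∧ π s₂ = 0 ∧ S.HasSelfInt s₁ a ∧ S.HasSelfInt s₂ b ∧ F S π ∧ G S (-π)

/-- `T` is the surface `S(std^1_n)`, whose minimal resolution is `[[-n, F_0, n-1, F_1^0]]`. -/
def IsStd1 (T : ToricSurface) (n : ℤ) : Prop :=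
  ∃ T' : ToricSurface, IsMinRes T' T ∧ T'.HasForm (-n) FiberF0 (n - 1) FiberI0

/-- `T` is the surface `S(std^2_n)`, whose minimal resolution is `[[-n, F_1^0, n-2, F_1^0]]`. -/
def IsStd2 (T : ToricSurface) (n : ℤ) : Prop :=
  ∃ T' : ToricSurface, IsMinRes T' T ∧ T'.HasForm (-n) FiberI0 (n - 2) FiberI0

/-- `T` is the surface `S(3A_2)`, whose minimal resolution is `[[-2, F_1^0, -2, F_2^0]]`. -/
def Is3A2 (T : ToricSurface) : Prop :=
  ∃ T' : ToricSurface, IsMinRes T' T ∧ T'.HasForm (-2) FiberI0 (-2) FiberII0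

/-- `S` admits a cascade to some `S(std^1_n)`, `n ≥ 2`. -/
def CascadeToStd1 (S : ToricSurface) : Prop :=
  ∃ (n : ℤ) (T : ToricSurface), 2 ≤ n ∧ S.AdmitsCascadeTo T ∧ T.IsStd1 n

/-- `S` admits a cascade to some `S(std^2_n)`, `n ≥ 2`. -/
def CascadeToStd2 (S : ToricSurface) : Prop :=
  ∃ (n : ℤ) (T : ToricSurface), 2 ≤ n ∧ S.AdmitsCascadeTo T ∧ T.IsStd2 n

/-- `S` admits a cascade to `S(3A_2)`. -/
def CascadeTo3A2 (S : ToricSurface) : Prop :=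
  ∃ T : ToricSurface, S.AdmitsCascadeTo T ∧ T.Is3A2

end ToricSurface

end ToricCascade

open ToricCascade ToricSurface

/-! Everything is read off the fan. The Picard number is the number of rays minus two, and log
terminality and ampleness of `-K` are automatic on a fan with three rays, so the surfaces in
question are exactly the complete fans with three rays (`isLDP₁_iff`).

Let `A` be the minimal resolution of such a surface `S`, and call a curve on `A` big if its
self-intersection number is at least `-1`. A maximum principle for curves with `D² ≤ -2` shows that
the big rays positively span the plane (`IsSmooth.posSpans_big`), so there are at least three of
them. Exceptional curves are not big, hence the big curves are exactly the three curves coming from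
`S` (`IsMinRes.big_eq`), and the problem becomes one about smooth fans with three big rays
(`IsThree`).

On such a fan both neighbours of a `(-1)`-curve are at most `-2` (`IsThree.si_le_of_cone`). If one
neighbour is at most `-3`, contracting the `(-1)`-curve removes a big curve, so the other neighbour
must be a `(-2)`-curve that becomes the new `(-1)`-curve (`IsThree.contracts_of_le`). Iterating this
ends at a basic surface that still has a `(-1)`-curve `u`. There `u` lies between two `(-2)`-curves
`p` and `q`. Then `u = p + q`, the outer neighbours of `p` and `q` are the opposite rays `p - q` and
`q - p`, and `p, u, q` is a fibre of type `I₀`. Locating the other two big curves gives the three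
models (`IsThree.hasForm_of_basic`). Without any `(-1)`-curve, one big curve meets the two others
and `S` is `P(1,1,n)`.

Part 2 follows the cascade upwards. Each step blows up a point on a `(-1)`-curve inside a fibre. If
all `(-1)`-curves of the fibres have multiplicity at least two, they miss the sections, whose
self-intersection numbers therefore do not change (`FibStep.si_section`).

For the singular points, the existence of two meeting curves with `D² ≥ 0` is invariant under
cascades, holds for `std¹` and fails for `std²` and `3A₂`. It says that `S` has a smooth torus-fixed
point (`IsMinRes.exists_smooth_cone`, `IsMinRes.hasAdjNonneg`). -/

namespace ToricCascade

/-! ### The determinant form on `N`. -/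

section Det

theorem det_swap (u v : NLat) : det v u = -det u v := by simp only [det]; ring
theorem det_self (u : NLat) : det u u = 0 := by simp only [det]; ring
theorem det_add_right (u v w : NLat) : det u (v + w) = det u v + det u w := by
  simp only [det, Prod.fst_add, Prod.snd_add]; ring
theorem det_add_left (u v w : NLat) : det (u + v) w = det u w + det v w := by
  simp only [det, Prod.fst_add, Prod.snd_add]; ring
theorem det_smul_right (k : ℤ) (u v : NLat) : det u (k • v) = k * det u v := by
  simp only [det, Prod.smul_fst, Prod.smul_snd, smul_eq_mul]; ring
theorem det_smul_left (k : ℤ) (u v : NLat) : det (k • u) v = k * det u v := by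
  simp only [det, Prod.smul_fst, Prod.smul_snd, smul_eq_mul]; ring
theorem det_nsmul_right (k : ℕ) (u v : NLat) : det u (k • v) = k * det u v := by
  rw [← natCast_zsmul, det_smul_right]
theorem det_nsmul_left (k : ℕ) (u v : NLat) : det (k • u) v = k * det u v := by
  rw [← natCast_zsmul, det_smul_left]
theorem det_neg_right (u v : NLat) : det u (-v) = -det u v := by
  simp only [det, Prod.fst_neg, Prod.snd_neg]; ring
theorem det_neg_left (u v : NLat) : det (-u) v = -det u v := by
  simp only [det, Prod.fst_neg, Prod.snd_neg]; ring
theorem det_sub_right (u v w : NLat) : det u (v - w) = det u v - det u w := by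
  simp only [det, Prod.fst_sub, Prod.snd_sub]; ring
theorem det_sub_left (u v w : NLat) : det (u - v) w = det u w - det v w := by
  simp only [det, Prod.fst_sub, Prod.snd_sub]; ring
theorem det_zero_right (u : NLat) : det u 0 = 0 := by simp [det]
theorem det_zero_left (u : NLat) : det 0 u = 0 := by simp [det]

/-- The Plücker relation, which with Cramer's rule below replaces arguments about angles. -/
theorem det_pluecker (a b x y : NLat) :
    det a b * det x y = det a x * det b y - det a y * det b x := by
  simp only [det]; ring

theorem det_smul_eq (u v x : NLat) : det u v • x = det x v • u + det u x • v := by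
  ext <;> simp [det] <;> ring

theorem ne_of_det_ne_zero {u v : NLat} (h : det u v ≠ 0) : u ≠ v := by
  rintro rfl; exact h (det_self u)

/-- The linear functional `det y`. -/
def detL (y : NLat) : NLat →ₗ[ℤ] ℤ where
  toFun := det y
  map_add' := det_add_right y
  map_smul' k v := det_smul_right k y v

@[simp] theorem detL_apply (y x : NLat) : detL y x = det y x := rfl

/-- The form is unimodular, so half-planes can be described by functionals or by vectors at will. -/
theorem exists_eq_detL (π : NLat →ₗ[ℤ] ℤ) : ∃ y, π = detL y := by
  refine ⟨(π (0, 1), -π (1, 0)), ?_⟩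
  ext <;> simp [det]

theorem eq_zero_of_det {u v x : NLat} (h : det u v ≠ 0) (h1 : det u x = 0) (h2 : det v x = 0) :
    x = 0 := by
  have := det_smul_eq u v x
  rw [h1, det_swap v x, h2, neg_zero, zero_smul, zero_smul, add_zero] at this
  exact (smul_eq_zero.mp this).resolve_left h

theorem IsPrimitive.ne_zero {u : NLat} (h : IsPrimitive u) : u ≠ 0 := by
  rintro rfl; simp [IsPrimitive] at h

theorem isPrimitive_of_isUnit {u v : NLat} (h : IsUnit (det u v)) : IsPrimitive u := by
  have h1 : (Int.gcd u.1 u.2 : ℤ) ∣ det u v :=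
    dvd_sub (Dvd.dvd.mul_right (Int.gcd_dvd_left ..) _) (Dvd.dvd.mul_right (Int.gcd_dvd_right ..) _)
  have := isUnit_of_dvd_unit h1 h
  unfold IsPrimitive
  simpa using Int.ofNat_isUnit.mp this

theorem IsPrimitive.exists_det_eq_one {u : NLat} (h : IsPrimitive u) : ∃ y, det u y = 1 := by
  have h1 := Int.gcd_eq_gcd_ab u.1 u.2
  unfold IsPrimitive at h
  refine ⟨(-Int.gcdB u.1 u.2, Int.gcdA u.1 u.2), ?_⟩
  rw [h] at h1
  simp only [det]
  push_cast at h1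
  linarith

theorem IsPrimitive.eq_smul {u x : NLat} (h : IsPrimitive u) (hd : det u x = 0) :
    ∃ k : ℤ, x = k • u := by
  obtain ⟨y, hy⟩ := h.exists_det_eq_one
  refine ⟨det x y, ?_⟩
  have := det_smul_eq u y x
  rw [hy, hd] at this
  simpa using this

theorem IsPrimitive.eq_or_eq_neg {u v : NLat} (hu : IsPrimitive u) (hv : IsPrimitive v)
    (hd : det u v = 0) : v = u ∨ v = -u := by
  obtain ⟨k, rfl⟩ := hu.eq_smul hd
  obtain ⟨y, hy⟩ := hv.exists_det_eq_one
  rw [det_smul_left] at hy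
  rcases Int.isUnit_iff.mp (IsUnit.of_mul_eq_one _ hy) with h | h <;> subst h <;> simp

/-- Two primitive vectors on the same half-line, as seen from `y`, coincide. -/
theorem IsPrimitive.eq_of_det {u v y : NLat} (hu : IsPrimitive u) (hv : IsPrimitive v)
    (hd : det u v = 0) (h1 : 0 < det y u) (h2 : 0 ≤ det y v) : v = u := by
  rcases hu.eq_or_eq_neg hv hd with h | h
  · exact h
  · subst h; rw [det_neg_right] at h2; omega

theorem isUnit_det_swap {u v : NLat} : IsUnit (det u v) ↔ IsUnit (det v u) := by
  rw [det_swap u v, IsUnit.neg_iff]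

end Det

/-! ### Cones, the angular order, and completeness. -/

section Cones

theorem InCone.symm {u v x : NLat} (h : InCone u v x) : InCone v u x := by
  obtain ⟨a, b, c, hc, h⟩ := h
  exact ⟨b, a, c, hc, by rw [h, add_comm]⟩

theorem inCone_of_eq {u v x : NLat} {a b c : ℤ} (ha : 0 ≤ a) (hb : 0 ≤ b) (hc : 0 < c)
    (h : c • x = a • u + b • v) : InCone u v x := by
  lift a to ℕ using ha
  lift b to ℕ using hb
  lift c to ℕ using hc.le
  exact ⟨a, b, c, by exact_mod_cast hc, by simpa using h⟩

theorem inCone_iff {u v x : NLat} (h : 0 < det u v) :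
    InCone u v x ↔ 0 ≤ det u x ∧ 0 ≤ det x v := by
  constructor
  · rintro ⟨a, b, c, hc, hx⟩
    have h1 : (c : ℤ) * det u x = b * det u v := by
      rw [← det_nsmul_right, hx, det_add_right, det_nsmul_right, det_nsmul_right, det_self]; ring
    have h2 : (c : ℤ) * det x v = a * det u v := by
      rw [← det_nsmul_left, hx, det_add_left, det_nsmul_left, det_nsmul_left, det_self]; ring
    have hc' : (0 : ℤ) < c := by exact_mod_cast hc
    exact ⟨nonneg_of_mul_nonneg_right (by rw [h1]; positivity) hc',
      nonneg_of_mul_nonneg_right (by rw [h2]; positivity) hc'⟩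
  · rintro ⟨h1, h2⟩
    exact inCone_of_eq h2 h1 h (det_smul_eq u v x)

variable {R : Finset NLat} {u v w x : NLat}

theorem SpansCone.symm (h : SpansCone R u v) : SpansCone R v u :=
  ⟨h.2.1, h.1, by rw [det_swap u v]; exact neg_ne_zero.mpr h.2.2.1,
    fun w hw hc => (h.2.2.2 w hw hc.symm).symm⟩

theorem spansCone_iff (h : 0 < det u v) : SpansCone R u v ↔
    u ∈ R ∧ v ∈ R ∧ ∀ w ∈ R, 0 ≤ det u w → 0 ≤ det w v → w = u ∨ w = v := by
  unfold SpansCone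
  simp only [inCone_iff h, and_imp]
  exact ⟨fun ⟨a, b, _, c⟩ => ⟨a, b, c⟩, fun ⟨a, b, c⟩ => ⟨a, b, h.ne', c⟩⟩

/-- Crossing a maximal cone: a ray beyond `u` which is not `v` is beyond `v`. -/
theorem SpansCone.cross (hc : SpansCone R u v) (hx : x ∈ R) (h : 0 < det u v * det u x) :
    x = v ∨ 0 < det u v * det v x := by
  by_contra! hcon
  obtain ⟨h1, h2⟩ := hcon
  have key : x = u ∨ x = v := by
    rcases lt_or_gt_of_ne hc.2.2.1 with hd | hd
    · refine hc.2.2.2 x hx (InCone.symm ((inCone_iff (by rw [det_swap u v]; omega)).mpr ⟨?_, ?_⟩))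
      · nlinarith
      · rw [det_swap u x]; nlinarith
    · refine hc.2.2.2 x hx ((inCone_iff hd).mpr ⟨?_, ?_⟩)
      · nlinarith
      · rw [det_swap v x]; nlinarith
  rcases key with rfl | rfl
  · simp [det_self] at h
  · exact h1 rfl

/-- Inside an open half-plane the angular order is linear. The quotient maximized here is the
cotangent of the angle from `y`, which decreases counterclockwise. -/
theorem exists_first {P : Finset NLat} (hP : P.Nonempty) (y : NLat) (h : ∀ u ∈ P, 0 < det y u) :
    ∃ u ∈ P, ∀ v ∈ P, 0 ≤ det u v := by
  obtain ⟨u, hu, hm⟩ := P.exists_max_image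
    (fun u : NLat => ((u.1 * y.1 + u.2 * y.2 : ℤ) : ℚ) / (det y u : ℤ)) hP
  refine ⟨u, hu, fun v hv => ?_⟩
  have h1 := h u hu
  have h2 := h v hv
  have h3 := hm v hv
  rw [div_le_div_iff₀ (by exact_mod_cast h2) (by exact_mod_cast h1)] at h3
  have h4 : (v.1 * y.1 + v.2 * y.2) * det y u ≤ (u.1 * y.1 + u.2 * y.2) * det y v := by
    exact_mod_cast h3
  have h5 : (u.1 * y.1 + u.2 * y.2) * det y v - (v.1 * y.1 + v.2 * y.2) * det y u
      = (y.1 * y.1 + y.2 * y.2) * det u v := by simp only [det]; ring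
  by_contra! hneg
  have h6 : 0 < y.1 * y.1 + y.2 * y.2 := by
    by_contra! h0
    have e1 : y.1 = 0 := by nlinarith [mul_self_nonneg y.1, mul_self_nonneg y.2]
    have e2 : y.2 = 0 := by nlinarith [mul_self_nonneg y.1, mul_self_nonneg y.2]
    simp [det, e1, e2] at h1
  nlinarith

theorem exists_last {P : Finset NLat} (hP : P.Nonempty) (y : NLat) (h : ∀ u ∈ P, 0 < det y u) :
    ∃ u ∈ P, ∀ v ∈ P, det u v ≤ 0 := by
  classical
  -- A reflection reverses orientation and so exchanges first and last.
  let f : NLat → NLat := fun u => (u.2, u.1)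
  have hf : ∀ u v, det (f u) (f v) = -det u v := by intro u v; simp only [f, det]; ring
  obtain ⟨u, hu, hm⟩ := exists_first (hP.image f) (-f y) (by
    intro u hu
    obtain ⟨v, hv, rfl⟩ := Finset.mem_image.mp hu
    rw [det_neg_left, hf, neg_neg]; exact h v hv)
  obtain ⟨v, hv, rfl⟩ := Finset.mem_image.mp hu
  refine ⟨v, hv, fun w hw => ?_⟩
  have := hm (f w) (Finset.mem_image_of_mem f hw)
  rw [hf] at this; omega

/-- `R` positively spans the plane. -/
def PosSpans (R : Finset NLat) : Prop := ∀ y : NLat, y ≠ 0 → ∃ u ∈ R, 0 < det y u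

theorem exists_spansCone_right (hR : ∀ u ∈ R, IsPrimitive u) (hu : u ∈ R)
    (h : ∃ v ∈ R, 0 < det u v) : ∃ v, SpansCone R u v ∧ 0 < det u v := by
  classical
  obtain ⟨v, hv, hm⟩ := exists_first (P := R.filter fun v => 0 < det u v)
    (by obtain ⟨v, hv, h⟩ := h; exact ⟨v, by simp [hv, h]⟩) u (by simp)
  simp only [Finset.mem_filter, and_imp] at hv hm
  refine ⟨v, (spansCone_iff hv.2).mpr ⟨hu, hv.1, fun w hw h1 h2 => ?_⟩, hv.2⟩
  rcases h1.lt_or_eq with h1 | h1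
  · right
    have h3 := hm w hw h1
    rw [det_swap w v] at h3
    exact (hR v hv.1).eq_of_det (hR w hw) (by rw [det_swap w v]; omega) hv.2 h1.le
  · left
    refine (hR u hu).eq_of_det (y := -v) (hR w hw) h1.symm ?_ ?_
    · rw [det_neg_left, det_swap u v]; simpa using hv.2
    · rw [det_neg_left, det_swap w v]; simpa using h2

theorem exists_spansCone_left (hR : ∀ u ∈ R, IsPrimitive u) (hu : u ∈ R)
    (h : ∃ v ∈ R, 0 < det v u) : ∃ v, SpansCone R u v ∧ 0 < det v u := by
  classical
  obtain ⟨v, hv, hm⟩ := exists_last (P := R.filter fun v => 0 < det v u)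
    (by obtain ⟨v, hv, h⟩ := h; exact ⟨v, by simp [hv, h]⟩) (-u)
    (by simp [det_neg_left, det_swap u])
  simp only [Finset.mem_filter, and_imp] at hv hm
  refine ⟨v, SpansCone.symm ((spansCone_iff hv.2).mpr ⟨hv.1, hu, fun w hw h1 h2 => ?_⟩), hv.2⟩
  rcases h2.lt_or_eq with h2 | h2
  · left
    have h3 := hm w hw h2
    refine (hR v hv.1).eq_of_det (y := -u) (hR w hw) (by omega) ?_ ?_
    · rw [det_neg_left, ← det_swap]; exact hv.2
    · rw [det_neg_left, ← det_swap]; exact h2.le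
  · right
    refine (hR u hu).eq_of_det (y := v) (hR w hw) ?_ hv.2 h1
    rw [det_swap w u, ← h2, neg_zero]

/-- A point lies between the last ray clockwise from it and the successor of that ray: a successor
still before the point would contradict the choice of the last ray. -/
theorem PosSpans.complete (hR : ∀ u ∈ R, IsPrimitive u) (h : PosSpans R) (x : NLat) :
    ∃ u v, SpansCone R u v ∧ InCone u v x := by
  classical
  by_cases hx : x = 0
  · obtain ⟨u, hu, -⟩ := h (1, 0) (by simp)
    obtain ⟨v, hv, -⟩ := exists_spansCone_right hR hu (h u (hR u hu).ne_zero)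
    exact ⟨u, v, hv, 0, 0, 1, one_pos, by simp [hx]⟩
  by_cases hpar : ∃ u ∈ R, det u x = 0 ∧ ∃ y, 0 < det y u ∧ 0 < det y x
  · obtain ⟨u, hu, h0, y, h1, h2⟩ := hpar
    obtain ⟨v, hv, hd⟩ := exists_spansCone_right hR hu (h u (hR u hu).ne_zero)
    refine ⟨u, v, hv, (inCone_iff hd).mpr ⟨h0.ge, ?_⟩⟩
    have h3 : det y u * det x v = det y x * det u v := by
      have e := det_pluecker y x u v
      rw [det_swap u x, h0] at e
      linarith
    by_contra! hc
    nlinarith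
  · obtain ⟨u, hu, hm⟩ := exists_last (P := R.filter fun u => 0 < det u x)
      (by obtain ⟨v, hv, h⟩ := h (-x) (by simpa using hx)
          exact ⟨v, by
            rw [det_neg_left, ← det_swap] at h
            simp [hv, h]⟩) (-x)
      (by simp [det_neg_left, det_swap x])
    simp only [Finset.mem_filter, and_imp] at hu hm
    obtain ⟨v, hv, hd⟩ := exists_spansCone_right hR hu.1 (h u (hR u hu.1).ne_zero)
    refine ⟨u, v, hv, (inCone_iff hd).mpr ⟨hu.2.le, ?_⟩⟩
    by_contra! hc
    have := hm v hv.2.1 (by rw [det_swap x v]; omega)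
    omega

end Cones

/-! ### The two neighbours of a ray in a complete fan. -/

namespace ToricSurface

variable {S A B : ToricSurface} {u v w x y e f : NLat}

theorem ext_rays (h : A.rays = B.rays) : A = B := by
  cases A; cases B; simp_all

theorem posSpans (S : ToricSurface) : PosSpans S.rays := by
  intro y hy
  obtain ⟨x, hx⟩ : ∃ x, 0 < det y x := by
    -- This is `y` turned by a right angle, so `det y x` is the squared length of `y`.
    refine ⟨(-y.2, y.1), ?_⟩
    simp only [det]
    by_contra! h0
    apply hy
    ext
    · show y.1 = 0; nlinarith [mul_self_nonneg y.1, mul_self_nonneg y.2]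
    · show y.2 = 0; nlinarith [mul_self_nonneg y.1, mul_self_nonneg y.2]
  obtain ⟨u, v, hc, a, b, c, hpos, h⟩ := S.complete x
  have h1 : (c : ℤ) * det y x = a * det y u + b * det y v := by
    rw [← det_nsmul_right, h, det_add_right, det_nsmul_right, det_nsmul_right]
  by_contra! hcon
  have h2 := hcon u hc.1
  have h3 := hcon v hc.2.1
  have hpos' : (0 : ℤ) < c := by exact_mod_cast hpos
  nlinarith

/-- The complete fan with the given ray generators. -/
def ofPosSpans (R : Finset NLat) (hR : ∀ u ∈ R, IsPrimitive u) (h : PosSpans R) :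
    ToricSurface := ⟨R, hR, h.complete hR⟩

theorem Cone.symm (h : S.Cone u v) : S.Cone v u := SpansCone.symm h
theorem Cone.left (h : S.Cone u v) : u ∈ S.rays := h.1
theorem Cone.right (h : S.Cone u v) : v ∈ S.rays := h.2.1
theorem Cone.det_ne (h : S.Cone u v) : det u v ≠ 0 := h.2.2.1
theorem Cone.ne (h : S.Cone u v) : u ≠ v := ne_of_det_ne_zero h.det_ne

theorem ne_zero (hu : u ∈ S.rays) : u ≠ 0 := (S.primitive u hu).ne_zero

theorem exists_cone_right (hu : u ∈ S.rays) : ∃ v, S.Cone u v ∧ 0 < det u v :=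
  exists_spansCone_right S.primitive hu (S.posSpans u (ne_zero hu))

theorem exists_cone_left (hu : u ∈ S.rays) : ∃ v, S.Cone u v ∧ 0 < det v u := by
  refine exists_spansCone_left S.primitive hu ?_
  obtain ⟨v, hv, h⟩ := S.posSpans (-u) (by simpa using ne_zero hu)
  exact ⟨v, hv, by rwa [det_neg_left, ← det_swap] at h⟩

theorem Cone.unique (h1 : S.Cone u v) (h2 : S.Cone u w) (h : 0 < det u v * det u w) : v = w := by
  rcases SpansCone.cross h1 h2.right h with h3 | h3
  · exact h3.symm
  · rcases SpansCone.cross h2 h1.right (by linarith) with h4 | h4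
    · exact h4
    · rw [det_swap v w] at h4
      rcases mul_pos_iff.mp h with ⟨a, b⟩ | ⟨a, b⟩ <;> nlinarith

/-- The two neighbours of a ray. -/
theorem exists_nbrs (hu : u ∈ S.rays) :
    ∃ e f, e ≠ f ∧ det u e < 0 ∧ 0 < det u f ∧ ∀ y, S.Cone u y ↔ y = e ∨ y = f := by
  obtain ⟨f, hf, hf'⟩ := S.exists_cone_right hu
  obtain ⟨e, he, he'⟩ := S.exists_cone_left hu
  rw [det_swap u e] at he'
  refine ⟨e, f, by rintro rfl; omega, by omega, hf', fun y => ⟨fun hy => ?_, ?_⟩⟩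
  · rcases lt_or_gt_of_ne hy.det_ne with h | h
    · exact Or.inl (hy.unique he (by nlinarith))
    · exact Or.inr (hy.unique hf (by nlinarith))
  · rintro (rfl | rfl) <;> assumption

theorem Cone.det_mul_neg (h1 : S.Cone u e) (h2 : S.Cone u f) (h : e ≠ f) :
    det u e * det u f < 0 := by
  by_contra! hc
  rcases hc.lt_or_eq with hc | hc
  · exact h (h1.unique h2 hc)
  · rcases mul_eq_zero.mp hc.symm with h3 | h3
    · exact h1.det_ne h3
    · exact h2.det_ne h3

theorem Cone.eq_or_eq (h1 : S.Cone u e) (h2 : S.Cone u f) (h : e ≠ f) (hy : S.Cone u y) :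
    y = e ∨ y = f := by
  obtain ⟨a, b, -, -, -, hab⟩ := S.exists_nbrs h1.left
  rcases (hab _).mp h1 with rfl | rfl <;> rcases (hab _).mp h2 with rfl | rfl <;>
    rcases (hab _).mp hy with rfl | rfl <;> simp_all

theorem Cone.exists_other (h : S.Cone u e) : ∃ f, S.Cone u f ∧ e ≠ f := by
  obtain ⟨a, b, hne, -, -, hab⟩ := S.exists_nbrs h.left
  rcases (hab _).mp h with rfl | rfl
  · exact ⟨b, (hab _).mpr (Or.inr rfl), hne⟩
  · exact ⟨a, (hab _).mpr (Or.inl rfl), hne.symm⟩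

/-- No ray lies in the interior of a maximal cone. -/
theorem Cone.not_interior (h : S.Cone u v) (hx : x ∈ S.rays) (h1 : 0 < det u x)
    (h2 : 0 < det x v) (h3 : 0 < det u v) : False := by
  rcases ((spansCone_iff h3).mp h).2.2 x hx h1.le h2.le with rfl | rfl
  · simp [det_self] at h1
  · simp [det_self] at h2

end ToricSurface
end ToricCascade

/-! ### Self-intersection numbers and the maximum principle on smooth surfaces. -/

namespace ToricCascade

theorem inCone_mul {u v x : NLat} (h : InCone u v x) (hd : det u v ≠ 0) :
    0 ≤ det u v * det u x ∧ 0 ≤ det u v * det x v := by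
  rcases lt_or_gt_of_ne hd with h0 | h0
  · have := (inCone_iff (by rw [det_swap u v]; omega)).mp h.symm
    rw [det_swap x v, det_swap u x] at this
    constructor <;> nlinarith
  · have := (inCone_iff h0).mp h
    constructor <;> nlinarith

theorem PosSpans.mono {R R' : Finset NLat} (h : PosSpans R) (hs : R ⊆ R') : PosSpans R' := by
  intro y hy
  obtain ⟨u, hu, h⟩ := h y hy
  exact ⟨u, hs hu, h⟩

/-- Any two vectors lie in a common closed half-plane. -/
theorem PosSpans.three_le_card {R : Finset NLat} (h : PosSpans R) : 3 ≤ R.card := by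
  by_contra! hc
  obtain ⟨a, b, hab⟩ : ∃ a b, R ⊆ {a, b} := by
    have : R.card = 0 ∨ R.card = 1 ∨ R.card = 2 := by omega
    rcases this with h | h | h
    · rw [Finset.card_eq_zero] at h; exact ⟨0, 0, by simp [h]⟩
    · obtain ⟨a, rfl⟩ := Finset.card_eq_one.mp h; exact ⟨a, a, by simp⟩
    · obtain ⟨a, b, -, rfl⟩ := Finset.card_eq_two.mp h; exact ⟨a, b, subset_rfl⟩
  obtain ⟨y, hy, h1, h2⟩ : ∃ y : NLat, y ≠ 0 ∧ det y a ≤ 0 ∧ det y b ≤ 0 := by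
    by_cases ha : a = 0
    · subst ha
      by_cases hb : b = 0
      · exact ⟨(1, 0), by simp, by simp [hb, det_zero_right]⟩
      · exact ⟨b, hb, by simp [det_zero_right, det_self]⟩
    · rcases le_total (det a b) 0 with h | h
      · exact ⟨a, ha, by simp [det_self, h]⟩
      · exact ⟨-a, by simpa using ha, by simp [det_neg_left, det_self, h]⟩
  obtain ⟨u, hu, hpos⟩ := h y hy
  have := hab hu
  simp only [Finset.mem_insert, Finset.mem_singleton] at this
  rcases this with rfl | rfl <;> omega

namespace ToricSurface

variable {S A B : ToricSurface} {u v w x y e f : NLat}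

theorem Cone.exists_pos (h : S.Cone u v) : 0 < det u v ∨ 0 < det v u := by
  have := h.det_ne
  rw [det_swap u v]; omega

theorem IsSmooth.det_eq_one (hA : A.IsSmooth) (h : A.Cone u v) (hd : 0 < det u v) :
    det u v = 1 := by
  rcases Int.isUnit_iff.mp (hA u v h) with h | h <;> omega

theorem IsSmooth.exists_nbrs_sum (hA : A.IsSmooth) (h1 : A.Cone u e) (h2 : A.Cone u f)
    (h : e ≠ f) : ∃ k : ℤ, e + f = k • u := by
  apply (A.primitive u h1.left).eq_smul
  have h3 := h1.det_mul_neg h2 h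
  rw [det_add_right]
  rcases Int.isUnit_iff.mp (hA u e h1) with a | a <;>
    rcases Int.isUnit_iff.mp (hA u f h2) with b | b <;> rw [a, b] at h3 ⊢ <;> simp at h3 ⊢

/-- The self-intersection number of the curve `D_u` on a smooth surface. -/
noncomputable def si (A : ToricSurface) (u : NLat) : ℤ :=
  -- The default `0` is never taken at a ray of a smooth surface, by `IsSmooth.hasSelfInt`.
  open Classical in if h : ∃ d, A.HasSelfInt u d then h.choose else 0

theorem HasSelfInt.mem {d : ℤ} (h : A.HasSelfInt u d) : u ∈ A.rays := by
  obtain ⟨v, w, -, h, -⟩ := h; exact h.left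

theorem HasSelfInt.unique {d d' : ℤ} (h : A.HasSelfInt u d) (h' : A.HasSelfInt u d') :
    d = d' := by
  have hu := h.mem
  obtain ⟨v, w, hne, h1, h2, h3⟩ := h
  obtain ⟨v', w', hne', h1', h2', h3'⟩ := h'
  have : v + w = v' + w' := by
    rcases h1.eq_or_eq h2 hne h1' with rfl | rfl <;> rcases h1.eq_or_eq h2 hne h2' with rfl | rfl
    · exact absurd rfl hne'
    · rfl
    · exact add_comm _ _
    · exact absurd rfl hne'
  rw [h3, h3'] at this
  have := smul_left_injective ℤ (ne_zero hu) this
  simpa using this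

theorem HasSelfInt.si_eq {d : ℤ} (h : A.HasSelfInt u d) : A.si u = d := by
  have h0 : ∃ d, A.HasSelfInt u d := ⟨d, h⟩
  rw [si, dif_pos h0]
  exact h0.choose_spec.unique h

theorem IsSmooth.hasSelfInt (hA : A.IsSmooth) (hu : u ∈ A.rays) : A.HasSelfInt u (A.si u) := by
  obtain ⟨e, f, hne, -, -, h⟩ := A.exists_nbrs hu
  have h1 := (h e).mpr (Or.inl rfl)
  have h2 := (h f).mpr (Or.inr rfl)
  obtain ⟨k, hk⟩ := hA.exists_nbrs_sum h1 h2 hne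
  have : A.HasSelfInt u (-k) := ⟨e, f, hne, h1, h2, by simpa only [neg_neg] using hk⟩
  rwa [this.si_eq]

theorem IsSmooth.hasSelfInt_iff (hA : A.IsSmooth) (hu : u ∈ A.rays) {d : ℤ} :
    A.HasSelfInt u d ↔ A.si u = d :=
  ⟨fun h => h.si_eq, fun h => h ▸ hA.hasSelfInt hu⟩

theorem IsSmooth.nbrs_sum (hA : A.IsSmooth) (h1 : A.Cone u e) (h2 : A.Cone u f) (h : e ≠ f) :
    e + f = (-A.si u) • u := by
  obtain ⟨k, hk⟩ := hA.exists_nbrs_sum h1 h2 h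
  have : A.HasSelfInt u (-k) := ⟨e, f, h, h1, h2, by simpa only [neg_neg] using hk⟩
  rw [this.si_eq, neg_neg, hk]

theorem IsSmooth.det_nbrs_sum (hA : A.IsSmooth) (h1 : A.Cone u e) (h2 : A.Cone u f) (h : e ≠ f)
    (y : NLat) : det y e + det y f = -A.si u * det y u := by
  rw [← det_add_right, hA.nbrs_sum h1 h2 h, det_smul_right]

/-- Maximum principle for curves of self-intersection number at most `-2`. -/
theorem IsSmooth.max_principle (hA : A.IsSmooth) {Q : Finset NLat} (hQ : Q ⊆ A.rays)
    (hne : Q.Nonempty) (y : NLat) (hpos : ∀ x ∈ Q, 0 < det y x)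
    (hout : ∀ x ∈ Q, ∀ z, A.Cone x z → z ∉ Q → det y z < det y x) :
    ∃ x ∈ Q, -1 ≤ A.si x ∧ ∀ z ∈ Q, det y z ≤ det y x := by
  -- Ties in `det y` are broken by the inner product with `y`. If `D_x² ≤ -2`, the neighbours of `x`
  -- sum to at least `2x` in `det y`, so both attain the maximum and the sum is exactly `2x`. They
  -- then lie on a line through `x` parallel to `y`, and the tie-break forces them to equal `x`.
  obtain ⟨x, hx, hm⟩ := Q.exists_max_image
    (fun z : NLat => toLex (det y z, y.1 * z.1 + y.2 * z.2)) hne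
  simp only [Prod.Lex.le_iff, ofLex_toLex] at hm
  have hmax : ∀ z ∈ Q, det y z ≤ det y x := by
    intro z hz; rcases hm z hz with h | h <;> omega
  refine ⟨x, hx, ?_, hmax⟩
  by_contra! hlt
  obtain ⟨e, f, hef, -, -, hnb⟩ := A.exists_nbrs (hQ hx)
  have he := (hnb e).mpr (Or.inl rfl)
  have hf := (hnb f).mpr (Or.inr rfl)
  have hsum := hA.nbrs_sum he hf hef
  have hdet := hA.det_nbrs_sum he hf hef y
  have hx0 := hpos x hx
  have key : ∀ z, A.Cone x z → det y z ≤ det y x := by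
    intro z hz
    by_cases h : z ∈ Q
    · exact hmax z h
    · exact (hout x hx z hz h).le
  have h1 := key e he
  have h2 := key f hf
  have e1 : det y e = det y x := by nlinarith
  have e2 : det y f = det y x := by nlinarith
  have heQ : e ∈ Q := by by_contra h; have := hout x hx e he h; omega
  have hfQ : f ∈ Q := by by_contra h; have := hout x hx f hf h; omega
  have hsi : -A.si x = 2 := by
    rw [e1, e2] at hdet
    have : (-A.si x - 2) * det y x = 0 := by linarith
    rcases mul_eq_zero.mp this with h | h <;> omega
  rw [hsi] at hsum
  have s1 : e.1 + f.1 = 2 * x.1 := by simpa using congrArg Prod.fst hsum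
  have s2 : e.2 + f.2 = 2 * x.2 := by simpa using congrArg Prod.snd hsum
  have h3 : y.1 * e.1 + y.2 * e.2 ≤ y.1 * x.1 + y.2 * x.2 := by
    rcases hm e heQ with h | h <;> omega
  have h4 : y.1 * f.1 + y.2 * f.2 ≤ y.1 * x.1 + y.2 * x.2 := by
    rcases hm f hfQ with h | h <;> omega
  have h5 : y.1 * (e.1 - x.1) + y.2 * (e.2 - x.2) = 0 := by
    have : y.1 * e.1 + y.2 * e.2 + (y.1 * f.1 + y.2 * f.2) = 2 * (y.1 * x.1 + y.2 * x.2) := by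
      linear_combination y.1 * s1 + y.2 * s2
    linarith
  have h6 : y.1 * (e.2 - x.2) - y.2 * (e.1 - x.1) = 0 := by
    simp only [det] at e1; linarith
  have hy : 0 < y.1 * y.1 + y.2 * y.2 := by
    by_contra! h0
    have a1 : y.1 = 0 := by nlinarith [mul_self_nonneg y.1, mul_self_nonneg y.2]
    have a2 : y.2 = 0 := by nlinarith [mul_self_nonneg y.1, mul_self_nonneg y.2]
    simp [det, a1, a2] at hx0
  have g1 : (y.1 * y.1 + y.2 * y.2) * (e.1 - x.1) = 0 := by linear_combination y.1 * h5 - y.2 * h6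
  have g2 : (y.1 * y.1 + y.2 * y.2) * (e.2 - x.2) = 0 := by linear_combination y.2 * h5 + y.1 * h6
  have g3 := (mul_eq_zero.mp g1).resolve_left hy.ne'
  have g4 := (mul_eq_zero.mp g2).resolve_left hy.ne'
  exact he.ne (Prod.ext (by omega) (by omega))

/-- The invariant curves of self-intersection number at least `-1`. -/
noncomputable def big (A : ToricSurface) : Finset NLat := A.rays.filter fun u => -1 ≤ A.si u

theorem mem_big : u ∈ A.big ↔ u ∈ A.rays ∧ -1 ≤ A.si u := by simp [big]

/-- Every functional that is positive on some ray attains its maximum at a big ray, by the maximum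
principle on the open half-plane. -/
theorem IsSmooth.posSpans_big (hA : A.IsSmooth) : PosSpans A.big := by
  intro y hy
  obtain ⟨u, hu, hpos⟩ := A.posSpans y hy
  obtain ⟨x, hx, h, -⟩ := hA.max_principle (Q := A.rays.filter fun u => 0 < det y u)
    (Finset.filter_subset ..) ⟨u, by simp [hu, hpos]⟩ y (by simp) (by
      intro x hx z hz hzQ
      simp only [Finset.mem_filter, hz.right, true_and] at hx hzQ
      omega)
  simp only [Finset.mem_filter] at hx
  exact ⟨x, mem_big.mpr ⟨hx.1, h⟩, hx.2⟩

/-- A smooth surface with exactly three curves of self-intersection number at least `-1`. -/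
def IsThree (A : ToricSurface) : Prop := A.IsSmooth ∧ A.big.card = 3

/-- If only one big curve lies on the positive side of a functional, it maximizes the
functional. -/
theorem IsSmooth.le_of_unique_big (hA : A.IsSmooth) (hw : ∀ z ∈ A.big, 0 < det y z → z = w)
    (hx : x ∈ A.rays) (hpos : 0 < det y x) : det y x ≤ det y w := by
  obtain ⟨z, hz, h, hm⟩ := hA.max_principle (Q := A.rays.filter fun u => 0 < det y u)
    (Finset.filter_subset ..) ⟨x, by simp [hx, hpos]⟩ y (by simp) (by
      intro x hx z hz hzQ
      simp only [Finset.mem_filter, hz.right, true_and] at hx hzQ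
      omega)
  simp only [Finset.mem_filter] at hz hm
  rw [← hw z (mem_big.mpr ⟨hz.1, h⟩) hz.2]
  exact hm x ⟨hx, hpos⟩

/-- A smooth cone contains no ray in its interior if all rays there are of self-intersection number at most `-2`. -/
theorem IsSmooth.not_mem_interior (hA : A.IsSmooth) {p q : NLat} (hpq : det p q = 1)
    (h : ∀ x ∈ A.rays, 0 < det p x → 0 < det x q → A.si x ≤ -2) (hx : x ∈ A.rays)
    (h1 : 0 < det p x) (h2 : 0 < det x q) : False := by
  -- The functional is the sum of the coordinates in the basis `p, q`.
  have hval : ∀ z, det (p - q) z = det p z + det z q := by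
    intro z; rw [det_sub_left, det_swap z q]; ring
  obtain ⟨z, hz, hbig, -⟩ := hA.max_principle
    (Q := A.rays.filter fun u => 0 < det p u ∧ 0 < det u q)
    (Finset.filter_subset ..) ⟨x, by simp [hx, h1, h2]⟩ (p - q)
    (by intro x hx; simp only [Finset.mem_filter] at hx; rw [hval]; omega) (by
      intro x hx z hz hzQ
      simp only [Finset.mem_filter, hz.right, true_and] at hx hzQ
      rw [hval, hval]
      obtain ⟨hx, ha, hb⟩ := hx
      -- In these coordinates, passing from `(a, b)` in the open quadrant to a unimodular neighbour
      -- `(c, d)` outside it lowers the coordinate sum. This is the boundary condition of the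
      -- maximum principle.
      have key : ∀ a b c d n : ℤ, 0 < a → 0 < b → (n = 1 ∨ n = -1) → ¬(0 < c ∧ 0 < d) →
          a * d - c * b = n → c + d < a + b := by
        intro a b c d n ha hb hn hcd he
        by_contra! hlt
        by_cases hc : 0 < c
        · have hd : d ≤ 0 := by by_contra! h; exact hcd ⟨hc, h⟩
          have h1 : (a + b - d) * b ≤ c * b := mul_le_mul_of_nonneg_right (by omega) hb.le
          have h2 : a * d ≤ 0 := mul_nonpos_of_nonneg_of_nonpos ha.le hd
          have h3 : b * d ≤ 0 := mul_nonpos_of_nonneg_of_nonpos hb.le hd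
          have h4 : 0 < a * b := mul_pos ha hb
          have h5 : 0 < b * b := mul_pos hb hb
          rcases hn with rfl | rfl <;> linarith
        · have hc' : c ≤ 0 := by omega
          have h1 : a * (a + b - c) ≤ a * d := mul_le_mul_of_nonneg_left (by omega) ha.le
          have h2 : a * c ≤ 0 := mul_nonpos_of_nonneg_of_nonpos ha.le hc'
          have h3 : b * c ≤ 0 := mul_nonpos_of_nonneg_of_nonpos hb.le hc'
          have h4 : 0 < a * b := mul_pos ha hb
          have h5 : 0 < a * a := mul_pos ha ha
          rcases hn with rfl | rfl <;> linarith
      refine key _ _ _ _ (-det x z) ha hb ?_ hzQ ?_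
      · rcases Int.isUnit_iff.mp (hA x z hz) with h | h <;> omega
      have := det_pluecker p q x z
      rw [hpq, det_swap x q, det_swap z q] at this
      linarith)
  simp only [Finset.mem_filter] at hz
  have := h z hz.1 hz.2.1 hz.2.2
  omega

/-! ### Refinements and minimal resolutions. -/

theorem refines_of_subset (h : S.rays ⊆ A.rays) : A.Refines S := by
  have main : ∀ x y, A.Cone x y → 0 < det x y →
      ∃ a b, S.Cone a b ∧ ∀ z, InCone x y z → InCone a b z := by
    intro x y hc hd
    -- The cone of `S` through the interior point `x + y` must contain all of `cone(x, y)`, since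
    -- otherwise `a` or `b` would be a ray inside that cone.
    obtain ⟨a, b, hab, hin⟩ := S.complete (x + y)
    wlog hpos : 0 < det a b generalizing a b
    · obtain ⟨a', b', h1, h2⟩ := this b a (SpansCone.symm hab) hin.symm (by
        have := hab.2.2.1; rw [det_swap a b]; omega)
      exact ⟨a', b', h1, h2⟩
    refine ⟨a, b, hab, ?_⟩
    rw [inCone_iff hpos, det_add_right, det_add_left] at hin
    have na := fun h1 h2 => hc.not_interior (h hab.1) h1 h2 hd
    have nb := fun h1 h2 => hc.not_interior (h hab.2.1) h1 h2 hd
    rw [det_swap a x] at na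
    rw [det_swap b y |> fun h => (by rw [det_swap y b] : det b y = -det y b)] at nb
    have h1 : 0 ≤ det a x := by by_contra! hlt; exact na (by omega) (by omega)
    have h2 : 0 ≤ det y b := by by_contra! hlt; exact nb (by omega) (by omega)
    have P := det_pluecker a b x y
    rw [det_swap x b, det_swap y b] at P
    have hP : 0 < det a b * det x y := mul_pos hpos hd
    have h3 : 0 ≤ det a y := by
      by_contra! hlt
      by_cases hxb : 0 ≤ det x b <;> nlinarith
    have h4 : 0 ≤ det x b := by
      by_contra! hlt
      nlinarith
    intro z hz
    rw [inCone_iff hd] at hz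
    rw [inCone_iff hpos]
    have E1 : det x y * det a z = det z y * det a x + det x z * det a y := by
      rw [← det_smul_right, det_smul_eq x y z, det_add_right, det_smul_right, det_smul_right]
    have E2 : det x y * det z b = det z y * det x b + det x z * det y b := by
      rw [← det_smul_left, det_smul_eq x y z, det_add_left, det_smul_left, det_smul_left]
    constructor
    · exact nonneg_of_mul_nonneg_right (by rw [E1]; nlinarith) hd
    · exact nonneg_of_mul_nonneg_right (by rw [E2]; nlinarith) hd
  intro x y hc
  rcases hc.exists_pos with hd | hd
  · exact main x y hc hd
  · obtain ⟨a, b, h1, h2⟩ := main y x hc.symm hd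
    exact ⟨a, b, h1, fun z hz => h2 z hz.symm⟩

/-- An edge of a cone is extremal: if `a` is a combination of `x` and `y` lying in a cone with edge
`a`, then `x` or `y` is on that edge. -/
theorem Refines.subset (h : A.Refines S) : S.rays ⊆ A.rays := by
  have main : ∀ a ∈ S.rays, ∀ x y d, A.Cone x y → InCone x y a → S.Cone a d →
      (∀ z, InCone x y z → InCone a d z) → a ∈ A.rays := by
    intro a ha x y d hxy hin had hsub
    have aux : ∀ x ∈ A.rays, InCone a d x → det a x = 0 → x = a := by
      intro x hx h1 h2
      rcases (S.primitive a ha).eq_or_eq_neg (A.primitive x hx) h2 with h | h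
      · exact h
      · have := (inCone_mul h1 had.det_ne).2
        rw [h, det_neg_left] at this
        have := had.det_ne
        nlinarith [mul_self_pos.mpr this]
    have hx := hsub x ⟨1, 0, 1, one_pos, by simp⟩
    have hy := hsub y ⟨0, 1, 1, one_pos, by simp⟩
    have hx' := (inCone_mul hx had.det_ne).1
    have hy' := (inCone_mul hy had.det_ne).1
    obtain ⟨α, β, c, hc, he⟩ := hin
    have h0 : (α : ℤ) * det a x + β * det a y = 0 := by
      rw [← det_nsmul_right, ← det_nsmul_right, ← det_add_right, ← he, det_nsmul_right, det_self,
        mul_zero]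
    have e1 : (0 : ℤ) ≤ α * (det a d * det a x) := by positivity
    have e2 : (0 : ℤ) ≤ β * (det a d * det a y) := by positivity
    have e3 : (α * (det a d * det a x) + β * (det a d * det a y) : ℤ) = 0 := by
      linear_combination det a d * h0
    have e4 : (α : ℤ) * (det a d * det a x) = 0 := by linarith
    have e5 : (β : ℤ) * (det a d * det a y) = 0 := by linarith
    by_cases hα : α = 0
    · by_cases hβ : β = 0
      · subst hα hβ
        rw [zero_smul, zero_smul, add_zero] at he
        exact absurd ((smul_eq_zero.mp he).resolve_left hc.ne') (S.ne_zero ha)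
      · have : det a y = 0 := by
          simpa [hβ, had.det_ne] using e5
        rw [← aux y hxy.right hy this]; exact hxy.right
    · have : det a x = 0 := by simpa [hα, had.det_ne] using e4
      rw [← aux x hxy.left hx this]; exact hxy.left
  intro a ha
  obtain ⟨x, y, hxy, hin⟩ := A.complete a
  obtain ⟨c, d, hcd, hsub⟩ := h x y hxy
  rcases hcd.2.2.2 a ha (hsub a hin) with rfl | rfl
  · exact main _ ha x y d hxy hin hcd hsub
  · exact main _ ha x y c hxy hin (Cone.symm hcd) fun z hz => (hsub z hz).symm

theorem refines_iff : A.Refines S ↔ S.rays ⊆ A.rays := ⟨Refines.subset, refines_of_subset⟩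

/-- A ray of a refinement which is not a ray lies in the interior of a maximal cone. -/
theorem exists_cone_interior (hx : IsPrimitive x) (hxS : x ∉ S.rays) :
    ∃ a b, S.Cone a b ∧ 0 < det a b ∧ 0 < det a x ∧ 0 < det x b := by
  obtain ⟨a, b, hab, hin⟩ := S.complete x
  wlog hpos : 0 < det a b generalizing a b
  · exact this b a (SpansCone.symm hab) hin.symm (by
      have := hab.2.2.1; rw [det_swap a b]; omega)
  rw [inCone_iff hpos] at hin
  refine ⟨a, b, hab, hpos, hin.1.lt_of_ne fun h => hxS ?_, hin.2.lt_of_ne fun h => hxS ?_⟩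
  · have := (S.primitive a hab.1).eq_of_det (y := -b) hx h.symm
      (by rw [det_neg_left, ← det_swap]; exact hpos) (by rw [det_neg_left, ← det_swap]; exact hin.2)
    rw [this]; exact hab.1
  · have := (S.primitive b hab.2.1).eq_of_det (y := a) hx (by rw [det_swap x b]; omega)
      hpos hin.1
    rw [this]; exact hab.2.1

/-- Exceptional curves have negative self-intersection number. -/
theorem IsSmooth.si_neg_of_exceptional (hA : A.IsSmooth) (hSA : S.rays ⊆ A.rays)
    (hx : x ∈ A.rays) (hxS : x ∉ S.rays) : A.si x < 0 := by
  obtain ⟨a, b, hab, hpos, h1, h2⟩ := exists_cone_interior (S := S) (A.primitive x hx) hxS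
  obtain ⟨z, y, hne, hz, hy, hnb⟩ := A.exists_nbrs hx
  have cz := (hnb z).mpr (Or.inl rfl)
  have cy := (hnb y).mpr (Or.inr rfl)
  by_contra! hk
  have h3 : det y b ≥ 0 := by
    by_contra! h
    exact cy.not_interior (hSA hab.2.1) h2 (by rw [det_swap y b]; omega) hy
  have h4 : det a z ≥ 0 := by
    by_contra! h
    exact cz.symm.not_interior (hSA hab.1) (by rw [det_swap a z]; omega) h1
      (by rw [det_swap x z]; omega)
  have h5 := hA.det_nbrs_sum cz cy hne a
  have h6 : det a y ≤ 0 := by nlinarith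
  have P := det_pluecker a b x y
  rw [det_swap x b, det_swap y b] at P
  have : 0 < det a b * det x y := mul_pos hpos hy
  nlinarith

/-- Exceptional curves are negative anyway, so excluding `-1` leaves `D² ≤ -2`. -/
theorem isMinRes_iff : IsMinRes A S ↔
    A.IsSmooth ∧ S.rays ⊆ A.rays ∧ ∀ u ∈ A.rays, u ∉ S.rays → A.si u ≤ -2 := by
  unfold IsMinRes
  rw [refines_iff]
  constructor
  · rintro ⟨h1, h2, h3⟩
    refine ⟨h1, h2, fun u hu hS => ?_⟩
    have := h1.si_neg_of_exceptional h2 hu hS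
    have h4 := h3 u hu hS
    rw [h1.hasSelfInt_iff hu] at h4
    omega
  · rintro ⟨h1, h2, h3⟩
    refine ⟨h1, h2, fun u hu hS h => ?_⟩
    have := h3 u hu hS
    rw [h.si_eq] at this
    omega

/-- A ray of one resolution missing from the other would lie inside a smooth cone of the latter. All
rays of the former inside that cone are exceptional, contrary to `IsSmooth.not_mem_interior`. -/
theorem IsMinRes.unique (hA : IsMinRes A S) (hB : IsMinRes B S) : A = B := by
  rw [isMinRes_iff] at hA hB
  have main : ∀ A B : ToricSurface, A.IsSmooth → B.IsSmooth → S.rays ⊆ B.rays →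
      (∀ u ∈ A.rays, u ∉ S.rays → A.si u ≤ -2) → A.rays ⊆ B.rays := by
    intro A B hA hB hSB h x hx
    by_contra hxB
    obtain ⟨p, q, hpq, hd, h1, h2⟩ := exists_cone_interior (S := B) (A.primitive x hx) hxB
    exact hA.not_mem_interior (hB.det_eq_one hpq hd)
      (fun z hz hz1 hz2 => h z hz fun hzS => hpq.not_interior (hSB hzS) hz1 hz2 hd) hx h1 h2
  exact ext_rays (Finset.Subset.antisymm (main A B hA.1 hB.1 hB.2.1 hA.2.2)
    (main B A hB.1 hA.1 hA.2.1 hB.2.2))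

theorem IsMinRes.big_subset (h : IsMinRes A S) : A.big ⊆ S.rays := by
  rw [isMinRes_iff] at h
  intro u hu
  rw [mem_big] at hu
  by_contra hS
  have := h.2.2 u hu.1 hS
  omega

/-- Big curves are not exceptional, and a positively spanning set has at least three members. -/
theorem IsMinRes.big_eq (h : IsMinRes A S) (h3 : S.rays.card = 3) : A.big = S.rays :=
  Finset.eq_of_subset_of_card_le h.big_subset (h3 ▸ h.1.posSpans_big.three_le_card)

theorem IsMinRes.isThree (h : IsMinRes A S) (h3 : S.rays.card = 3) : A.IsThree :=
  ⟨h.1, by rw [h.big_eq h3, h3]⟩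

/-- The way back from a smooth surface: all curves with `D² ≤ -2` can be contracted at once. -/
theorem IsSmooth.exists_isMinRes_big (hA : A.IsSmooth) : ∃ S, S.rays = A.big ∧ IsMinRes A S := by
  refine ⟨ofPosSpans A.big (fun u hu => A.primitive u (mem_big.mp hu).1) hA.posSpans_big, rfl,
    isMinRes_iff.mpr ⟨hA, fun u hu => (mem_big.mp hu).1, fun u hu hS => ?_⟩⟩
  by_contra! h
  exact hS (mem_big.mpr ⟨hu, by omega⟩)

end ToricSurface
end ToricCascade

namespace ToricCascade
namespace ToricSurface

variable {S A B : ToricSurface} {u v w x y e f : NLat}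

/-! ### The Picard number. -/

section Picard

/-- Every invariant divisor becomes Cartier after multiplication by the product of the cone
determinants (Cramer's rule), so the Cartier divisors have full rank. -/
theorem finrank_cartier (S : ToricSurface) : Module.finrank ℤ S.cartier = S.rays.card := by
  classical
  have hcard : Module.finrank ℤ (S.rays → ℤ) = S.rays.card := by simp
  refine le_antisymm ?_ ?_
  · rw [← hcard]
    exact Submodule.finrank_le _
  -- The product runs over all pairs of rays; the value `1` at dependent pairs keeps it nonzero.
  · let δ : S.rays × S.rays → ℤ := fun p => if det p.1 p.2 = 0 then 1 else det p.1 p.2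
    have hN : ∏ p, δ p ≠ 0 := by
      rw [Finset.prod_ne_zero_iff]
      intro p _
      simp only [δ]
      split_ifs with h
      · exact one_ne_zero
      · exact h
    have hmem : ∀ D : S.rays → ℤ, ((∏ p, δ p) • LinearMap.id : (S.rays → ℤ) →ₗ[ℤ] _) D ∈ S.cartier := by
      intro D u v huv
      obtain ⟨k, hk⟩ := Finset.dvd_prod_of_mem δ (Finset.mem_univ (u, v))
      have hd : δ (u, v) = det u v := if_neg huv.det_ne
      refine ⟨(k * D u) • (-detL v) + (k * D v) • detL u, ?_, ?_⟩
      · simp only [LinearMap.add_apply, LinearMap.smul_apply, LinearMap.neg_apply, detL_apply,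
          det_self, LinearMap.id_apply, Pi.smul_apply, smul_eq_mul, hk, hd]
        rw [det_swap (u : NLat) v]; ring
      · simp only [LinearMap.add_apply, LinearMap.smul_apply, LinearMap.neg_apply, detL_apply,
          det_self, LinearMap.id_apply, Pi.smul_apply, smul_eq_mul, hk, hd]
        ring
    rw [← hcard]
    refine LinearMap.finrank_le_finrank_of_injective
      (f := LinearMap.codRestrict S.cartier ((∏ p, δ p) • LinearMap.id) hmem) ?_
    intro D D' h
    have h1 := congrArg Subtype.val h
    simp only [LinearMap.codRestrict_apply, LinearMap.smul_apply, LinearMap.id_apply] at h1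
    exact smul_right_injective _ hN h1

theorem divHom_injective (S : ToricSurface) : Function.Injective S.divHom := by
  rw [injective_iff_map_eq_zero]
  intro m hm
  obtain ⟨u, v, h, -⟩ := S.complete 0
  obtain ⟨y, rfl⟩ := exists_eq_detL m
  have h1 : det y u = 0 := congrFun hm ⟨u, h.1⟩
  have h2 : det y v = 0 := congrFun hm ⟨v, h.2.1⟩
  have : y = 0 := eq_zero_of_det h.2.2.1 (by rw [det_swap y, h1, neg_zero])
    (by rw [det_swap y, h2, neg_zero])
  ext <;> simp [this, det_zero_left]

/-- Ranks in the exact sequence `0 → M → CDiv → Pic → 0`, where `M` has rank two. -/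
theorem picardNumber_add_two (S : ToricSurface) : S.picardNumber + 2 = S.rays.card := by
  have hle : LinearMap.range S.divHom ≤ S.cartier := by
    rintro _ ⟨m, rfl⟩ u v _
    exact ⟨m, rfl, rfl⟩
  have h1 := Submodule.finrank_quotient_add_finrank
    ((LinearMap.range S.divHom).submoduleOf S.cartier)
  have h2 : Module.finrank ℤ ((LinearMap.range S.divHom).submoduleOf S.cartier) = 2 := by
    rw [(Submodule.submoduleOfEquivOfLe hle).finrank_eq,
      LinearMap.finrank_range_of_inj S.divHom_injective, Module.finrank_linearMap]
    simp
  rw [h2, finrank_cartier] at h1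
  exact h1

end Picard

/-! ### Log terminality and ampleness are automatic. -/

section DelPezzo

theorem exists_anticanonical_functional (h : det u v ≠ 0) :
    ∃ m : NLat →ₗ[ℤ] ℚ, m u = -1 ∧ m v = -1 ∧ ∀ x, m x = (det (v - u) x : ℚ) / det u v := by
  have h' : (det u v : ℚ) ≠ 0 := by exact_mod_cast h
  refine ⟨{ toFun := fun x => (det (v - u) x : ℚ) / det u v, map_add' := ?_, map_smul' := ?_ },
    ?_, ?_, fun x => rfl⟩
  · intro x y; rw [det_add_right]; push_cast; ring
  · intro k x; rw [det_smul_right]; push_cast; simp only [zsmul_eq_mul]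
    rw [mul_div_assoc]; simp
  · simp only [LinearMap.coe_mk, AddHom.coe_mk]
    rw [det_sub_left, det_self, det_swap u v]; push_cast; field_simp; ring
  · simp only [LinearMap.coe_mk, AddHom.coe_mk]
    rw [det_sub_left, det_self]; push_cast; field_simp; ring

/-- The functional is negative at both generators, hence on every nonzero vector of the cone. -/
theorem isLogTerminal (S : ToricSurface) : S.IsLogTerminal := by
  intro u v huv
  obtain ⟨m, h1, h2, -⟩ := exists_anticanonical_functional huv.det_ne
  refine ⟨m, h1, h2, fun x hx hin => ?_⟩
  obtain ⟨a, b, c, hc, he⟩ := hin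
  have h3 := congrArg m he
  rw [map_add, map_nsmul, map_nsmul, map_nsmul, h1, h2] at h3
  simp only [nsmul_eq_mul] at h3
  have hab : 0 < a + b := by
    by_contra! h
    have ha : a = 0 := by omega
    have hb : b = 0 := by omega
    rw [ha, hb, zero_smul, zero_smul, add_zero] at he
    exact hx.ne_zero ((smul_eq_zero.mp he).resolve_left hc.ne')
  have hab' : (0 : ℚ) < a + b := by exact_mod_cast hab
  have hc' : (0 : ℚ) < c := by exact_mod_cast hc
  by_contra! hcon
  have : 0 ≤ m x := by linarith
  nlinarith [mul_nonneg hc'.le this]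

theorem det_pos_of_rays_eq (h : S.rays = {u, v, w}) (hd : 0 < det u v) :
    0 < det v w ∧ 0 < det w u := by
  have hu : u ∈ S.rays := by simp [h]
  have hv : v ∈ S.rays := by simp [h]
  constructor
  · obtain ⟨z, hz, hpos⟩ := S.posSpans v (ne_zero hv)
    simp only [h, Finset.mem_insert, Finset.mem_singleton] at hz
    rcases hz with rfl | rfl | rfl
    · rw [det_swap z v] at hpos; omega
    · simp [det_self] at hpos
    · exact hpos
  · obtain ⟨z, hz, hpos⟩ := S.posSpans (-u) (by simpa using ne_zero hu)
    rw [det_neg_left, ← det_swap] at hpos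
    simp only [h, Finset.mem_insert, Finset.mem_singleton] at hz
    rcases hz with rfl | rfl | rfl
    · simp [det_self] at hpos
    · rw [det_swap u z] at hpos; omega
    · exact hpos

theorem cone_of_rays_eq (h : S.rays = {u, v, w}) (hd : 0 < det u v) : S.Cone u v := by
  have h1 := det_pos_of_rays_eq h hd
  refine (spansCone_iff hd).mpr ⟨by simp [h], by simp [h], fun z hz h2 h3 => ?_⟩
  simp only [h, Finset.mem_insert, Finset.mem_singleton] at hz
  rcases hz with rfl | rfl | rfl
  · exact Or.inl rfl
  · exact Or.inr rfl
  · rw [det_swap z u] at h2; omega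

theorem exists_triangle (h : S.rays.card = 3) :
    ∃ u v w, S.rays = {u, v, w} ∧ 0 < det u v ∧ 0 < det v w ∧ 0 < det w u := by
  obtain ⟨u, v, w, -, -, -, huvw⟩ := Finset.card_eq_three.mp h
  obtain ⟨z, hz, hpos⟩ := S.posSpans u (ne_zero (S := S) (by simp [huvw]))
  simp only [huvw, Finset.mem_insert, Finset.mem_singleton] at hz
  rcases hz with rfl | rfl | rfl
  · simp [det_self] at hpos
  · exact ⟨u, z, w, huvw, hpos, det_pos_of_rays_eq huvw hpos⟩
  · have huvw' : S.rays = {u, z, v} := by rw [huvw, Finset.pair_comm]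
    exact ⟨u, z, v, huvw', hpos, det_pos_of_rays_eq huvw' hpos⟩

/-- The third ray is opposite to the cone of the other two, so the functional equal to `-1` on these
two is even positive there. -/
theorem isAmple_of_card (h : S.rays.card = 3) : S.IsAmple S.antiCanonical := by
  classical
  have main : ∀ u v : S.rays, S.Cone u v → 0 < det (u : NLat) v →
    ∃ m : NLat →ₗ[ℤ] ℚ, m u = - 1 ∧ m v = - 1 ∧
      ∀ w : S.rays, w ≠ u → w ≠ v → - 1 < m w := by
    intro u v huv hd
    obtain ⟨m, h1, h2, h3⟩ := exists_anticanonical_functional huv.det_ne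
    refine ⟨m, h1, h2, fun w hwu hwv => ?_⟩
    have hr : S.rays = {u.1, v.1, w.1} := by
      symm
      refine Finset.eq_of_subset_of_card_le ?_ ?_
      · intro z hz
        simp only [Finset.mem_insert, Finset.mem_singleton] at hz
        rcases hz with rfl | rfl | rfl <;> simp
      · rw [h, Finset.card_eq_three.mpr ⟨u.1, v.1, w.1, huv.ne, fun h => hwu (Subtype.ext h.symm),
          fun h => hwv (Subtype.ext h.symm), rfl⟩]
    obtain ⟨e1, e2⟩ := det_pos_of_rays_eq hr hd
    have : (0 : ℚ) < m w := by
      rw [h3]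
      have e3 : 0 < det (v.1 - u.1) w.1 := by
        rw [det_sub_left, det_swap w.1 u.1]; omega
      have e4 : (0 : ℚ) < det (v.1 - u.1) w.1 := by exact_mod_cast e3
      have e5 : (0 : ℚ) < det u.1 v.1 := by exact_mod_cast hd
      positivity
    linarith
  intro u v huv
  rcases huv.exists_pos with hd | hd
  · exact main u v huv hd
  · obtain ⟨m, h1, h2, h3⟩ := main v u huv.symm hd
    exact ⟨m, h2, h1, fun w h4 h5 => h3 w h5 h4⟩

theorem isLDP₁_iff : S.IsLDP₁ ↔ S.rays.card = 3 := by
  have := S.picardNumber_add_two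
  constructor
  · rintro ⟨-, h⟩; omega
  · intro h
    exact ⟨⟨S.isLogTerminal, isAmple_of_card h⟩, by omega⟩

end DelPezzo

/-! ### Contraction of a `(-1)`-curve. -/

section Contraction

/-- `B` is the contraction of the `(-1)`-curve `D_u` of `A`, whose neighbours are `D_e`, `D_f`. -/
structure Contracts (A B : ToricSurface) (u e f : NLat) : Prop where
  cone_left : A.Cone u e
  cone_right : A.Cone u f
  ne : e ≠ f
  sum : e + f = u
  rays : B.rays = A.rays.erase u

namespace Contracts

variable (h : Contracts A B u e f)
include h

theorem symm : Contracts A B u f e :=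
  ⟨h.cone_right, h.cone_left, h.ne.symm, by rw [add_comm, h.sum], h.rays⟩

theorem mem : u ∈ A.rays := h.cone_left.left

theorem mem_iff : x ∈ B.rays ↔ x ≠ u ∧ x ∈ A.rays := by rw [h.rays, Finset.mem_erase]

theorem e_mem : e ∈ B.rays := h.mem_iff.mpr ⟨h.cone_left.ne.symm, h.cone_left.right⟩

theorem card : B.rays.card < A.rays.card := by
  rw [h.rays]; exact Finset.card_erase_lt_of_mem h.mem

theorem cone_of_cone (hxy : A.Cone x y) (hx : x ≠ u) (hy : y ≠ u) : B.Cone x y :=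
  ⟨h.mem_iff.mpr ⟨hx, hxy.left⟩, h.mem_iff.mpr ⟨hy, hxy.right⟩, hxy.det_ne,
    fun w hw hin => hxy.2.2.2 w (h.mem_iff.mp hw).2 hin⟩

theorem det_eq : det e f = -det u e := by
  rw [← h.sum, det_add_left, det_self, det_swap e f]; ring

theorem cone_new : B.Cone e f := by
  refine ⟨h.e_mem, h.symm.e_mem, ?_, fun w hw hin => ?_⟩
  · rw [h.det_eq]; exact neg_ne_zero.mpr h.cone_left.det_ne
  · rw [h.mem_iff] at hw
    obtain ⟨a, b, c, hc, hw'⟩ := hin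
    have hs := h.sum
    rcases le_total a b with hab | hab
    · right
      have : InCone u f w := by
        refine ⟨a, b - a, c, hc, ?_⟩
        obtain ⟨k, rfl⟩ := Nat.exists_eq_add_of_le hab
        rw [hw', ← hs, Nat.add_sub_cancel_left, add_smul, smul_add]; abel
      exact (h.cone_right.2.2.2 w hw.2 this).resolve_left hw.1
    · left
      have : InCone u e w := by
        refine ⟨b, a - b, c, hc, ?_⟩
        obtain ⟨k, rfl⟩ := Nat.exists_eq_add_of_le hab
        rw [hw', ← hs, Nat.add_sub_cancel_left, add_smul, smul_add]; abel
      exact (h.cone_left.2.2.2 w hw.2 this).resolve_left hw.1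

theorem not_cone : ¬A.Cone e f := by
  intro hc
  have := hc.2.2.2 u h.mem ⟨1, 1, 1, one_pos, by simp [h.sum]⟩
  rcases this with h1 | h1
  · exact h.cone_left.ne h1
  · exact h.cone_right.ne h1

theorem exists_other : ∃ g, A.Cone e g ∧ g ≠ u ∧ g ≠ f := by
  obtain ⟨g, hg, hne⟩ := h.cone_left.symm.exists_other
  exact ⟨g, hg, hne.symm, fun hgf => h.not_cone (hgf ▸ hg)⟩

theorem eq_or_eq (hx : A.Cone u x) : x = e ∨ x = f :=
  h.cone_left.eq_or_eq h.cone_right h.ne hx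

/-- Rays away from `u` keep both neighbours, while `e` and `f` exchange the neighbour `u` for each
other. Since a ray has only two neighbours, nothing else changes. -/
theorem cone_iff : B.Cone x y ↔
    (A.Cone x y ∧ x ≠ u ∧ y ≠ u) ∨ (x = e ∧ y = f) ∨ (x = f ∧ y = e) := by
  constructor
  · intro hxy
    have hx := h.mem_iff.mp hxy.left
    have hy := h.mem_iff.mp hxy.right
    by_cases hxu : A.Cone x u
    · have aux : ∀ {e f}, Contracts A B u e f → B.Cone e y →
          (A.Cone e y ∧ e ≠ u ∧ y ≠ u) ∨ (e = e ∧ y = f) ∨ (e = f ∧ y = e) := by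
        intro e f h hxy
        obtain ⟨g, hg, hgu, hgf⟩ := h.exists_other
        rcases (h.cone_of_cone hg h.cone_left.ne.symm hgu).eq_or_eq h.cone_new hgf hxy with rfl | rfl
        · exact Or.inl ⟨hg, h.cone_left.ne.symm, hgu⟩
        · exact Or.inr (Or.inl ⟨rfl, rfl⟩)
      rcases h.eq_or_eq hxu.symm with rfl | rfl
      · exact aux h hxy
      · rcases aux h.symm hxy with h1 | h1 | h1
        · exact Or.inl h1
        · exact Or.inr (Or.inr h1)
        · exact Or.inr (Or.inl h1)
    · obtain ⟨a, b, hne, -, -, hab⟩ := A.exists_nbrs hx.2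
      have ha := (hab a).mpr (Or.inl rfl)
      have hb := (hab b).mpr (Or.inr rfl)
      left
      refine ⟨?_, hx.1, hy.1⟩
      rcases (h.cone_of_cone ha hx.1 fun h => hxu (h ▸ ha)).eq_or_eq
        (h.cone_of_cone hb hx.1 fun h => hxu (h ▸ hb)) hne hxy with rfl | rfl
      · exact ha
      · exact hb
  · rintro (⟨h1, h2, h3⟩ | ⟨rfl, rfl⟩ | ⟨rfl, rfl⟩)
    · exact h.cone_of_cone h1 h2 h3
    · exact h.cone_new
    · exact h.cone_new.symm

theorem isSmooth (hA : A.IsSmooth) : B.IsSmooth := by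
  intro x y hxy
  rcases h.cone_iff.mp hxy with ⟨h1, -, -⟩ | ⟨rfl, rfl⟩ | ⟨rfl, rfl⟩
  · exact hA x y h1
  · rw [h.det_eq]; exact (hA _ _ h.cone_left).neg
  · rw [h.symm.det_eq]; exact (hA _ _ h.cone_right).neg

theorem hasSelfInt_neg_one : A.HasSelfInt u (-1) :=
  ⟨e, f, h.ne, h.cone_left, h.cone_right, by rw [h.sum, neg_neg, one_smul]⟩

theorem isBlowDownAt : IsBlowDownAt A B u := ⟨h.hasSelfInt_neg_one, h.rays⟩

theorem si_u : A.si u = -1 := h.hasSelfInt_neg_one.si_eq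

/-- The neighbour `u` of `e` is replaced by `f = u - e`. -/
theorem si_left (hA : A.IsSmooth) : B.si e = A.si e + 1 := by
  obtain ⟨g, hg, hgu, hgf⟩ := h.exists_other
  have h1 := hA.nbrs_sum h.cone_left.symm hg hgu.symm
  refine HasSelfInt.si_eq ⟨f, g, hgf.symm, h.cone_new,
    h.cone_of_cone hg h.cone_left.ne.symm hgu, ?_⟩
  have h2 : f + g = u + g - e := by rw [← h.sum]; abel
  rw [h2, h1, neg_add, add_smul, neg_one_smul, sub_eq_add_neg]

theorem si_right (hA : A.IsSmooth) : B.si f = A.si f + 1 := h.symm.si_left hA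

theorem si_of_ne (hA : A.IsSmooth) (hx : x ∈ A.rays) (hu : x ≠ u) (he : x ≠ e) (hf : x ≠ f) :
    B.si x = A.si x := by
  obtain ⟨a, b, hne, -, -, hab⟩ := A.exists_nbrs hx
  have ha := (hab a).mpr (Or.inl rfl)
  have hb := (hab b).mpr (Or.inr rfl)
  have aux : ∀ {a}, A.Cone x a → a ≠ u := by
    rintro a ha rfl
    rcases h.eq_or_eq ha.symm with h | h
    · exact he h
    · exact hf h
  exact HasSelfInt.si_eq ⟨a, b, hne, h.cone_of_cone ha hu (aux ha), h.cone_of_cone hb hu (aux hb),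
    hA.nbrs_sum ha hb hne⟩

theorem si_le (hA : A.IsSmooth) (hx : x ∈ A.rays) (hu : x ≠ u) : A.si x ≤ B.si x := by
  by_cases he : x = e
  · subst he; rw [h.si_left hA]; omega
  · by_cases hf : x = f
    · subst hf; rw [h.si_right hA]; omega
    · rw [h.si_of_ne hA hx hu he hf]

end Contracts

theorem IsBlowDownAt.exists_contracts (h : IsBlowDownAt A B u) : ∃ e f, Contracts A B u e f := by
  obtain ⟨⟨e, f, hne, he, hf, hsum⟩, hr⟩ := h
  exact ⟨e, f, he, hf, hne, by rw [hsum, neg_neg, one_smul], hr⟩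

theorem IsSmooth.nbrs_sum_of_neg_one (hA : A.IsSmooth) (he : A.Cone u e) (hf : A.Cone u f)
    (hne : e ≠ f) (hsi : A.si u = -1) : e + f = u := by
  rw [hA.nbrs_sum he hf hne, hsi, neg_neg, one_smul]

/-- Since `u = e + f`, a functional positive at `u` is positive at `e` or `f`, so the fan stays
complete. -/
theorem IsSmooth.exists_contracts (hA : A.IsSmooth) (he : A.Cone u e) (hf : A.Cone u f)
    (hne : e ≠ f) (hsi : A.si u = -1) : ∃ B, Contracts A B u e f := by
  have hsum := hA.nbrs_sum_of_neg_one he hf hne hsi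
  refine ⟨ofPosSpans (A.rays.erase u) (fun v hv => A.primitive v (Finset.mem_of_mem_erase hv)) ?_,
    he, hf, hne, hsum, rfl⟩
  intro y hy
  obtain ⟨x, hx, hpos⟩ := A.posSpans y hy
  by_cases hxu : x = u
  · rw [hxu, ← hsum, det_add_right] at hpos
    by_cases h1 : 0 < det y e
    · exact ⟨e, Finset.mem_erase.mpr ⟨he.ne.symm, he.right⟩, h1⟩
    · exact ⟨f, Finset.mem_erase.mpr ⟨hf.ne.symm, hf.right⟩, by omega⟩
  · exact ⟨x, Finset.mem_erase.mpr ⟨hxu, hx⟩, hpos⟩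

end Contraction

/-! ### Existence of the minimal resolution. -/

section Resolution

/-- Every fan has a smooth refinement: all primitive vectors of a large box. -/
theorem exists_smooth_refinement (S : ToricSurface) :
    ∃ A : ToricSurface, A.IsSmooth ∧ S.rays ⊆ A.rays := by
  classical
  let M : ℤ := ∑ u ∈ S.rays, (|u.1| + |u.2|)
  let R : Finset NLat := (Finset.Icc (-M) M ×ˢ Finset.Icc (-M) M).filter IsPrimitive
  have hR : ∀ u, u ∈ R ↔ (|u.1| ≤ M ∧ |u.2| ≤ M) ∧ IsPrimitive u := by
    intro u
    simp only [R, Finset.mem_filter, Finset.mem_product, Finset.mem_Icc, abs_le]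
  have hSR : S.rays ⊆ R := by
    intro u hu
    have : |u.1| + |u.2| ≤ M :=
      Finset.single_le_sum (f := fun u : NLat => |u.1| + |u.2|) (fun _ _ => by positivity) hu
    exact (hR u).mpr ⟨⟨by linarith [abs_nonneg u.2], by linarith [abs_nonneg u.1]⟩,
      S.primitive u hu⟩
  refine ⟨ofPosSpans R (fun u hu => ((hR u).mp hu).2) (S.posSpans.mono hSR), ?_, hSR⟩
  have main : ∀ u v, SpansCone R u v → 0 < det u v → IsUnit (det u v) := by
    intro u v huv hd
    have hu := (hR u).mp huv.1
    have hv := (hR v).mp huv.2.1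
    obtain ⟨w₀, hw₀⟩ := hu.2.exists_det_eq_one
    -- Reduction modulo `u` gives `det u w = 1` and `0 ≤ r = det w v < d = det u v`. From `d • w = r
    -- • u + v` and `r + 1 ≤ d`, the vector `w` stays in the box. It lies in the cone, so it must be
    -- `v`.
    let w : NLat := w₀ + (-(det w₀ v / det u v)) • u
    have h1 : det u w = 1 := by
      simp only [w]; rw [det_add_right, det_smul_right, det_self, hw₀]; ring
    have h2 : det w v = det w₀ v % det u v := by
      simp only [w]; rw [det_add_left, det_smul_left, Int.emod_def]; ring
    have h3 : 0 ≤ det w v := h2 ▸ Int.emod_nonneg _ hd.ne'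
    have h4 : det w v < det u v := h2 ▸ Int.emod_lt_of_pos _ hd
    have h5 := det_smul_eq u v w
    rw [h1, one_smul] at h5
    have e1 : det u v * w.1 = det w v * u.1 + v.1 := by simpa using congrArg Prod.fst h5
    have e2 : det u v * w.2 = det w v * u.2 + v.2 := by simpa using congrArg Prod.snd h5
    have aux : ∀ a b c r d : ℤ, |a| ≤ M → |b| ≤ M → 0 ≤ r → r < d → d * c = r * a + b →
        |c| ≤ M := by
      intro a b c r d ha hb hr hrd h
      rw [abs_le] at *
      constructor <;> by_contra! hcon <;> nlinarith
    have hw : w ∈ R := (hR w).mpr ⟨⟨aux _ _ _ _ _ hu.1.1 hv.1.1 h3 h4 e1,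
      aux _ _ _ _ _ hu.1.2 hv.1.2 h3 h4 e2⟩, isPrimitive_of_isUnit (v := -u) (by
        rw [det_neg_right, ← det_swap, h1]; exact isUnit_one)⟩
    rcases ((spansCone_iff hd).mp huv).2.2 w hw (by omega) h3 with h6 | h6
    · rw [h6, det_self] at h1; omega
    · rw [← h6, h1]; exact isUnit_one
  intro u v huv
  rcases huv.exists_pos with hd | hd
  · exact main u v huv hd
  · exact isUnit_det_swap.mp (main v u (SpansCone.symm huv) hd)

theorem exists_isMinRes (S : ToricSurface) : ∃ A, IsMinRes A S := by
  have main : ∀ n : ℕ, ∀ A : ToricSurface, A.rays.card ≤ n → A.IsSmooth → S.rays ⊆ A.rays →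
      ∃ A, IsMinRes A S := by
    intro n
    induction n with
    | zero =>
      intro A h hA hS
      have := A.posSpans.three_le_card
      omega
    | succ n ih =>
      intro A h hA hS
      by_cases hmin : ∀ u ∈ A.rays, u ∉ S.rays → ¬A.HasSelfInt u (-1)
      · exact ⟨A, hA, refines_iff.mpr hS, hmin⟩
      · push Not at hmin
        obtain ⟨u, hu, huS, hsi⟩ := hmin
        obtain ⟨e, f, hne, he, hf, hsum⟩ := hsi
        obtain ⟨B, hB⟩ := hA.exists_contracts he hf hne
          (HasSelfInt.si_eq ⟨e, f, hne, he, hf, hsum⟩)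
        have := hB.card
        refine ih B (by omega) (hB.isSmooth hA) fun x hx => hB.mem_iff.mpr ⟨?_, hS hx⟩
        rintro rfl
        exact huS hx
  obtain ⟨A, hA, hS⟩ := S.exists_smooth_refinement
  exact main _ A le_rfl hA hS

end Resolution

end ToricSurface
end ToricCascade

namespace ToricCascade

theorem span_eq_top_of_isUnit {u v : NLat} (h : IsUnit (det u v)) :
    Submodule.span ℤ {u, v} = ⊤ := by
  rw [eq_top_iff]
  intro x _
  have h1 : det u v * det u v = 1 := by
    rcases Int.isUnit_iff.mp h with h | h <;> rw [h] <;> norm_num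
  refine Submodule.mem_span_pair.mpr ⟨det u v * det x v, det u v * det u x, ?_⟩
  rw [mul_smul, mul_smul, ← smul_add, ← det_smul_eq, smul_smul, h1, one_smul]

namespace ToricSurface

variable {S T A B C : ToricSurface} {u v w x y e f p q : NLat}

/-! ### Smooth surfaces with three big curves. -/

section Three

theorem Contracts.mem_big_of_ne (h : Contracts A B u e f) (hA : A.IsSmooth) (he : x ≠ e)
    (hf : x ≠ f) : x ∈ B.big ↔ x ≠ u ∧ x ∈ A.big := by
  rw [mem_big, mem_big, h.mem_iff]
  constructor
  · rintro ⟨⟨h1, h2⟩, h3⟩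
    rw [h.si_of_ne hA h2 h1 he hf] at h3
    exact ⟨h1, h2, h3⟩
  · rintro ⟨h1, h2, h3⟩
    rw [h.si_of_ne hA h2 h1 he hf]
    exact ⟨⟨h1, h2⟩, h3⟩

theorem Contracts.mem_big_left (h : Contracts A B u e f) (hA : A.IsSmooth) :
    e ∈ B.big ↔ -2 ≤ A.si e := by
  rw [mem_big, h.si_left hA]
  exact ⟨fun h => by omega, fun h' => ⟨h.e_mem, by omega⟩⟩

theorem Contracts.u_mem_big (h : Contracts A B u e f) : u ∈ A.big :=
  mem_big.mpr ⟨h.mem, h.si_u.ge⟩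

theorem IsThree.card_erase (hA : A.IsThree) (h : Contracts A B u e f) :
    (A.big.erase u).card = 2 := by
  rw [Finset.card_erase_of_mem h.u_mem_big, hA.2]

/-- On a surface with three big curves, a `(-1)`-curve meets no other big curve. -/
theorem IsThree.si_le_of_cone (hA : A.IsThree) (hu : A.si u = -1) (hp : A.Cone u p) :
    A.si p ≤ -2 := by
  have main : ∀ n : ℕ, ∀ (A : ToricSurface) (u p : NLat), A.rays.card ≤ n → A.IsThree →
      A.si u = -1 → A.Cone u p → -1 ≤ A.si p → False := by
    intro n
    induction n with
    | zero =>
      intro A u p h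
      have := A.posSpans.three_le_card
      omega
    | succ n ih =>
      intro A u p hn hA hu hp hbig
      obtain ⟨q, hq, hne⟩ := hp.exists_other
      -- Infinite descent: contracting `u` loses a big curve, so `q` must become one. Then `q` was a
      -- `(-2)`-curve and is now a `(-1)`-curve meeting the big curve `p`, on a surface with fewer
      -- rays.
      obtain ⟨B, h⟩ := hA.1.exists_contracts hp hq hne hu
      have hB := (h.isSmooth hA.1).posSpans_big.three_le_card
      have hsub : B.big ⊆ insert q (A.big.erase u) := by
        intro x hx
        by_cases hxq : x = q
        · simp [hxq]
        by_cases hxp : x = p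
        · subst hxp
          simp [hp.ne.symm, mem_big, hp.right, hbig]
        · have := (h.mem_big_of_ne hA.1 hxp hxq).mp hx
          simp [this]
      have hq1 : q ∈ B.big ∧ q ∉ A.big := by
        by_contra hcon
        have : B.big ⊆ A.big.erase u := by
          intro x hx
          by_cases hxq : x = q
          · subst hxq
            have : x ∈ A.big := by by_contra h1; exact hcon ⟨hx, h1⟩
            exact Finset.mem_erase.mpr ⟨hq.ne.symm, this⟩
          · exact Finset.mem_of_mem_insert_of_ne (hsub hx) hxq
        have := Finset.card_le_card this
        have := hA.card_erase h
        omega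
      have h1 := (h.symm.mem_big_left hA.1).mp hq1.1
      have h2 : ¬(-1 ≤ A.si q) := fun h2 => hq1.2 (mem_big.mpr ⟨hq.right, h2⟩)
      have hB3 : B.IsThree := by
        refine ⟨h.isSmooth hA.1, le_antisymm ?_ hB⟩
        refine (Finset.card_le_card hsub).trans ((Finset.card_insert_le _ _).trans ?_)
        rw [hA.card_erase h]
      have hcard := h.card
      refine ih B q p (by omega) hB3 ?_ h.cone_new.symm ?_
      · rw [h.si_right hA.1]; omega
      · rw [h.si_left hA.1]; omega
  by_contra! hcon
  exact main _ A u p le_rfl hA hu hp (by omega)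

/-- Contracting a `(-1)`-curve one of whose neighbours has self-intersection number at most
`-3`. -/
theorem IsThree.contracts_of_le (hA : A.IsThree) (h : Contracts A B u e f) (hf : A.si f ≤ -3) :
    A.si e = -2 ∧ B.IsThree := by
  have hB := (h.isSmooth hA.1).posSpans_big.three_le_card
  have he := hA.si_le_of_cone h.si_u h.cone_left
  have hfB : f ∉ B.big := fun hfB => by
    have := (h.symm.mem_big_left hA.1).mp hfB; omega
  have hsub : B.big ⊆ insert e (A.big.erase u) := by
    intro x hx
    by_cases hxe : x = e
    · simp [hxe]
    · have := (h.mem_big_of_ne hA.1 hxe (by rintro rfl; exact hfB hx)).mp hx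
      simp [this]
  -- The curve `u` is lost and `f` remains too negative, so only `e` can bring the number of big
  -- curves back to three.
  have he2 : -2 ≤ A.si e := by
    rw [← h.mem_big_left hA.1]
    by_contra heB
    have : B.big ⊆ A.big.erase u := fun x hx =>
      Finset.mem_of_mem_insert_of_ne (hsub hx) (by rintro rfl; exact heB hx)
    have := Finset.card_le_card this
    have := hA.card_erase h
    omega
  refine ⟨by omega, h.isSmooth hA.1, le_antisymm ?_ hB⟩
  refine (Finset.card_le_card hsub).trans ((Finset.card_insert_le _ _).trans ?_)
  rw [hA.card_erase h]

/-- The shape of a step of a cascade. -/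
theorem IsThree.exists_step (hA : A.IsThree) (hB : B.IsThree) (h : IsBlowDown A B) :
    ∃ u e f, Contracts A B u e f ∧ A.si e = -2 ∧ A.si f ≤ -3 := by
  obtain ⟨u, h⟩ := h
  obtain ⟨e, f, h⟩ := h.exists_contracts
  have he := hA.si_le_of_cone h.si_u h.cone_left
  have hf := hA.si_le_of_cone h.si_u h.cone_right
  rcases hf.lt_or_eq with hf' | hf'
  · exact ⟨u, e, f, h, (hA.contracts_of_le h (by omega)).1, by omega⟩
  rcases he.lt_or_eq with he' | he'
  · exact ⟨u, f, e, h.symm, hf', by omega⟩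
  -- If both neighbours were `(-2)`-curves, both would become big, giving four big curves on `B`.
  exfalso
  have heA : e ∉ A.big := fun h => by have := (mem_big.mp h).2; omega
  have hfA : f ∉ A.big := fun h => by have := (mem_big.mp h).2; omega
  have hsub : insert e (insert f (A.big.erase u)) ⊆ B.big := by
    intro x hx
    by_cases hxe : x = e
    · rw [hxe]; exact (h.mem_big_left hA.1).mpr he'.ge
    by_cases hxf : x = f
    · rw [hxf]; exact (h.symm.mem_big_left hA.1).mpr hf'.ge
    rw [h.mem_big_of_ne hA.1 hxe hxf]
    simpa [hxe, hxf] using hx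
  have := Finset.card_le_card hsub
  rw [Finset.card_insert_of_notMem (by simp [h.ne, heA]), Finset.card_insert_of_notMem
    (by simp [hfA]), hA.card_erase h, hB.2] at this
  omega

/-- Two disjoint curves of nonnegative self-intersection number have the same neighbours. -/
theorem IsSmooth.cone_of_not_cone (hA : A.IsSmooth) (hv : v ∈ A.rays)
    (hu0 : 0 ≤ A.si u) (hv0 : 0 ≤ A.si v) (huv : u ≠ v) (hn : ¬A.Cone u v) (he : A.Cone u e) :
    A.Cone v e := by
  obtain ⟨f, hf, hne⟩ := he.exists_other
  have hsum := hA.nbrs_sum he hf hne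
  have hunit : det e u * det e u = 1 := by
    rcases Int.isUnit_iff.mp (hA e u he.symm) with h | h <;> rw [h] <;> norm_num
  -- This is the `u`-coordinate in the basis `e, u`. As `D_u² ≥ 0`, the two cones at `u` cover the
  -- half-plane `Y ≥ 0`, so all rays other than `u, e, f` have `Y < 0`. The neighbours of `v` have
  -- `Y ≤ 0` but nonnegative total, hence `Y = 0`, and they must be `e` and `f`.
  let Y : NLat → ℤ := fun x => det e u * det e x
  have hYu : Y u = 1 := hunit
  have hYe : Y e = 0 := by simp only [Y, det_self, mul_zero]
  have hYf : Y f = -A.si u := by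
    have := hA.det_nbrs_sum he hf hne e
    rw [det_self, zero_add] at this
    simp only [Y]; rw [this]; linear_combination -A.si u * hunit
  have hneg : ∀ x ∈ A.rays, x ≠ u → x ≠ e → x ≠ f → Y x < 0 := by
    intro x hx hxu hxe hxf
    by_contra! hY
    have hdec : x = (det e u * det x u) • e + Y x • u := by
      have := det_smul_eq e u x
      have h2 := congrArg (fun z => det e u • z) this
      simp only [smul_add, smul_smul] at h2
      rw [hunit, one_smul] at h2
      exact h2
    rcases le_total 0 (det e u * det x u) with h | h
    · rcases he.2.2.2 x hx (inCone_of_eq hY h one_pos (by rw [one_smul, add_comm]; exact hdec))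
        with h | h
      · exact hxu h
      · exact hxe h
    · refine (hf.2.2.2 x hx (inCone_of_eq (a := Y x + -(det e u * det x u) * A.si u)
        (b := -(det e u * det x u)) ?_ (by omega) one_pos ?_)).elim hxu hxf
      · have : 0 ≤ -(det e u * det x u) * A.si u := mul_nonneg (by omega) hu0
        omega
      · have : f = (-A.si u) • u - e := by rw [← hsum]; abel
        rw [one_smul, this]
        nth_rw 1 [hdec]
        rw [smul_sub, smul_smul, neg_smul _ e, sub_neg_eq_add, add_comm]
        rw [← add_assoc, ← add_smul]
        congr 2
        ring
  obtain ⟨g, h, hgh, -, -, hnb⟩ := A.exists_nbrs hv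
  have hg := (hnb g).mpr (Or.inl rfl)
  have hh := (hnb h).mpr (Or.inr rfl)
  by_cases hve : v = e
  · exact absurd (hve ▸ he) hn
  by_cases hvf : v = f
  · exact absurd (hvf ▸ hf) hn
  have hYv := hneg v hv huv.symm hve hvf
  have hle : ∀ z, A.Cone v z → Y z ≤ 0 ∧ (Y z = 0 → z = e ∨ z = f) := by
    intro z hz
    by_cases h1 : z = u
    · exact absurd (h1 ▸ hz).symm hn
    by_cases h2 : z = e
    · exact ⟨by rw [h2, hYe], fun _ => Or.inl h2⟩
    by_cases h3 : z = f
    · exact ⟨by rw [h3, hYf]; omega, fun _ => Or.inr h3⟩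
    · have := hneg z hz.right h1 h2 h3
      exact ⟨this.le, fun h => by omega⟩
  have hs : Y g + Y h = -A.si v * Y v := by
    have := hA.det_nbrs_sum hg hh hgh e
    simp only [Y]; linear_combination det e u * this
  have hs' : 0 ≤ Y g + Y h := by rw [hs]; nlinarith
  have hg' := hle g hg
  have hh' := hle h hh
  rcases hg'.2 (by omega) with rfl | rfl
  · exact hg
  · rcases hh'.2 (by omega) with rfl | rfl
    · exact hh
    · exact absurd rfl hgh

/-- On a surface with three big curves and no `(-1)`-curve, one big curve meets the two others. -/
theorem IsThree.exists_center (hA : A.IsThree) (h : ∀ u ∈ A.rays, A.si u ≠ -1) :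
    ∃ u e f, A.Cone u e ∧ A.Cone u f ∧ e ≠ f ∧ A.big = {u, e, f} ∧
      0 ≤ A.si u ∧ 0 ≤ A.si e ∧ 0 ≤ A.si f := by
  obtain ⟨a, b, c, hab, hac, hbc, hbig⟩ := Finset.card_eq_three.mp hA.2
  have hmem : ∀ x ∈ A.big, x ∈ A.rays ∧ 0 ≤ A.si x := by
    intro x hx
    have := mem_big.mp hx
    have := h x this.1
    exact ⟨(mem_big.mp hx).1, by omega⟩
  have ha := hmem a (by simp [hbig])
  have hb := hmem b (by simp [hbig])
  have hc := hmem c (by simp [hbig])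
  -- If `a` met neither `b` nor `c`, a neighbour of `a` would have the three neighbours `a, b, c`.
  have key : ∀ a b c, a ∈ A.rays ∧ 0 ≤ A.si a → b ∈ A.rays ∧ 0 ≤ A.si b →
      c ∈ A.rays ∧ 0 ≤ A.si c → a ≠ b → a ≠ c → b ≠ c → ¬A.Cone a b → A.Cone c a := by
    intro a b c ha hb hc hab hac hbc h1
    by_contra h2
    obtain ⟨e, he, -⟩ := A.exists_cone_right ha.1
    have h3 := hA.1.cone_of_not_cone hb.1 ha.2 hb.2 hab h1 he
    have h4 := hA.1.cone_of_not_cone hc.1 ha.2 hc.2 hac (fun h => h2 h.symm) he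
    rcases he.symm.eq_or_eq h3.symm hab h4.symm with h | h
    · exact hac h.symm
    · exact hbc h.symm
  by_cases h1 : A.Cone a b
  · by_cases h2 : A.Cone a c
    · exact ⟨a, b, c, h1, h2, hbc, hbig, ha.2, hb.2, hc.2⟩
    · have h3 := key c a b hc ha hb hac.symm hbc.symm hab fun h => h2 h.symm
      exact ⟨b, a, c, h1.symm, h3, hac, by rw [hbig, Finset.insert_comm], hb.2, ha.2, hc.2⟩
  · have h2 := key a b c ha hb hc hab hac hbc h1
    have h3 := key b a c hb ha hc hab.symm hbc hac fun h => h1 h.symm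
    refine ⟨c, a, b, h2, h3, hab, ?_, hc.2, ha.2, hb.2⟩
    rw [hbig]; ext x; simp only [Finset.mem_insert, Finset.mem_singleton]; tauto

theorem IsMinRes.isWeightedProjectivePlane (h : IsMinRes A S) (h3 : S.rays.card = 3)
    (hn : ∀ u ∈ A.rays, A.si u ≠ -1) :
    ∃ n : ℕ, 1 ≤ n ∧ S.IsWeightedProjectivePlane 1 1 n := by
  obtain ⟨u, e, f, he, hf, hne, hbig, hu, -, -⟩ := (h.isThree h3).exists_center hn
  rw [h.big_eq h3] at hbig
  have hsum := h.1.nbrs_sum he hf hne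
  have hspan : Submodule.span ℤ {e, f, u} = ⊤ := by
    refine eq_top_iff.mpr ((span_eq_top_of_isUnit (h.1 u e he)).ge.trans ?_)
    refine Submodule.span_mono ?_
    intro x hx
    simp only [Set.mem_insert_iff, Set.mem_singleton_iff] at hx ⊢
    tauto
  have hrays : S.rays = {e, f, u} := by
    rw [hbig]; ext x; simp only [Finset.mem_insert, Finset.mem_singleton]; tauto
  -- For `D_u² = 0` the rays of `S` would be `e, -e, u`, contained in a closed half-plane.
  have hpos : 0 < A.si u := by
    refine hu.lt_of_ne fun h0 => ?_
    rw [← h0, neg_zero, zero_smul] at hsum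
    have hf' : f = -e := by rw [← add_eq_zero_iff_eq_neg, add_comm, hsum]
    rw [hf'] at hrays
    obtain ⟨z, hz, hz'⟩ := S.posSpans e (A.ne_zero he.right)
    obtain ⟨t, ht, ht'⟩ := S.posSpans (-e) (neg_ne_zero.mpr (A.ne_zero he.right))
    simp only [hrays, Finset.mem_insert, Finset.mem_singleton] at hz ht
    rw [det_neg_left] at ht'
    rcases hz with rfl | rfl | rfl
    · simp [det_self] at hz'
    · simp [det_self, det_neg_right] at hz'
    · rcases ht with rfl | rfl | rfl
      · simp [det_self] at ht'
      · simp [det_self, det_neg_right] at ht'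
      · omega
  refine ⟨(A.si u).toNat, by omega, e, f, u, hne, hf.ne.symm, he.ne.symm, hrays, ?_, hspan⟩
  rw [one_smul, one_smul, hsum, ← natCast_zsmul, Int.toNat_of_nonneg hpos.le, neg_smul,
    neg_add_cancel]

end Three

/-! ### Building cascades and induction along them. -/

section Cascade

theorem AdmitsCascadeTo.refl (hS : S.IsLDP₁) (hA : IsMinRes A S) (hb : BasicCondition A) :
    S.AdmitsCascadeTo S :=
  ⟨0, fun _ => S, fun _ => A, rfl, rfl, fun _ _ => ⟨hS, hA⟩, fun k hk => by omega, A, hA, hb⟩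

theorem AdmitsCascadeTo.cons (hS : S.IsLDP₁) (hA : IsMinRes A S) (hAB : IsBlowDown A B)
    (hB : IsMinRes B C) (h : C.AdmitsCascadeTo T) : S.AdmitsCascadeTo T := by
  obtain ⟨t, X, X', hXt, hX0, h1, h2, h3⟩ := h
  refine ⟨t + 1, fun k => if k ≤ t then X k else S, fun k => if k ≤ t then X' k else A,
    by simp, by simpa using hX0, ?_, ?_, by simpa using h3⟩
  · intro k hk
    by_cases hkt : k ≤ t
    · simpa only [hkt, if_true] using h1 k hkt
    · simpa only [hkt, if_false] using ⟨hS, hA⟩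
  · intro k hk
    have hkt : k ≤ t := by omega
    by_cases hk' : k + 1 ≤ t
    · simpa only [hkt, hk', if_true] using h2 k hk'
    · have hk2 : k = t := by omega
      subst hk2
      -- The given cascade comes with its own resolution of `C`; uniqueness identifies it with `B`.
      have : X' k = B := IsMinRes.unique (by rw [← hXt]; exact (h1 k le_rfl).2) hB
      simpa only [hkt, hk', if_true, if_false, this] using hAB

theorem AdmitsCascadeTo.induct {P : ToricSurface → Prop} (h : S.AdmitsCascadeTo T)
    (hstep : ∀ A B : ToricSurface, A.IsThree → B.IsThree → IsBlowDown A B → P B → P A)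
    (hA : IsMinRes A S) (hC : IsMinRes C T) (hP : P C) : P A := by
  obtain ⟨t, X, X', hXt, hX0, h1, h2, -⟩ := h
  have main : ∀ k ≤ t, P (X' k) := by
    intro k
    induction k with
    | zero =>
      intro _
      have := (h1 0 (Nat.zero_le _)).2
      rw [hX0] at this
      rwa [this.unique hC]
    | succ k ih =>
      intro hk
      have h3 : ∀ k ≤ t, (X' k).IsThree := fun k hk =>
        (h1 k hk).2.isThree (isLDP₁_iff.mp (h1 k hk).1)
      exact hstep _ _ (h3 _ hk) (h3 k (by omega)) (h2 k hk) (ih (by omega))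
  have := (h1 t le_rfl).2
  rw [hXt] at this
  rw [hA.unique this]
  exact main t le_rfl

theorem IsSmooth.basicCondition_iff (hA : A.IsSmooth) :
    BasicCondition A ↔ ∀ u v, A.Cone u v → A.si u = -1 → -2 ≤ A.si v := by
  constructor
  · intro h u v huv hu
    exact h u v ((hA.hasSelfInt_iff huv.left).mpr hu) huv _ (hA.hasSelfInt huv.right)
  · intro h u v hu huv d hd
    rw [← hd.si_eq]
    exact h u v huv hu.si_eq

/-- A surface with three big curves which carries a `(-1)`-curve admits a cascade to a basic
surface of the same kind. -/
theorem IsThree.exists_cascade (hA : A.IsThree) (hu : ∃ u ∈ A.rays, A.si u = -1)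
    (hS : IsMinRes A S) (h3 : S.rays.card = 3) :
    ∃ T C, S.AdmitsCascadeTo T ∧ IsMinRes C T ∧ C.IsThree ∧ (∃ u ∈ C.rays, C.si u = -1) ∧
      ∀ u v, C.Cone u v → C.si u = -1 → C.si v = -2 := by
  have main : ∀ n : ℕ, ∀ A S : ToricSurface, A.rays.card ≤ n → A.IsThree →
      (∃ u ∈ A.rays, A.si u = -1) → IsMinRes A S → S.rays.card = 3 →
      ∃ T C, S.AdmitsCascadeTo T ∧ IsMinRes C T ∧ C.IsThree ∧ (∃ u ∈ C.rays, C.si u = -1) ∧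
        ∀ u v, C.Cone u v → C.si u = -1 → C.si v = -2 := by
    intro n
    induction n with
    | zero =>
      intro A S h
      have := A.posSpans.three_le_card
      omega
    | succ n ih =>
      intro A S hn hA hu hS h3
      by_cases hb : BasicCondition A
      · refine ⟨S, A, AdmitsCascadeTo.refl (isLDP₁_iff.mpr h3) hS hb, hS, hA, hu, ?_⟩
        intro u v huv hu
        have := hA.1.basicCondition_iff.mp hb u v huv hu
        have := hA.si_le_of_cone hu huv
        omega
      · rw [hA.1.basicCondition_iff] at hb
        push Not at hb
        obtain ⟨u, f, hf, hu, hlt⟩ := hb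
        obtain ⟨e, he, hne⟩ := hf.exists_other
        obtain ⟨B, h⟩ := hA.1.exists_contracts he hf hne.symm hu
        -- The `(-2)`-curve `e` becomes a `(-1)`-curve, so the induction hypothesis applies to `B`.
        obtain ⟨h1, hB⟩ := hA.contracts_of_le h (by omega)
        obtain ⟨S₁, hS₁, hres⟩ := hB.1.exists_isMinRes_big
        have := h.card
        obtain ⟨T, C, hT, hrest⟩ := ih B S₁ (by omega) hB
          ⟨e, h.e_mem, by rw [h.si_left hA.1, h1]; rfl⟩ hres (by rw [hS₁, hB.2])
        exact ⟨T, C, AdmitsCascadeTo.cons (isLDP₁_iff.mpr h3) hS ⟨u, h.isBlowDownAt⟩ hres hT,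
          hrest⟩
  exact main _ A S le_rfl hA hu hS h3

end Cascade

end ToricSurface
end ToricCascade

namespace ToricCascade
namespace ToricSurface

variable {S T A B C : ToricSurface} {u v w x y z e f p q s : NLat} {π : NLat →ₗ[ℤ] ℤ}

/-! ### Fibrations and fibres of type `I₀`. -/

section Fibration

theorem det_eq_mul_of_map (hs : π s = 0) (hz : π z = 1) (x : NLat) :
    det s x = det s z * π x := by
  have := congrArg π (det_smul_eq s z x)
  simp only [map_add, map_smul, hs, hz, smul_eq_mul, mul_zero, mul_one, zero_add] at this
  exact this.symm

theorem eq_or_eq_neg_of_map_eq_zero (hsurj : Function.Surjective π) (hs : IsPrimitive s)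
    (hx : IsPrimitive x) (hs0 : π s = 0) (hx0 : π x = 0) : x = s ∨ x = -s := by
  obtain ⟨z, hz⟩ := hsurj 1
  refine hs.eq_or_eq_neg hx ?_
  rw [det_eq_mul_of_map hs0 hz, hx0, mul_zero]

/-- Up to sign `π x` is the multiplicity of `D_x` in its fibre, so fibre components meeting a
section are reduced. -/
theorem isUnit_map_of_cone (hA : A.IsSmooth) (hsurj : Function.Surjective π) (h : A.Cone s x)
    (hs : π s = 0) : IsUnit (π x) := by
  obtain ⟨z, hz⟩ := hsurj 1
  have h1 := hA s x h
  rw [det_eq_mul_of_map hs hz] at h1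
  exact isUnit_of_mul_isUnit_right h1

theorem surjective_of_map_eq_one (hz : π z = 1) : Function.Surjective π := fun k =>
  ⟨k • z, by rw [map_smul, hz, smul_eq_mul, mul_one]⟩

theorem isP1Fibration_of_mem (hsurj : Function.Surjective π) (hs : s ∈ A.rays)
    (hs' : -s ∈ A.rays) (h0 : π s = 0) : A.IsP1Fibration π := by
  have main : ∀ x y, A.Cone x y → 0 < π x → π y < 0 → False := by
    intro x y hxy hx hy
    obtain ⟨z, hz⟩ := hsurj 1
    -- A cone crossing the line `π = 0` would contain this point of the line, hence one of the rays
    -- `s`, `-s`.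
    obtain ⟨k, hk⟩ := (A.primitive s hs).eq_smul (x := π x • y - π y • x) (by
      rw [det_eq_mul_of_map h0 hz, map_sub, map_smul, map_smul, smul_eq_mul, smul_eq_mul]; ring)
    have hk0 : k ≠ 0 := by
      rintro rfl
      rw [zero_smul] at hk
      have := congrArg (det x) hk
      rw [det_sub_right, det_smul_right, det_smul_right, det_self, det_zero_right, mul_zero,
        sub_zero] at this
      rcases mul_eq_zero.mp this with h | h
      · omega
      · exact hxy.det_ne h
    have hmem : s = x ∨ s = y ∨ -s = x ∨ -s = y := by
      rcases lt_or_gt_of_ne hk0 with h | h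
      · have := hxy.2.2.2 (-s) hs' (inCone_of_eq (a := -π y) (b := π x) (c := -k) (by omega) hx.le
          (by omega) (by rw [smul_neg, neg_smul, neg_neg, ← hk, neg_smul]; abel))
        tauto
      · have := hxy.2.2.2 s hs (inCone_of_eq (a := -π y) (b := π x) (c := k) (by omega) hx.le
          h (by rw [← hk, neg_smul]; abel))
        tauto
    rcases hmem with h | h | h | h <;> have h2 := congrArg π h <;>
      simp only [map_neg, h0] at h2 <;> omega
  refine ⟨hsurj, fun x y hxy => ?_⟩
  by_contra! hcon
  rcases lt_trichotomy (π x) 0 with hx | hx | hx <;> rcases lt_trichotomy (π y) 0 with hy | hy | hy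
  all_goals first
    | exact main x y hxy hx hy
    | exact main y x hxy.symm hy hx
    | (have := hcon.1; have := hcon.2; omega)

theorem IsP1Fibration.neg (h : A.IsP1Fibration π) : A.IsP1Fibration (-π) := by
  refine ⟨fun k => ?_, fun x y hxy => ?_⟩
  · obtain ⟨z, hz⟩ := h.1 (-k)
    exact ⟨z, by rw [LinearMap.neg_apply, hz, neg_neg]⟩
  · simp only [LinearMap.neg_apply]
    rcases h.2 x y hxy with h | h
    · right; omega
    · left; omega

theorem IsP1Fibration.nonpos_of_cone (h : A.IsP1Fibration π) (hxy : A.Cone x y) (hx : π x < 0) :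
    π y ≤ 0 := by
  rcases h.2 x y hxy with h | h <;> omega

theorem IsP1Fibration.nonneg_of_cone (h : A.IsP1Fibration π) (hxy : A.Cone x y) (hx : 0 < π x) :
    0 ≤ π y := by
  rcases h.2 x y hxy with h | h <;> omega

theorem IsSmooth.cone_other (hA : A.IsSmooth) (h : A.Cone x y) :
    A.Cone x ((-A.si x) • x - y) ∧ y ≠ (-A.si x) • x - y := by
  obtain ⟨z, hz, hne⟩ := h.exists_other
  have : (-A.si x) • x - y = z := by rw [← hA.nbrs_sum h hz hne]; abel
  rw [this]
  exact ⟨hz, hne⟩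

/-- The rays on the positive side of a fibration with a smooth fibre. -/
theorem eq_of_smooth_fiber (h1 : A.Cone z s) (h2 : A.Cone z (-s)) (hs : π s = 0) (hz : π z = 1)
    (hx : x ∈ A.rays) (hpos : 0 < π x) : x = z := by
  have h3 := det_eq_mul_of_map hs hz x
  have hne := h1.symm.det_ne
  rcases h1.symm.cross hx (by rw [h3]; nlinarith [mul_self_pos.mpr hne]) with h | h
  · exact h
  · rcases h2.cross hx (by rw [det_neg_right, ← det_swap]; exact h) with h4 | h4
    · rw [h4, map_neg, hs] at hpos; omega
    · rw [det_neg_right, det_neg_left, ← det_swap, h3] at h4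
      nlinarith [mul_self_pos.mpr hne]

theorem fiberF0_of_cone (hA : A.IsSmooth) (h1 : A.Cone z s) (h2 : A.Cone z (-s)) (hs : π s = 0)
    (hz : π z = 1) (hsi : A.si z = 0) : A.FiberF0 π := by
  refine ⟨[z], by simp, fun x => ?_, by simp, ?_⟩
  · simp only [List.mem_singleton]
    constructor
    · rintro rfl; exact ⟨h1.left, by omega⟩
    · rintro ⟨hx, hpos⟩; exact eq_of_smooth_fiber h1 h2 hs hz hx hpos
  · exact .cons ((hA.hasSelfInt_iff h1.left).mpr hsi) .nil

/-- A `(-1)`-curve `D_u` meeting two `(-2)`-curves `D_p`, `D_q`. -/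
structure FiberCore (A : ToricSurface) (π : NLat →ₗ[ℤ] ℤ) (u p q : NLat) : Prop where
  smooth : A.IsSmooth
  cone_p : A.Cone u p
  cone_q : A.Cone u q
  ne : p ≠ q
  si_u : A.si u = -1
  si_p : A.si p = -2
  si_q : A.si q = -2
  map_p : π p = 1
  map_q : π q = 1

namespace FiberCore

theorem exists_of_si (hA : A.IsSmooth) (hp : A.Cone u p) (hq : A.Cone u q) (hne : p ≠ q)
    (hu : A.si u = -1) (hp2 : A.si p = -2) (hq2 : A.si q = -2) : ∃ π, FiberCore A π u p q := by
  have hd : det p q = -det u p := by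
    rw [← hA.nbrs_sum_of_neg_one hp hq hne hu, det_add_left, det_self, det_swap p q]; ring
  have hd2 : det p q * det p q = 1 := by
    rcases Int.isUnit_iff.mp (hA u p hp) with h | h <;> rw [hd, h] <;> norm_num
  -- The kernel is spanned by `p - q`, and the sign `det p q` makes the values at `p` and `q` equal
  -- to `1`.
  refine ⟨det p q • detL (p - q), hA, hp, hq, hne, hu, hp2, hq2, ?_, ?_⟩
  · rw [LinearMap.smul_apply, detL_apply, det_sub_left, det_self, det_swap p q, smul_eq_mul]
    linarith
  · rw [LinearMap.smul_apply, detL_apply, det_sub_left, det_self, smul_eq_mul]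
    linarith

variable (h : FiberCore A π u p q)
include h

theorem symm : FiberCore A π u q p :=
  ⟨h.smooth, h.cone_q, h.cone_p, h.ne.symm, h.si_u, h.si_q, h.si_p, h.map_q, h.map_p⟩

theorem sum : p + q = u := h.smooth.nbrs_sum_of_neg_one h.cone_p h.cone_q h.ne h.si_u

theorem surjective : Function.Surjective π := surjective_of_map_eq_one h.map_p

theorem map_s : π (p - q) = 0 := by rw [map_sub, h.map_p, h.map_q, sub_self]

/-- The neighbours of the `(-2)`-curve `p` sum to `2p`, and one of them is `u = p + q`. -/
theorem cone_section : A.Cone p (p - q) := by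
  have := (h.smooth.cone_other h.cone_p.symm).1
  rw [h.si_p] at this
  convert this using 1
  rw [← h.sum, neg_neg, two_smul]; abel

theorem cone_section' : A.Cone q (-(p - q)) := by
  rw [neg_sub]; exact h.symm.cone_section

theorem isP1Fibration : A.IsP1Fibration π :=
  isP1Fibration_of_mem h.surjective h.cone_section.right h.cone_section'.right h.map_s

/-- The consecutive cones through `p - q, p, u, q, q - p` fill the half-plane `π ≥ 0`. -/
theorem eq_of_pos (hx : x ∈ A.rays) (hpos : 0 < π x) : x = p ∨ x = u ∨ x = q := by
  have h3 := det_eq_mul_of_map h.map_s h.map_p x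
  have hne := h.cone_section.symm.det_ne
  have e1 : det (p - q) p = det p q := by rw [det_sub_left, det_self, det_swap p q]; ring
  have e2 : det p u = det p q := by rw [← h.sum, det_add_right, det_self, zero_add]
  have e3 : det u q = det p q := by rw [← h.sum, det_add_left, det_self, add_zero]
  have e4 : det q (-(p - q)) = det p q := by
    rw [neg_sub, det_sub_right, det_self, det_swap p q]; ring
  rcases h.cone_section.symm.cross hx (by rw [h3]; nlinarith [mul_self_pos.mpr hne]) with h4 | h4
  · exact Or.inl h4
  rcases h.cone_p.symm.cross hx (by rw [e2, ← e1]; exact h4) with h5 | h5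
  · exact Or.inr (Or.inl h5)
  rcases h.cone_q.cross hx (by rw [e3, ← e2]; exact h5) with h6 | h6
  · exact Or.inr (Or.inr h6)
  rcases h.cone_section'.cross hx (by rw [e4, ← e3]; exact h6) with h7 | h7
  · rw [h7, map_neg, h.map_s] at hpos; omega
  · rw [det_neg_left, e4, ← e1, h3] at h7
    nlinarith [mul_self_pos.mpr hne]

theorem fiberI0 : A.FiberI0 π := by
  refine ⟨[p, u, q], ?_, fun x => ?_, ?_, ?_⟩
  · simp [h.cone_p.ne.symm, h.cone_q.ne, h.ne]
  · simp only [List.mem_cons, List.not_mem_nil, or_false]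
    constructor
    · rintro (rfl | rfl | rfl)
      · exact ⟨h.cone_p.right, by rw [h.map_p]; omega⟩
      · exact ⟨h.cone_p.left, by rw [← h.sum, map_add, h.map_p, h.map_q]; omega⟩
      · exact ⟨h.cone_q.right, by rw [h.map_q]; omega⟩
    · rintro ⟨hx, hpos⟩; exact h.eq_of_pos hx hpos
  · simp [h.cone_p.symm, h.cone_q]
  · exact .cons ((h.smooth.hasSelfInt_iff h.cone_p.right).mpr h.si_p)
      (.cons ((h.smooth.hasSelfInt_iff h.cone_p.left).mpr h.si_u)
      (.cons ((h.smooth.hasSelfInt_iff h.cone_q.right).mpr h.si_q) .nil))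

theorem eq_section (hx : x ∈ A.rays) (h0 : π x = 0) : x = p - q ∨ x = -(p - q) :=
  eq_or_eq_neg_of_map_eq_zero h.surjective (A.primitive _ h.cone_section.right)
    (A.primitive x hx) h.map_s h0

theorem section_ne : p - q ≠ -(p - q) := by
  intro h0
  have h1 := A.ne_zero h.cone_section.right
  have : (2 : ℤ) • (p - q) = 0 := by rw [two_smul]; nth_rw 1 [h0]; abel
  exact h1 ((smul_eq_zero.mp this).resolve_left two_ne_zero)

theorem section_sum (hx : A.Cone (p - q) x) (hxp : p ≠ x) :
    p + x = (-A.si (p - q)) • (p - q) ∧ π x = -1 := by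
  have h1 := h.smooth.nbrs_sum h.cone_section.symm hx hxp
  refine ⟨h1, ?_⟩
  have h2 := congrArg π h1
  rw [map_add, map_smul, h.map_p, h.map_s, smul_zero] at h2
  omega

/-- A curve of nonnegative self-intersection number in the opposite fibre is the whole fibre. -/
theorem cone_of_nonneg (hz : z ∈ A.rays) (hneg : π z < 0) (hsi : 0 ≤ A.si z) :
    A.Cone z (p - q) ∧ A.Cone z (-(p - q)) ∧ A.si z = 0 := by
  obtain ⟨a, b, hab, -, -, hnb⟩ := A.exists_nbrs hz
  have ha := (hnb a).mpr (Or.inl rfl)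
  have hb := (hnb b).mpr (Or.inr rfl)
  have h1 := congrArg π (h.smooth.nbrs_sum ha hb hab)
  rw [map_add, map_smul, smul_eq_mul] at h1
  have h2 := h.isP1Fibration.nonpos_of_cone ha hneg
  have h3 := h.isP1Fibration.nonpos_of_cone hb hneg
  -- Both neighbours have `π ≤ 0`, but the sum is nonnegative, so both are sections.
  have h4 : 0 ≤ -A.si z * π z := by nlinarith
  have h5 : π a = 0 := by omega
  have h6 : π b = 0 := by omega
  have h7 : A.si z = 0 := by
    have : A.si z * π z = 0 := by linarith
    exact (mul_eq_zero.mp this).resolve_right hneg.ne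
  rcases h.eq_section ha.right h5 with rfl | rfl <;> rcases h.eq_section hb.right h6 with rfl | rfl
  · exact absurd rfl hab
  · exact ⟨ha, hb, h7⟩
  · exact ⟨hb, ha, h7⟩
  · exact absurd rfl hab

/-- A `(-1)`-curve in the opposite fibre which meets two `(-2)`-curves meets a section, or the
fibre is of type `I₀`. -/
theorem cone_section_or (hz : z ∈ A.rays) (hneg : π z < 0) (hsi : A.si z = -1)
    (hnb : ∀ y, A.Cone z y → A.si y = -2) :
    A.Cone z (p - q) ∨ A.Cone z (-(p - q)) ∨
      ∃ p' q', FiberCore A (-π) z p' q' ∧ A.Cone p' (p - q) ∧ A.Cone q' (-(p - q)) := by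
  obtain ⟨a, b, hab, -, -, hn⟩ := A.exists_nbrs hz
  have ha := (hn a).mpr (Or.inl rfl)
  have hb := (hn b).mpr (Or.inr rfl)
  have h2 := h.isP1Fibration.nonpos_of_cone ha hneg
  have h3 := h.isP1Fibration.nonpos_of_cone hb hneg
  have hsec : ∀ y, A.Cone z y → π y = 0 → A.Cone z (p - q) ∨ A.Cone z (-(p - q)) := by
    intro y hy hy0
    rcases h.eq_section hy.right hy0 with rfl | rfl
    · exact Or.inl hy
    · exact Or.inr hy
  by_cases ha0 : π a = 0
  · have := hsec a ha ha0; tauto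
  by_cases hb0 : π b = 0
  · have := hsec b hb hb0; tauto
  right; right
  have hsum := h.smooth.nbrs_sum_of_neg_one ha hb hab hsi
  have key : ∀ a b, A.Cone z a → a + b = z → A.Cone a (a - b) := by
    intro a b ha hsum
    have := (h.smooth.cone_other ha.symm).1
    rw [hnb a ha] at this
    convert this using 1
    rw [← hsum, neg_neg, two_smul]; abel
  have c1 := key a b ha hsum
  have c2 := key b a hb (by rw [add_comm, hsum])
  -- The outer neighbours `a - b` and `b - a` are opposite and both have `π ≤ 0`, hence they are the
  -- sections.
  have h4 := h.isP1Fibration.nonpos_of_cone c1 (by omega)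
  have h5 := h.isP1Fibration.nonpos_of_cone c2 (by omega)
  rw [map_sub] at h4 h5
  have hn1 : ∀ {a c}, A.Cone a c → π c = 0 → π a < 0 → (-π) a = 1 := by
    intro a c hc h0 hlt
    rcases Int.isUnit_iff.mp (isUnit_map_of_cone h.smooth h.surjective hc.symm h0) with h | h
    · omega
    · rw [LinearMap.neg_apply, h]; rfl
  have z1 : π (a - b) = 0 := by rw [map_sub]; omega
  have z2 : π (b - a) = 0 := by rw [map_sub]; omega
  have fc : FiberCore A (-π) z a b := ⟨h.smooth, ha, hb, hab, hsi, hnb a ha, hnb b hb,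
    hn1 c1 z1 (by omega), hn1 c2 z2 (by omega)⟩
  rcases h.eq_section c1.right z1 with h6 | h6
  · refine ⟨a, b, fc, h6 ▸ c1, ?_⟩
    rw [← h6, neg_sub]; exact c2
  · refine ⟨b, a, fc.symm, ?_, h6 ▸ c1⟩
    have : p - q = b - a := by rw [← neg_eq_iff_eq_neg.mpr h6, neg_sub]
    rw [this]; exact c2

end FiberCore

end Fibration

/-! ### Classification of the basic surfaces with a `(-1)`-curve. -/

section Classification

/-- The case of one big section, with `w` the only big curve in the opposite fibre. If `w² ≥ 0`,
that fibre is `w` alone; if `w² = -1`, it is of type `I₀`. Comparing the neighbour relations at the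
two sections gives the sum `-1`, respectively `-2`, of their self-intersection numbers. -/
theorem FiberCore.hasForm_of_section_big (h : FiberCore A π u p q)
    (hb : ∀ u v, A.Cone u v → A.si u = -1 → A.si v = -2) (hs : A.si (p - q) ≤ -2)
    (hs' : -1 ≤ A.si (-(p - q))) (hw : w ∈ A.rays) (hwb : -1 ≤ A.si w) (hwn : π w < 0)
    (huniq : ∀ z ∈ A.big, π z < 0 → z = w) :
    (∃ n, 2 ≤ n ∧ A.HasForm (-n) FiberF0 (n - 1) FiberI0) ∨
      (∃ n, 2 ≤ n ∧ A.HasForm (-n) FiberI0 (n - 2) FiberI0) := by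
  have hs0 : p - q ≠ 0 := A.ne_zero h.cone_section.right
  have hms' : π (-(p - q)) = 0 := by rw [map_neg, h.map_s, neg_zero]
  have hp_ne : ∀ {x}, π x < 0 → p ≠ x := by
    rintro x hx rfl; have := h.map_p; omega
  have hq_ne : ∀ {x}, π x < 0 → q ≠ x := by
    rintro x hx rfl; have := h.map_q; omega
  have sec2 : ∀ {x}, A.Cone (-(p - q)) x → q ≠ x →
      q + x = A.si (-(p - q)) • (p - q) ∧ π x = -1 := by
    intro x hx hqx
    have := h.symm.section_sum (by rwa [← neg_sub]) hqx
    rw [← neg_sub p q] at this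
    refine ⟨?_, this.2⟩
    rw [this.1, smul_neg, neg_smul, neg_neg]
  rcases hwb.lt_or_eq with hw0 | hw1
  · left
    obtain ⟨c1, c2, hsi⟩ := h.cone_of_nonneg hw hwn (by omega)
    obtain ⟨e1, e2⟩ := h.section_sum c1.symm (hp_ne hwn)
    obtain ⟨e3, -⟩ := sec2 c2.symm (hq_ne hwn)
    have e4 : (-A.si (p - q) - A.si (-(p - q)) - 1) • (p - q) = 0 := by
      rw [sub_smul, sub_smul, one_smul, ← e1, ← e3]; abel
    have e5 := (smul_eq_zero.mp e4).resolve_right hs0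
    refine ⟨-A.si (p - q), by omega, h.smooth, -π, p - q, -(p - q), h.isP1Fibration.neg,
      h.section_ne, by rw [LinearMap.neg_apply, h.map_s, neg_zero],
      by rw [LinearMap.neg_apply, hms', neg_zero],
      (h.smooth.hasSelfInt_iff h.cone_section.right).mpr (neg_neg _).symm,
      (h.smooth.hasSelfInt_iff h.cone_section'.right).mpr (by omega), ?_, ?_⟩
    · exact fiberF0_of_cone h.smooth c1 c2 (by rw [LinearMap.neg_apply, h.map_s, neg_zero])
        (by rw [LinearMap.neg_apply, e2]; rfl) hsi
    · rw [neg_neg]; exact h.fiberI0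
  · right
    have hnb := fun y hy => hb w y hy hw1.symm
    have no2 : ¬A.Cone w (-(p - q)) := fun hc => by
      have := hnb _ hc; omega
    rcases h.cone_section_or hw hwn hw1.symm hnb with hc | hc | ⟨p', q', fc, c1, c2⟩
    -- Here `w` would be reduced and maximal for `-π`. But the component `r` at the big section is
    -- reduced with `r² ≤ -2`, so its next neighbour `t` has `-π t ≥ 2`.
    · exfalso
      obtain ⟨-, e2⟩ := h.section_sum hc.symm (hp_ne hwn)
      obtain ⟨r, hr, hqr⟩ := h.cone_section'.symm.exists_other
      obtain ⟨-, e4⟩ := sec2 hr hqr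
      have hrb : A.si r ≤ -2 := by
        by_contra! hcon
        have := huniq r (mem_big.mpr ⟨hr.right, by omega⟩) (by omega)
        exact no2 (this ▸ hr.symm)
      obtain ⟨t, ht, hne⟩ := hr.symm.exists_other
      have e5 := congrArg π (h.smooth.nbrs_sum hr.symm ht hne)
      rw [map_add, hms', map_smul, e4, smul_eq_mul] at e5
      obtain ⟨y, hy⟩ := exists_eq_detL (-π)
      have hval : ∀ x, det y x = -π x := fun x => by
        rw [← detL_apply, ← hy, LinearMap.neg_apply]
      have := h.smooth.le_of_unique_big (y := y) (w := w) (x := t)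
        (fun z hz hpos => huniq z hz (by rw [hval] at hpos; omega)) ht.right
        (by rw [hval]; omega)
      rw [hval, hval] at this
      omega
    · exact absurd hc no2
    · obtain ⟨e1, -⟩ := h.section_sum c1.symm (hp_ne (by
        have := fc.map_p; rw [LinearMap.neg_apply] at this; omega))
      obtain ⟨e3, -⟩ := sec2 c2.symm (hq_ne (by
        have := fc.map_q; rw [LinearMap.neg_apply] at this; omega))
      have hpq' : p' - q' = p - q := by
        have z := fc.map_s
        rw [LinearMap.neg_apply] at z
        rcases h.eq_section fc.cone_section.right (by omega) with h6 | h6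
        · exact h6
        · exfalso
          have d1 := fc.cone_section
          rw [h6] at d1
          rcases c1.eq_or_eq fc.cone_p.symm (by
            intro hh
            have := fc.sum
            have h8 := congrArg (-π) this
            rw [map_add, fc.map_p, fc.map_q, LinearMap.neg_apply, ← hh, h.map_s] at h8
            omega) d1 with h7 | h7
          · exact h.section_ne h7.symm
          · have := congrArg π h7
            rw [hms'] at this
            omega
      have e4 : (-A.si (p - q) - A.si (-(p - q)) - 2) • (p - q) = 0 := by
        rw [sub_smul, sub_smul, two_smul, ← e1, ← e3]; nth_rw 1 [← hpq']; abel
      have e5 := (smul_eq_zero.mp e4).resolve_right hs0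
      exact ⟨-A.si (p - q), by omega, h.smooth, π, p - q, -(p - q), h.isP1Fibration,
        h.section_ne, h.map_s, hms',
        (h.smooth.hasSelfInt_iff h.cone_section.right).mpr (neg_neg _).symm,
        (h.smooth.hasSelfInt_iff h.cone_section'.right).mpr (by omega), h.fiberI0, fc.fiberI0⟩

/-- All numbers next to `v` and `w` are known, so the fan can be computed: starting from the section
`p - q`, the opposite fibre is `v = p - 2q, -q, -p, w = q - 2p`. -/
theorem FiberCore.hasForm_of_cone_sections (h : FiberCore A π u p q)
    (hb : ∀ u v, A.Cone u v → A.si u = -1 → A.si v = -2) (hv : A.si v = -1) (hw : A.si w = -1)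
    (hvn : π v < 0) (hwn : π w < 0) (hvs : A.Cone v (p - q)) (hws : A.Cone w (-(p - q))) :
    A.HasForm (-2) FiberI0 (-2) FiberII0 := by
  have hs2 := hb v _ hvs hv
  have hs2' := hb w _ hws hw
  have hv_eq : v = p - (2 : ℤ) • q := by
    have := (h.section_sum hvs.symm (by rintro rfl; have := h.map_p; omega)).1
    rw [hs2, neg_neg] at this
    have e : v = (p + v) - p := by abel
    rw [e, this, two_smul, two_smul]; abel
  have hw_eq : w = q - (2 : ℤ) • p := by
    have := (h.symm.section_sum (by rw [← neg_sub]; exact hws.symm)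
      (by rintro rfl; have := h.map_q; omega)).1
    rw [← neg_sub p q, hs2', neg_neg] at this
    have e : w = (q + w) - q := by abel
    rw [e, this, two_smul, two_smul]; abel
  have c1 : A.Cone v (-q) := by
    convert (h.smooth.cone_other hvs).1 using 1
    rw [hv, neg_neg, one_smul, hv_eq, two_smul]; abel
  have c2 : A.Cone w (-p) := by
    convert (h.smooth.cone_other hws).1 using 1
    rw [hw, neg_neg, one_smul, hw_eq, two_smul]; abel
  have c3 : A.Cone (-q) (-p) := by
    convert (h.smooth.cone_other c1.symm).1 using 1
    rw [hb v _ c1 hv, neg_neg, hv_eq, two_smul, two_smul]; abel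
  have hms' : π (-(p - q)) = 0 := by rw [map_neg, h.map_s, neg_zero]
  refine ⟨h.smooth, π, p - q, -(p - q), h.isP1Fibration, h.section_ne, h.map_s, hms',
    (h.smooth.hasSelfInt_iff h.cone_section.right).mpr hs2,
    (h.smooth.hasSelfInt_iff h.cone_section'.right).mpr hs2', h.fiberI0, ?_⟩
  have hpv : π v = -1 := by rw [hv_eq, map_sub, map_smul, h.map_p, h.map_q]; rfl
  have hpw : π w = -1 := by rw [hw_eq, map_sub, map_smul, h.map_p, h.map_q]; rfl
  have hpq : det p q ≠ 0 := by
    have e1 : det (p - q) p = det p q := by rw [det_sub_left, det_self, det_swap p q]; ring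
    rw [← e1]; exact h.cone_section.symm.det_ne
  have hp0 : p ≠ 0 := A.ne_zero h.cone_p.right
  have hvw : v ≠ w := by
    intro e
    have : det p v = det p w := by rw [e]
    rw [hv_eq, hw_eq, det_sub_right, det_sub_right, det_smul_right, det_smul_right, det_self] at this
    omega
  have n1 : v ≠ -p := by
    intro e
    have : det p v = det p (-p) := by rw [e]
    rw [hv_eq, det_sub_right, det_smul_right, det_neg_right, det_self] at this
    omega
  have n2 : -q ≠ w := by
    intro e
    have : det q (-q) = det q w := by rw [e]
    rw [hw_eq, det_sub_right, det_smul_right, det_neg_right, det_self, det_swap p q] at this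
    omega
  refine ⟨[v, -q, -p, w], ?_, fun x => ?_, ?_, ?_⟩
  · simp only [List.nodup_cons, List.mem_cons, List.not_mem_nil, or_false, not_or]
    exact ⟨⟨c1.ne, n1, hvw⟩, ⟨c3.ne, n2⟩, c2.ne.symm, by simp, by simp⟩
  · simp only [List.mem_cons, List.not_mem_nil, or_false, LinearMap.neg_apply]
    constructor
    · rintro (rfl | rfl | rfl | rfl)
      · exact ⟨c1.left, by omega⟩
      · exact ⟨c1.right, by rw [map_neg, h.map_q]; omega⟩
      · exact ⟨c2.right, by rw [map_neg, h.map_p]; omega⟩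
      · exact ⟨c2.left, by omega⟩
    · rintro ⟨hx, hpos⟩
      have h3 := det_eq_mul_of_map h.map_s h.map_p x
      have d0 : det (p - q) p = det p q := by rw [det_sub_left, det_self, det_swap p q]; ring
      rw [d0] at h3
      have d1 : det (p - q) v = -det p q := by
        rw [hv_eq]; simp only [det_sub_left, det_sub_right, det_smul_right, det_self, det_swap p q]
        ring
      have d2 : det v (-q) = -det p q := by
        rw [hv_eq]; simp only [det_sub_left, det_neg_right, det_smul_left, det_self]; ring
      have d3 : det (-q) (-p) = -det p q := by
        simp only [det_neg_left, det_neg_right, det_swap p q, neg_neg]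
      have d4 : det (-p) w = -det p q := by
        rw [hw_eq]; simp only [det_sub_right, det_neg_left, det_smul_right, det_self]; ring
      have d5 : det w (-(p - q)) = -det p q := by
        rw [hw_eq]
        simp only [det_neg_right, det_sub_left, det_sub_right, det_smul_left, det_self,
          det_swap p q]
        ring
      rcases hvs.symm.cross hx (by rw [d1, h3]; nlinarith [mul_self_pos.mpr hpq]) with h4 | h4
      · exact Or.inl h4
      rcases c1.cross hx (by rw [d2, ← d1]; exact h4) with h5 | h5
      · exact Or.inr (Or.inl h5)
      rcases c3.cross hx (by rw [d3, ← d2]; exact h5) with h6 | h6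
      · exact Or.inr (Or.inr (Or.inl h6))
      rcases c2.symm.cross hx (by rw [d4, ← d3]; exact h6) with h7 | h7
      · exact Or.inr (Or.inr (Or.inr h7))
      rcases hws.cross hx (by rw [d5, ← d4]; exact h7) with h8 | h8
      · rw [h8, hms'] at hpos; omega
      · rw [d5, det_neg_left, h3] at h8
        nlinarith [mul_self_pos.mpr hpq]
  · simp [c1, c2.symm, c3]
  · exact .cons ((h.smooth.hasSelfInt_iff c1.left).mpr hv)
      (.cons ((h.smooth.hasSelfInt_iff c1.right).mpr (hb v _ c1 hv))
      (.cons ((h.smooth.hasSelfInt_iff c2.right).mpr (hb w _ c2 hw))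
      (.cons ((h.smooth.hasSelfInt_iff c2.left).mpr hw) .nil)))

/-- Classification of the basic surfaces which carry a `(-1)`-curve. -/
theorem IsThree.hasForm_of_basic (hA : A.IsThree) (hu : ∃ u ∈ A.rays, A.si u = -1)
    (hb : ∀ u v, A.Cone u v → A.si u = -1 → A.si v = -2) :
    (∃ n, 2 ≤ n ∧ A.HasForm (-n) FiberF0 (n - 1) FiberI0) ∨
      (∃ n, 2 ≤ n ∧ A.HasForm (-n) FiberI0 (n - 2) FiberI0) ∨
      A.HasForm (-2) FiberI0 (-2) FiberII0 := by
  obtain ⟨u, hu, hsi⟩ := hu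
  obtain ⟨p, q, hpq, -, -, hn⟩ := A.exists_nbrs hu
  have hp := (hn p).mpr (Or.inl rfl)
  have hq := (hn q).mpr (Or.inr rfl)
  obtain ⟨π, h⟩ := FiberCore.exists_of_si hA.1 hp hq hpq hsi (hb u p hp hsi) (hb u q hq hsi)
  have huB : u ∈ A.big := mem_big.mpr ⟨hu, hsi.ge⟩
  have hcard : (A.big.erase u).card = 2 := by rw [Finset.card_erase_of_mem huB, hA.2]
  obtain ⟨v, w, hvw, hvw'⟩ := Finset.card_eq_two.mp hcard
  have hbig : ∀ z, z ∈ A.big ↔ z = u ∨ z = v ∨ z = w := by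
    intro z
    have := Finset.ext_iff.mp hvw' z
    simp only [Finset.mem_erase, Finset.mem_insert, Finset.mem_singleton] at this
    by_cases hz : z = u
    · simp [hz, huB]
    · rw [← this]; simp [hz]
  have hne : ∀ z, z = v ∨ z = w → z ≠ u := by
    intro z hz
    have : z ∈ A.big.erase u := by rw [hvw']; simpa using hz
    exact (Finset.mem_erase.mp this).1
  have hnonpos : ∀ z, z = v ∨ z = w → z ∈ A.rays ∧ -1 ≤ A.si z ∧ π z ≤ 0 := by
    intro z hz
    have h1 := mem_big.mp ((hbig z).mpr (Or.inr hz))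
    refine ⟨h1.1, h1.2, ?_⟩
    by_contra! hpos
    rcases h.eq_of_pos h1.1 hpos with rfl | rfl | rfl
    · have := h.si_p; omega
    · exact hne _ hz rfl
    · have := h.si_q; omega
  have hu0 : 0 < π u := by rw [← h.sum, map_add, h.map_p, h.map_q]; omega
  have hneg : π v < 0 ∨ π w < 0 := by
    obtain ⟨y, hy⟩ := exists_eq_detL (-π)
    have hval : ∀ x, det y x = -π x := fun x => by
      rw [← detL_apply, ← hy, LinearMap.neg_apply]
    obtain ⟨z, hz, hpos⟩ := hA.1.posSpans_big y (by
      rintro rfl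
      have := hval p
      rw [det_zero_left, h.map_p] at this
      omega)
    rw [hval] at hpos
    rcases (hbig z).mp hz with rfl | rfl | rfl
    · omega
    · left; omega
    · right; omega
  -- One of the remaining big curves is a section. Exchanging `p` and `q` puts it at `-(p - q)`.
  have hsection : ∀ v w, (∀ z, z ∈ A.big ↔ z = u ∨ z = v ∨ z = w) → π v = 0 → π w < 0 →
      (∃ n, 2 ≤ n ∧ A.HasForm (-n) FiberF0 (n - 1) FiberI0) ∨
      (∃ n, 2 ≤ n ∧ A.HasForm (-n) FiberI0 (n - 2) FiberI0) := by
    intro v w hbig hv hw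
    have hvb := mem_big.mp ((hbig v).mpr (Or.inr (Or.inl rfl)))
    have hwb := mem_big.mp ((hbig w).mpr (Or.inr (Or.inr rfl)))
    have huniq : ∀ z ∈ A.big, π z < 0 → z = w := by
      intro z hz hz0
      rcases (hbig z).mp hz with rfl | rfl | rfl
      · omega
      · omega
      · rfl
    have hother : ∀ t ∈ A.rays, π t = 0 → t ≠ v → A.si t ≤ -2 := by
      intro t ht ht0 htv
      by_contra! hcon
      rcases (hbig t).mp (mem_big.mpr ⟨ht, by omega⟩) with rfl | rfl | rfl
      · omega
      · exact htv rfl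
      · omega
    rcases h.eq_section hvb.1 hv with hvs | hvs
    · refine h.symm.hasForm_of_section_big hb (hother _ h.symm.cone_section.right h.symm.map_s ?_)
        ?_ hwb.1 hwb.2 hw huniq
      · rw [hvs, ← neg_sub p q]; exact h.section_ne.symm
      · rw [neg_sub, ← hvs]; exact hvb.2
    · refine h.hasForm_of_section_big hb (hother _ h.cone_section.right h.map_s ?_)
        ?_ hwb.1 hwb.2 hw huniq
      · rw [hvs]; exact h.section_ne
      · rw [← hvs]; exact hvb.2
  have hv := hnonpos v (Or.inl rfl)
  have hw := hnonpos w (Or.inr rfl)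
  rcases hv.2.2.lt_or_eq with hv0 | hv0
  · rcases hw.2.2.lt_or_eq with hw0 | hw0
    · right; right
      -- Both lie in the opposite fibre. A curve with `D² ≥ 0` would be the whole fibre and a fibre
      -- `I₀` has one big curve only, so both are `(-1)`-curves meeting sections, and the sections
      -- are different.
      have key : ∀ v w, v ∈ A.rays → w ∈ A.rays → -1 ≤ A.si v → -1 ≤ A.si w → π v < 0 →
          π w < 0 → v ≠ w → A.si v = -1 ∧ (A.Cone v (p - q) ∨ A.Cone v (-(p - q))) := by
        intro v w hv hw hvb hwb hv0 hw0 hvw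
        have h1 : A.si v = -1 := by
          by_contra hcon
          obtain ⟨c1, c2, -⟩ := h.cone_of_nonneg hv hv0 (by omega)
          have e := (h.section_sum c1.symm (by rintro rfl; have := h.map_p; omega)).2
          exact hvw (eq_of_smooth_fiber (π := -π) c1 c2
            (by rw [LinearMap.neg_apply, h.map_s, neg_zero])
            (by rw [LinearMap.neg_apply, e]; rfl) hw
            (by rw [LinearMap.neg_apply]; omega)).symm
        refine ⟨h1, ?_⟩
        rcases h.cone_section_or hv hv0 h1 (fun y hy => hb v y hy h1) with
          hc | hc | ⟨p', q', fc, -, -⟩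
        · exact Or.inl hc
        · exact Or.inr hc
        · exfalso
          rcases fc.eq_of_pos hw (by rw [LinearMap.neg_apply]; omega) with rfl | rfl | rfl
          · have := fc.si_p; omega
          · exact hvw rfl
          · have := fc.si_q; omega
      obtain ⟨hv1, hvc⟩ := key v w hv.1 hw.1 hv.2.1 hw.2.1 hv0 hw0 hvw
      obtain ⟨hw1, hwc⟩ := key w v hw.1 hv.1 hw.2.1 hv.2.1 hw0 hv0 hvw.symm
      have hnp : ∀ {z}, π z < 0 → p ≠ z ∧ q ≠ z := by
        intro z hz
        constructor
        · rintro rfl; have := h.map_p; omega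
        · rintro rfl; have := h.map_q; omega
      rcases hvc with hvc | hvc <;> rcases hwc with hwc | hwc
      · rcases h.cone_section.symm.eq_or_eq hvc.symm (hnp hv0).1 hwc.symm with e | e
        · exact absurd e.symm (hnp hw0).1
        · exact absurd e.symm hvw
      · exact h.hasForm_of_cone_sections hb hv1 hw1 hv0 hw0 hvc hwc
      · exact h.hasForm_of_cone_sections hb hw1 hv1 hw0 hv0 hwc hvc
      · rcases h.cone_section'.symm.eq_or_eq hvc.symm (hnp hv0).2 hwc.symm with e | e
        · exact absurd e.symm (hnp hw0).2
        · exact absurd e.symm hvw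
    · exact (hsection w v (fun z => by rw [hbig]; tauto) hw0 hv0).imp id Or.inl
  · exact (hsection v w hbig hv0 (by omega)).imp id Or.inl

end Classification

end ToricSurface
end ToricCascade

namespace ToricCascade
namespace ToricSurface

variable {S T A B C : ToricSurface} {u v w x y z e f p q s s₁ s₂ : NLat} {π : NLat →ₗ[ℤ] ℤ}
  {l : List ℤ}

/-! ### Lifting fibre types through a contraction. -/

section FiberTransfer

theorem Contracts.isP1Fibration (h : Contracts A B u e f) (hB : B.IsP1Fibration π) :
    A.IsP1Fibration π := by
  refine ⟨hB.1, fun x y hxy => ?_⟩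
  have hsum := congrArg π h.sum
  rw [map_add] at hsum
  have hef := hB.2 _ _ h.cone_new
  by_cases hx : x = u
  · subst hx
    rcases h.eq_or_eq hxy with rfl | rfl <;> rcases hef with h1 | h1
    · left; omega
    · right; omega
    · left; omega
    · right; omega
  · by_cases hy : y = u
    · subst hy
      rcases h.eq_or_eq hxy.symm with rfl | rfl <;> rcases hef with h1 | h1
      · left; omega
      · right; omega
      · left; omega
      · right; omega
    · exact hB.2 x y (h.cone_of_cone hxy hx hy)

theorem Contracts.isP1Fibration_down (h : Contracts A B u e f) (hA : A.IsP1Fibration π)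
    (hu : 0 < π u) : B.IsP1Fibration π := by
  refine ⟨hA.1, fun x y hxy => ?_⟩
  have h1 := hA.nonneg_of_cone h.cone_left hu
  have h2 := hA.nonneg_of_cone h.cone_right hu
  rcases h.cone_iff.mp hxy with ⟨h3, -, -⟩ | ⟨rfl, rfl⟩ | ⟨rfl, rfl⟩
  · exact hA.2 x y h3
  · exact Or.inl ⟨h1, h2⟩
  · exact Or.inl ⟨h2, h1⟩

theorem forall₂_of_mem {α β : Type*} {R R' : α → β → Prop} {c : List α} {l : List β}
    (h : List.Forall₂ R c l) (H : ∀ x ∈ c, ∀ d, R x d → R' x d) : List.Forall₂ R' c l := by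
  induction h with
  | nil => exact .nil
  | cons h1 _ ih =>
    exact .cons (H _ (by simp) _ h1) (ih fun x hx => H x (by simp [hx]))

/-- A fibre is unaffected by contractions in the opposite fibre. -/
theorem Contracts.fiberChain (h : Contracts A B u e f) (hA : A.IsSmooth)
    (hfib : A.IsP1Fibration π) (hu : π u < 0) (hc : B.FiberChain π l) : A.FiberChain π l := by
  have he := hfib.nonpos_of_cone h.cone_left hu
  have hf := hfib.nonpos_of_cone h.cone_right hu
  obtain ⟨c, h1, h2, h3, h4⟩ := hc
  have hne : ∀ x ∈ c, x ≠ u ∧ x ≠ e ∧ x ≠ f := by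
    intro x hx
    have := ((h2 x).mp hx).2
    refine ⟨?_, ?_, ?_⟩ <;> rintro rfl <;> omega
  refine ⟨c, h1, fun x => ?_, ?_, ?_⟩
  · rw [h2, h.mem_iff]
    constructor
    · rintro ⟨⟨-, h5⟩, h6⟩; exact ⟨h5, h6⟩
    · rintro ⟨h5, h6⟩; exact ⟨⟨by rintro rfl; omega, h5⟩, h6⟩
  · refine h3.imp_of_mem_imp fun x y hx hy hxy => ?_
    rcases h.cone_iff.mp hxy with ⟨h5, -, -⟩ | ⟨rfl, -⟩ | ⟨rfl, -⟩
    · exact h5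
    · exact absurd rfl (hne _ hx).2.1
    · exact absurd rfl (hne _ hx).2.2
  · refine forall₂_of_mem h4 fun x hx d hd => ?_
    obtain ⟨h5, h6, h7⟩ := hne x hx
    have hxA := (h.mem_iff.mp hd.mem).2
    rw [hA.hasSelfInt_iff hxA, ← h.si_of_ne hA hxA h5 h6 h7]
    exact hd.si_eq

/-- The fibre `π > 0` can be contracted to a chain with self-intersection numbers `l`. -/
def FiberType (l : List ℤ) (A : ToricSurface) (π : NLat →ₗ[ℤ] ℤ) : Prop :=
  ∃ B : ToricSurface, Relation.ReflTransGen (FiberBlowDown π) A B ∧ B.FiberChain π l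

/-- Contractions in opposite fibres commute, so a sequence of contractions starting at `B` lifts to
`A`. -/
theorem FiberType.of_contracts_neg (hA : A.IsSmooth) (h : Contracts A B u e f)
    (hfib : A.IsP1Fibration π) (hu : π u < 0) (hB : FiberType l B π) : FiberType l A π := by
  obtain ⟨D, hBD, hD⟩ := hB
  induction hBD using Relation.ReflTransGen.head_induction_on generalizing A with
  | refl => exact ⟨A, .refl, h.fiberChain hA hfib hu hD⟩
  | @head B C hBC _ ih =>
    obtain ⟨x, hx, hsi, hrays⟩ := hBC
    have he := hfib.nonpos_of_cone h.cone_left hu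
    have hf := hfib.nonpos_of_cone h.cone_right hu
    have hxu : x ≠ u := by rintro rfl; omega
    have hxe : x ≠ e := by rintro rfl; omega
    have hxf : x ≠ f := by rintro rfl; omega
    have hxA := (h.mem_iff.mp hsi.mem).2
    have hsiA : A.si x = -1 := by
      rw [← h.si_of_ne hA hxA hxu hxe hxf, hsi.si_eq]
    obtain ⟨g, k, hgk, -, -, hn⟩ := A.exists_nbrs hxA
    obtain ⟨C', hC'⟩ := hA.exists_contracts ((hn g).mpr (Or.inl rfl)) ((hn k).mpr (Or.inr rfl))
      hgk hsiA
    have hCC : Contracts C' C u e f := by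
      refine ⟨hC'.cone_of_cone h.cone_left hxu.symm hxe.symm,
        hC'.cone_of_cone h.cone_right hxu.symm hxf.symm, h.ne, h.sum, ?_⟩
      rw [hrays, h.rays, hC'.rays, Finset.erase_right_comm]
    obtain ⟨E, hE1, hE2⟩ := ih (hC'.isSmooth hA) hCC (hC'.isP1Fibration_down hfib hx)
    exact ⟨E, .head ⟨x, hx, hC'.isBlowDownAt⟩ hE1, hE2⟩

theorem FiberType.of_contracts (hA : A.IsSmooth) (h : Contracts A B u e f)
    (hfib : A.IsP1Fibration π) (hu : π u ≠ 0) (hB : FiberType l B π) : FiberType l A π := by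
  rcases lt_or_gt_of_ne hu with h0 | h0
  · exact hB.of_contracts_neg hA h hfib h0
  · obtain ⟨D, h1, h2⟩ := hB
    exact ⟨D, .head ⟨u, h0, h.isBlowDownAt⟩ h1, h2⟩

end FiberTransfer

/-! ### Fibres and sections along a cascade. -/

section Invariants

/-- The `(-1)`-curves of the fibre `π > 0` have multiplicity at least two. -/
def NoReducedNegOne (A : ToricSurface) (π : NLat →ₗ[ℤ] ℤ) : Prop :=
  ∀ x ∈ A.rays, A.si x = -1 → 0 < π x → 2 ≤ π x

theorem FiberChain.exists_si (h : A.FiberChain π l) (hx : x ∈ A.rays) (hpos : 0 < π x) :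
    A.si x ∈ l := by
  obtain ⟨c, -, h2, -, h4⟩ := h
  have hxc := (h2 x).mpr ⟨hx, hpos⟩
  clear h2
  induction h4 with
  | nil => simp at hxc
  | cons h1 _ ih =>
    rcases List.mem_cons.mp hxc with rfl | h
    · simp [h1.si_eq]
    · exact List.mem_cons_of_mem _ (ih h)

theorem FiberF0.noReducedNegOne (h : A.FiberF0 π) : A.NoReducedNegOne π := by
  intro x hx hsi hpos
  have := FiberChain.exists_si h hx hpos
  rw [hsi] at this
  simp at this

/-- The only `(-1)`-curve is the middle one; its ray is the sum of its two neighbours, both with `π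
≥ 1`. -/
theorem FiberI0.exists_data (hA : A.IsSmooth) (h : A.FiberI0 π) :
    ∃ y ∈ A.rays, A.si y = -1 ∧ 0 < π y ∧ A.NoReducedNegOne π := by
  obtain ⟨c, h1, h2, h3, h4⟩ := h
  obtain ⟨x, y, z, rfl⟩ : ∃ x y z, c = [x, y, z] := by
    have hl := h4.length_eq
    exact List.length_eq_three.mp hl
  cases h4 with
  | cons hx h4 =>
  cases h4 with
  | cons hy h4 =>
  cases h4 with
  | cons hz h4 =>
  simp only [List.isChain_cons_cons, List.isChain_singleton, and_true] at h3
  simp only [List.nodup_cons, List.mem_cons, List.not_mem_nil, or_false, not_or] at h1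
  have hy' := (h2 y).mp (by simp)
  have hx' := (h2 x).mp (by simp)
  have hz' := (h2 z).mp (by simp)
  refine ⟨y, hy'.1, hy.si_eq, hy'.2, fun t ht hsi hpos => ?_⟩
  have htc := (h2 t).mpr ⟨ht, hpos⟩
  simp only [List.mem_cons, List.not_mem_nil, or_false] at htc
  rcases htc with rfl | rfl | rfl
  · have := hx.si_eq; omega
  · have := hA.nbrs_sum_of_neg_one h3.1.symm h3.2 h1.1.2 hsi
    rw [← this, map_add]; omega
  · have := hz.si_eq; omega

theorem FiberII0.exists_neg_one (h : A.FiberII0 π) : ∃ y ∈ A.rays, A.si y = -1 ∧ 0 < π y := by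
  obtain ⟨c, -, h2, -, h4⟩ := h
  cases h4 with
  | @cons y _ _ _ h1 _ =>
  have := (h2 y).mp (by simp)
  exact ⟨y, this.1, h1.si_eq, this.2⟩

/-- Data on a step of a cascade over a fibration with sections that are not `(-1)`-curves. -/
structure FibStep (A B : ToricSurface) (π : NLat →ₗ[ℤ] ℤ) (u e f : NLat) : Prop where
  smooth : A.IsSmooth
  contracts : Contracts A B u e f
  si_e : A.si e = -2
  si_f : A.si f ≤ -3
  fib : B.IsP1Fibration π
  ker : ∀ x ∈ B.rays, π x = 0 → B.si x ≠ -1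

namespace FibStep

variable (h : FibStep A B π u e f)
include h

theorem si_e' : B.si e = -1 := by rw [h.contracts.si_left h.smooth, h.si_e]; rfl

/-- The curve `e` is a `(-1)`-curve on `B`, whereas the sections are not: the step takes place in a
fibre. -/
theorem map_e : π e ≠ 0 := fun h0 => h.ker e h.contracts.e_mem h0 h.si_e'

theorem map_u : π u ≠ 0 := by
  have h1 := h.fib.2 _ _ h.contracts.cone_new
  have h2 := congrArg π h.contracts.sum
  rw [map_add] at h2
  have := h.map_e
  omega

theorem neg : FibStep A B (-π) u e f :=
  ⟨h.smooth, h.contracts, h.si_e, h.si_f, h.fib.neg, fun x hx h0 =>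
    h.ker x hx (by rw [LinearMap.neg_apply] at h0; omega)⟩

theorem isP1Fibration : A.IsP1Fibration π := h.contracts.isP1Fibration h.fib

theorem fiberType (hB : FiberType l B π) : FiberType l A π :=
  hB.of_contracts h.smooth h.contracts h.isP1Fibration h.map_u

/-- The new `(-1)`-curve `u = e + f` has at least the multiplicity of the `(-1)`-curve `e` of `B`.
-/
theorem noReducedNegOne (hB : B.NoReducedNegOne π) : A.NoReducedNegOne π := by
  intro x hx hsi hpos
  by_cases hxu : x = u
  · subst hxu
    have h1 := h.fib.2 _ _ h.contracts.cone_new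
    have h2 := congrArg π h.contracts.sum
    rw [map_add] at h2
    have h3 := h.map_e
    have h4 := hB e h.contracts.e_mem h.si_e'
    omega
  · have hxe : x ≠ e := by rintro rfl; have := h.si_e; omega
    have hxf : x ≠ f := by rintro rfl; have := h.si_f; omega
    exact hB x (h.contracts.mem_iff.mpr ⟨hxu, hx⟩)
      (by rw [h.contracts.si_of_ne h.smooth hx hxu hxe hxf, hsi]) hpos

theorem mem_section (hs : s ∈ B.rays) : s ∈ A.rays := (h.contracts.mem_iff.mp hs).2

theorem si_section_le (hs : s ∈ B.rays) : A.si s ≤ B.si s :=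
  h.contracts.si_le h.smooth (h.mem_section hs) (h.contracts.mem_iff.mp hs).1

/-- A section could change only as the curve `f`; then the `(-1)`-curve `e` of `B` would meet it and
be reduced. -/
theorem si_section (hB : B.NoReducedNegOne π) (hB' : B.NoReducedNegOne (-π)) (hs : s ∈ B.rays)
    (h0 : π s = 0) : A.si s = B.si s := by
  refine (h.contracts.si_of_ne h.smooth (h.mem_section hs) (h.contracts.mem_iff.mp hs).1 ?_
    ?_).symm
  · rintro rfl; exact h.map_e h0
  · rintro rfl
    have h1 := hB e h.contracts.e_mem h.si_e'
    have h2 := hB' e h.contracts.e_mem h.si_e'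
    rw [LinearMap.neg_apply] at h2
    rcases Int.isUnit_iff.mp (isUnit_map_of_cone (h.contracts.isSmooth h.smooth) h.fib.1
      h.contracts.cone_new.symm h0) with h3 | h3 <;> omega

theorem fiberF0 (hB : B.FiberF0 π) : A.FiberF0 π := by
  have h1 : ¬0 < π e := fun hpos => by
    have := FiberChain.exists_si hB h.contracts.e_mem hpos
    rw [h.si_e'] at this
    simp at this
  have h2 := h.fib.2 _ _ h.contracts.cone_new
  have h3 := congrArg π h.contracts.sum
  rw [map_add] at h3
  have h4 := h.map_e
  exact h.contracts.fiberChain h.smooth h.isP1Fibration (by omega) hB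

end FibStep

theorem eq_or_eq_of_map_eq_zero (hfib : A.IsP1Fibration π) (h1 : s₁ ∈ A.rays) (h2 : s₂ ∈ A.rays)
    (hne : s₁ ≠ s₂) (h01 : π s₁ = 0) (h02 : π s₂ = 0) (hx : x ∈ A.rays) (h0 : π x = 0) :
    x = s₁ ∨ x = s₂ := by
  have key := fun {y : NLat} (hy : y ∈ A.rays) (h : π y = 0) =>
    eq_or_eq_neg_of_map_eq_zero hfib.1 (A.primitive s₁ h1) (A.primitive y hy) h01 h
  rcases key hx h0 with h | h
  · exact Or.inl h
  · rcases key h2 h02 with h' | h'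
    · exact absurd h'.symm hne
    · exact Or.inr (h.trans h'.symm)

/-- The properties of the sections that persist along a cascade. -/
structure Sections (A : ToricSurface) (π : NLat →ₗ[ℤ] ℤ) (s₁ s₂ : NLat) : Prop where
  fib : A.IsP1Fibration π
  ne : s₁ ≠ s₂
  map₁ : π s₁ = 0
  map₂ : π s₂ = 0
  mem₁ : s₁ ∈ A.rays
  mem₂ : s₂ ∈ A.rays

theorem Sections.exists_step (h : Sections B π s₁ s₂) (h1 : B.si s₁ ≠ -1) (h2 : B.si s₂ ≠ -1)
    (hA : A.IsThree) (hB : B.IsThree) (hAB : IsBlowDown A B) :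
    Sections A π s₁ s₂ ∧ ∃ u e f, FibStep A B π u e f := by
  obtain ⟨u, e, f, hc, he, hf⟩ := hA.exists_step hB hAB
  have st : FibStep A B π u e f := ⟨hA.1, hc, he, hf, h.fib, fun x hx h0 => by
    rcases eq_or_eq_of_map_eq_zero h.fib h.mem₁ h.mem₂ h.ne h.map₁ h.map₂ hx h0 with rfl | rfl <;>
      assumption⟩
  exact ⟨⟨st.isP1Fibration, h.ne, h.map₁, h.map₂, st.mem_section h.mem₁, st.mem_section h.mem₂⟩,
    u, e, f, st⟩

theorem AdmitsCascadeTo.hasForm_std1 {n : ℤ} (hn : 2 ≤ n) (h : S.AdmitsCascadeTo T)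
    (hT : T.IsStd1 n) (hA : IsMinRes A S) : A.HasForm (-n) FiberI (n - 1) FiberF0 := by
  obtain ⟨C, hC, hsm, π, s₁, s₂, hfib, hne, h1, h2, hs1, hs2, hF0, hI0⟩ := hT
  have key : ∃ π s₁ s₂, Sections A π s₁ s₂ ∧ A.si s₁ = -n ∧ A.si s₂ = n - 1 ∧
      FiberType [-2, -1, -2] A π ∧ A.NoReducedNegOne π ∧ A.FiberF0 (-π) := by
    refine h.induct (P := fun A => ∃ π s₁ s₂, Sections A π s₁ s₂ ∧ A.si s₁ = -n ∧
      A.si s₂ = n - 1 ∧ FiberType [-2, -1, -2] A π ∧ A.NoReducedNegOne π ∧ A.FiberF0 (-π))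
      ?_ hA hC ?_
    · rintro A B hA hB hAB ⟨π, s₁, s₂, hs, e1, e2, hI, hno, hF⟩
      obtain ⟨hs', u, e, f, st⟩ := hs.exists_step (by omega) (by omega) hA hB hAB
      have hno' := hF.noReducedNegOne
      exact ⟨π, s₁, s₂, hs', by rw [st.si_section hno hno' hs.mem₁ hs.map₁, e1],
        by rw [st.si_section hno hno' hs.mem₂ hs.map₂, e2], st.fiberType hI,
        st.noReducedNegOne hno, st.neg.fiberF0 hF⟩
    · obtain ⟨-, -, -, -, hno⟩ := hI0.exists_data hsm
      -- The model lists the smooth fibre first and the conclusion lists it last, whence the change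
      -- of sign.
      refine ⟨-π, s₁, s₂, ⟨hfib.neg, hne, ?_, ?_, hs1.mem, hs2.mem⟩, hs1.si_eq, hs2.si_eq,
        ⟨C, .refl, hI0⟩, hno, by rwa [neg_neg]⟩
      · rw [LinearMap.neg_apply, h1, neg_zero]
      · rw [LinearMap.neg_apply, h2, neg_zero]
  obtain ⟨π, s₁, s₂, hs, e1, e2, hI, -, hF⟩ := key
  exact ⟨hA.1, π, s₁, s₂, hs.fib, hs.ne, hs.map₁, hs.map₂, (hA.1.hasSelfInt_iff hs.mem₁).mpr e1,
    (hA.1.hasSelfInt_iff hs.mem₂).mpr e2, hI, hF⟩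

theorem AdmitsCascadeTo.hasForm_std2 {n : ℤ} (hn : 2 ≤ n) (h : S.AdmitsCascadeTo T)
    (hT : T.IsStd2 n) (hA : IsMinRes A S) : A.HasForm (-n) FiberI (n - 2) FiberI := by
  obtain ⟨C, hC, hsm, π, s₁, s₂, hfib, hne, h1, h2, hs1, hs2, hI0, hI0'⟩ := hT
  have key : ∃ π s₁ s₂, Sections A π s₁ s₂ ∧ A.si s₁ = -n ∧ A.si s₂ = n - 2 ∧
      FiberType [-2, -1, -2] A π ∧ A.NoReducedNegOne π ∧
      FiberType [-2, -1, -2] A (-π) ∧ A.NoReducedNegOne (-π) := by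
    refine h.induct (P := fun A => ∃ π s₁ s₂, Sections A π s₁ s₂ ∧ A.si s₁ = -n ∧
      A.si s₂ = n - 2 ∧ FiberType [-2, -1, -2] A π ∧ A.NoReducedNegOne π ∧
      FiberType [-2, -1, -2] A (-π) ∧ A.NoReducedNegOne (-π)) ?_ hA hC ?_
    · rintro A B hA hB hAB ⟨π, s₁, s₂, hs, e1, e2, hI, hno, hI', hno'⟩
      obtain ⟨hs', u, e, f, st⟩ := hs.exists_step (by omega) (by omega) hA hB hAB
      exact ⟨π, s₁, s₂, hs', by rw [st.si_section hno hno' hs.mem₁ hs.map₁, e1],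
        by rw [st.si_section hno hno' hs.mem₂ hs.map₂, e2], st.fiberType hI,
        st.noReducedNegOne hno, st.neg.fiberType hI', st.neg.noReducedNegOne hno'⟩
    · obtain ⟨-, -, -, -, hno⟩ := hI0.exists_data hsm
      obtain ⟨-, -, -, -, hno'⟩ := hI0'.exists_data hsm
      exact ⟨π, s₁, s₂, ⟨hfib, hne, h1, h2, hs1.mem, hs2.mem⟩, hs1.si_eq, hs2.si_eq,
        ⟨C, .refl, hI0⟩, hno, ⟨C, .refl, hI0'⟩, hno'⟩
  obtain ⟨π, s₁, s₂, hs, e1, e2, hI, -, hI', -⟩ := key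
  exact ⟨hA.1, π, s₁, s₂, hs.fib, hs.ne, hs.map₁, hs.map₂, (hA.1.hasSelfInt_iff hs.mem₁).mpr e1,
    (hA.1.hasSelfInt_iff hs.mem₂).mpr e2, hI, hI'⟩

/-- The end curves of `II₀` are reduced `(-1)`-curves, so points on the sections may be blown up.
Only the bounds `≤ -2` persist. -/
theorem AdmitsCascadeTo.hasForm_3A2 (h : S.AdmitsCascadeTo T)
    (hT : T.Is3A2) (hA : IsMinRes A S) :
    ∃ n m : ℤ, 2 ≤ n ∧ 2 ≤ m ∧ A.HasForm (-n) FiberI (-m) FiberII := by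
  obtain ⟨C, hC, hsm, π, s₁, s₂, hfib, hne, h1, h2, hs1, hs2, hI0, hII0⟩ := hT
  have key : ∃ π s₁ s₂, Sections A π s₁ s₂ ∧ A.si s₁ ≤ -2 ∧ A.si s₂ ≤ -2 ∧
      FiberType [-2, -1, -2] A π ∧ FiberType [-1, -2, -2, -1] A (-π) := by
    refine h.induct (P := fun A => ∃ π s₁ s₂, Sections A π s₁ s₂ ∧ A.si s₁ ≤ -2 ∧
      A.si s₂ ≤ -2 ∧ FiberType [-2, -1, -2] A π ∧ FiberType [-1, -2, -2, -1] A (-π)) ?_ hA hC ?_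
    · rintro A B hA hB hAB ⟨π, s₁, s₂, hs, e1, e2, hI, hII⟩
      obtain ⟨hs', u, e, f, st⟩ := hs.exists_step (by omega) (by omega) hA hB hAB
      exact ⟨π, s₁, s₂, hs', (st.si_section_le hs.mem₁).trans e1,
        (st.si_section_le hs.mem₂).trans e2, st.fiberType hI, st.neg.fiberType hII⟩
    · exact ⟨π, s₁, s₂, ⟨hfib, hne, h1, h2, hs1.mem, hs2.mem⟩, hs1.si_eq.le, hs2.si_eq.le,
        ⟨C, .refl, hI0⟩, ⟨C, .refl, hII0⟩⟩
  obtain ⟨π, s₁, s₂, hs, e1, e2, hI, hII⟩ := key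
  exact ⟨-A.si s₁, -A.si s₂, by omega, by omega, hA.1, π, s₁, s₂, hs.fib, hs.ne, hs.map₁, hs.map₂,
    (hA.1.hasSelfInt_iff hs.mem₁).mpr (neg_neg _).symm,
    (hA.1.hasSelfInt_iff hs.mem₂).mpr (neg_neg _).symm, hI, hII⟩

end Invariants

/-! ### An invariant separating `std¹` from the other models. -/

section Adjacency

/-- Two curves of nonnegative self-intersection number meet. -/
def HasAdjNonneg (A : ToricSurface) : Prop := ∃ v w, A.Cone v w ∧ 0 ≤ A.si v ∧ 0 ≤ A.si w

/-- The curves `u`, `e`, `f` involved in a step are negative before and after it. -/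
theorem hasAdjNonneg_iff_of_step (hA : A.IsThree) (hB : B.IsThree) (hAB : IsBlowDown A B) :
    A.HasAdjNonneg ↔ B.HasAdjNonneg := by
  obtain ⟨u, e, f, h, he, hf⟩ := hA.exists_step hB hAB
  have hu := h.si_u
  have heB := h.si_left hA.1
  have hfB := h.si_right hA.1
  constructor
  · rintro ⟨v, w, hvw, hv, hw⟩
    have aux : ∀ x, 0 ≤ A.si x → x ≠ u ∧ x ≠ e ∧ x ≠ f := by
      intro x hx
      refine ⟨?_, ?_, ?_⟩ <;> rintro rfl <;> omega
    obtain ⟨a1, a2, a3⟩ := aux v hv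
    obtain ⟨b1, b2, b3⟩ := aux w hw
    exact ⟨v, w, h.cone_of_cone hvw a1 b1, by rwa [h.si_of_ne hA.1 hvw.left a1 a2 a3],
      by rwa [h.si_of_ne hA.1 hvw.right b1 b2 b3]⟩
  · rintro ⟨v, w, hvw, hv, hw⟩
    have aux : ∀ x ∈ B.rays, 0 ≤ B.si x → x ∈ A.rays ∧ x ≠ u ∧ x ≠ e ∧ x ≠ f := by
      intro x hxB hx
      refine ⟨(h.mem_iff.mp hxB).2, (h.mem_iff.mp hxB).1, ?_, ?_⟩ <;> rintro rfl <;> omega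
    obtain ⟨a0, a1, a2, a3⟩ := aux v hvw.left hv
    obtain ⟨b0, b1, b2, b3⟩ := aux w hvw.right hw
    rw [h.si_of_ne hA.1 a0 a1 a2 a3] at hv
    rw [h.si_of_ne hA.1 b0 b1 b2 b3] at hw
    rcases h.cone_iff.mp hvw with ⟨h1, -, -⟩ | ⟨h1, -⟩ | ⟨h1, -⟩
    · exact ⟨v, w, h1, hv, hw⟩
    · exact absurd h1 a2
    · exact absurd h1 a3

theorem AdmitsCascadeTo.hasAdjNonneg_iff (h : S.AdmitsCascadeTo T) (hA : IsMinRes A S)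
    (hC : IsMinRes C T) : A.HasAdjNonneg ↔ C.HasAdjNonneg :=
  h.induct (P := fun A => A.HasAdjNonneg ↔ C.HasAdjNonneg)
    (fun _ _ hA hB hAB hP => (hasAdjNonneg_iff_of_step hA hB hAB).trans hP) hA hC Iff.rfl

theorem HasForm.hasAdjNonneg {n : ℤ} (hn : 2 ≤ n)
    (h : A.HasForm (-n) FiberF0 (n - 1) FiberI0) : A.HasAdjNonneg := by
  obtain ⟨hsm, π, s₁, s₂, hfib, hne, h1, h2, hs1, hs2, ⟨c, -, hc, -, hsi⟩, -⟩ := h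
  cases hsi with
  | @cons x _ _ _ hx hsi =>
  cases hsi with
  | nil =>
  have hx' := (hc x).mp (by simp)
  obtain ⟨a, b, hab, -, -, hn⟩ := A.exists_nbrs hx'.1
  have ha := (hn a).mpr (Or.inl rfl)
  have hb := (hn b).mpr (Or.inr rfl)
  have hsum := congrArg π (hsm.nbrs_sum ha hb hab)
  rw [hx.si_eq, neg_zero, zero_smul, map_zero, map_add] at hsum
  have ha0 := hfib.nonneg_of_cone ha hx'.2
  have hb0 := hfib.nonneg_of_cone hb hx'.2
  have key : A.Cone x s₂ := by
    rcases eq_or_eq_of_map_eq_zero hfib ha.right hb.right hab (by omega) (by omega) hs2.mem h2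
      with rfl | rfl
    · exact ha
    · exact hb
  exact ⟨x, s₂, key, hx.si_eq.ge, by rw [hs2.si_eq]; omega⟩

/-- Two `(-1)`-curves leave room for just one more big curve. -/
theorem IsThree.not_hasAdjNonneg (hA : A.IsThree) (hx : x ∈ A.rays) (hy : y ∈ A.rays)
    (hsx : A.si x = -1) (hsy : A.si y = -1) (hxy : x ≠ y) : ¬A.HasAdjNonneg := by
  rintro ⟨v, w, hvw, hv, hw⟩
  have hsub : ({x, y, v, w} : Finset NLat) ⊆ A.big := by
    intro z hz
    simp only [Finset.mem_insert, Finset.mem_singleton] at hz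
    rcases hz with rfl | rfl | rfl | rfl
    · exact mem_big.mpr ⟨hx, by omega⟩
    · exact mem_big.mpr ⟨hy, by omega⟩
    · exact mem_big.mpr ⟨hvw.left, by omega⟩
    · exact mem_big.mpr ⟨hvw.right, by omega⟩
  have := Finset.card_le_card hsub
  have ne : ∀ {a b}, A.si a = -1 → 0 ≤ A.si b → a ≠ b := by
    rintro a b ha hb rfl; omega
  rw [Finset.card_insert_of_notMem (by simp [hxy, ne hsx hv, ne hsx hw]),
    Finset.card_insert_of_notMem (by simp [ne hsy hv, ne hsy hw]), Finset.card_pair hvw.ne,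
    hA.2] at this
  omega

theorem HasForm.not_hasAdjNonneg {a b : ℤ} {F : ToricSurface → (NLat →ₗ[ℤ] ℤ) → Prop}
    (hA : A.IsThree) (hF : ∀ π, F A π → ∃ y ∈ A.rays, A.si y = -1 ∧ 0 < π y)
    (h : A.HasForm a FiberI0 b F) : ¬A.HasAdjNonneg := by
  obtain ⟨hsm, π, -, -, -, -, -, -, -, -, hI, hG⟩ := h
  obtain ⟨x, hx, hsx, hx0, -⟩ := hI.exists_data hsm
  obtain ⟨y, hy, hsy, hy0⟩ := hF _ hG
  refine hA.not_hasAdjNonneg hx hy hsx hsy ?_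
  rintro rfl
  rw [LinearMap.neg_apply] at hy0
  omega

theorem IsThree.hasAdjNonneg_of_forall_ne (hA : A.IsThree) (h : ∀ u ∈ A.rays, A.si u ≠ -1) :
    A.HasAdjNonneg := by
  obtain ⟨u, e, f, he, -, -, -, hu, he0, -⟩ := hA.exists_center h
  exact ⟨u, e, he, hu, he0⟩

theorem cone_of_subset (hSA : S.rays ⊆ A.rays) (h : A.Cone u v) (hu : u ∈ S.rays)
    (hv : v ∈ S.rays) : S.Cone u v :=
  ⟨hu, hv, h.det_ne, fun w hw => h.2.2.2 w (hSA hw)⟩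

theorem IsMinRes.exists_smooth_cone (hA : IsMinRes A S) (h3 : S.rays.card = 3)
    (h : A.HasAdjNonneg) : ∃ u v, S.Cone u v ∧ IsUnit (det u v) := by
  obtain ⟨v, w, hvw, hv, hw⟩ := h
  have hbig := hA.big_eq h3
  refine ⟨v, w, cone_of_subset (isMinRes_iff.mp hA).2.1 hvw ?_ ?_, hA.1 v w hvw⟩
  · rw [← hbig]; exact mem_big.mpr ⟨hvw.left, by omega⟩
  · rw [← hbig]; exact mem_big.mpr ⟨hvw.right, by omega⟩

/-- A smooth cone of `S` is not subdivided in the minimal resolution, so two big curves meet on `A`;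
by `IsThree.si_le_of_cone` neither is a `(-1)`-curve. -/
theorem IsMinRes.hasAdjNonneg (hA : IsMinRes A S) (h3 : S.rays.card = 3) (h : S.Cone u v)
    (hunit : IsUnit (det u v)) : A.HasAdjNonneg := by
  have hbig := hA.big_eq h3
  obtain ⟨hsm, hSA, hexc⟩ := isMinRes_iff.mp hA
  wlog hpos : 0 < det u v generalizing u v
  · exact this h.symm (isUnit_det_swap.mp hunit) (h.exists_pos.resolve_left hpos)
  have h1 : det u v = 1 := by rcases Int.isUnit_iff.mp hunit with h | h <;> omega
  have huA := hSA h.left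
  have hvA := hSA h.right
  have hc : A.Cone u v := by
    refine (spansCone_iff hpos).mpr ⟨huA, hvA, fun x hx hux hxv => ?_⟩
    by_cases e1 : det u x = 0
    · refine Or.inl ((A.primitive u huA).eq_of_det (y := -v) (A.primitive x hx) e1 ?_ ?_)
      · rw [det_neg_left, ← det_swap]; exact hpos
      · rw [det_neg_left, ← det_swap]; exact hxv
    by_cases e2 : det x v = 0
    · exact Or.inr ((A.primitive v hvA).eq_of_det (y := u) (A.primitive x hx)
        (by rw [det_swap x v, e2, neg_zero]) hpos hux)
    exfalso
    exact hsm.not_mem_interior h1 (fun z hz hz1 hz2 => hexc z hz fun hzS =>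
      h.not_interior hzS hz1 hz2 hpos) hx (by omega) (by omega)
  have hub := (mem_big.mp (hbig ▸ h.left)).2
  have hvb := (mem_big.mp (hbig ▸ h.right)).2
  have h3' := hA.isThree h3
  refine ⟨u, v, hc, hub.lt_of_ne fun h0 => ?_, hvb.lt_of_ne fun h0 => ?_⟩
  · have := h3'.si_le_of_cone h0.symm hc; omega
  · have := h3'.si_le_of_cone h0.symm hc.symm; omega

end Adjacency

/-! ### Counting singular points on a fan with three rays. -/

section Singularities

open Classical in
theorem singCount_eq (h : S.rays = {u, v, w}) (h1 : 0 < det u v) (h2 : 0 < det v w)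
    (h3 : 0 < det w u) : S.singCount = (if IsUnit (det u v) then 0 else 1) +
      (if IsUnit (det v w) then 0 else 1) + (if IsUnit (det w u) then 0 else 1) := by
  have huv := ne_of_det_ne_zero h1.ne'
  have hvw := ne_of_det_ne_zero h2.ne'
  have hwu := ne_of_det_ne_zero h3.ne'
  have c1 := cone_of_rays_eq h h1
  have c2 : S.Cone v w := cone_of_rays_eq (w := u)
    (by rw [h]; ext; simp only [Finset.mem_insert, Finset.mem_singleton]; tauto) h2
  have c3 : S.Cone w u := cone_of_rays_eq (w := v)
    (by rw [h]; ext; simp only [Finset.mem_insert, Finset.mem_singleton]; tauto) h3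
  have hset : {σ : Finset NLat | ∃ u v : NLat, S.Cone u v ∧ ¬ IsUnit (det u v) ∧ σ = {u, v}} =
      (((if IsUnit (det u v) then ∅ else {{u, v}}) ∪ (if IsUnit (det v w) then ∅ else {{v, w}}) ∪
        (if IsUnit (det w u) then ∅ else {{w, u}}) : Finset (Finset NLat)) :
        Set (Finset NLat)) := by
    ext σ
    simp only [Set.mem_ofPred_eq, Finset.coe_union, Set.mem_union, Finset.mem_coe]
    have hif : ∀ (P : Prop) [Decidable P] (τ : Finset NLat),
        σ ∈ (if P then (∅ : Finset (Finset NLat)) else {τ}) ↔ ¬P ∧ σ = τ := by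
      intro P _ τ; split_ifs with hP <;> simp [hP]
    rw [hif, hif, hif]
    constructor
    · rintro ⟨x, y, hxy, hd, rfl⟩
      have hx := hxy.left
      have hy := hxy.right
      simp only [h, Finset.mem_insert, Finset.mem_singleton] at hx hy
      have hne := hxy.ne
      rcases hx with rfl | rfl | rfl <;> rcases hy with rfl | rfl | rfl <;>
        first
        | exact absurd rfl hne
        | exact Or.inl (Or.inl ⟨hd, rfl⟩)
        | exact Or.inl (Or.inr ⟨hd, rfl⟩)
        | exact Or.inr ⟨hd, rfl⟩
        | exact Or.inl (Or.inl ⟨fun h => hd (isUnit_det_swap.mp h), Finset.pair_comm _ _⟩)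
        | exact Or.inl (Or.inr ⟨fun h => hd (isUnit_det_swap.mp h), Finset.pair_comm _ _⟩)
        | exact Or.inr ⟨fun h => hd (isUnit_det_swap.mp h), Finset.pair_comm _ _⟩
    · rintro ((⟨h4, rfl⟩ | ⟨h4, rfl⟩) | ⟨h4, rfl⟩)
      · exact ⟨u, v, c1, h4, rfl⟩
      · exact ⟨v, w, c2, h4, rfl⟩
      · exact ⟨w, u, c3, h4, rfl⟩
  have n1 : ({u, v} : Finset NLat) ≠ {v, w} := fun hh => by
    have : u ∈ ({v, w} : Finset NLat) := hh ▸ (by simp)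
    simp [huv, hwu.symm] at this
  have n2 : ({u, v} : Finset NLat) ≠ {w, u} := fun hh => by
    have : v ∈ ({w, u} : Finset NLat) := hh ▸ (by simp)
    simp [hvw, huv.symm] at this
  have n3 : ({v, w} : Finset NLat) ≠ {w, u} := fun hh => by
    have : v ∈ ({w, u} : Finset NLat) := hh ▸ (by simp)
    simp [hvw, huv.symm] at this
  rw [singCount, hset, Set.ncard_coe_finset]
  split_ifs <;> simp [n1, n2, n3]

/-- Cramer's rule in the basis `u, v` is the relation among the generators, with the other two
determinants as weights. -/
theorem isWeightedProjectivePlane_of_det_eq_one (h : S.rays = {u, v, w}) (h1 : det u v = 1)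
    (h2 : 0 < det v w) (h3 : 0 < det w u) :
    S.IsWeightedProjectivePlane 1 (det v w).toNat (det w u).toNat := by
  refine ⟨w, u, v, ne_of_det_ne_zero h3.ne', ne_of_det_ne_zero (by omega),
    (ne_of_det_ne_zero h2.ne').symm, ?_, ?_, ?_⟩
  · rw [h]; ext; simp only [Finset.mem_insert, Finset.mem_singleton]; tauto
  · have h4 := det_smul_eq u v w
    rw [h1, one_smul] at h4
    rw [one_smul, ← natCast_zsmul, ← natCast_zsmul, Int.toNat_of_nonneg h2.le,
      Int.toNat_of_nonneg h3.le]
    nth_rw 1 [h4]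
    rw [det_swap v w, det_swap w u, neg_smul, neg_smul]
    rw [det_swap v w] at *
    abel
  · refine eq_top_iff.mpr ((span_eq_top_of_isUnit (u := u) (v := v) (by rw [h1]; exact
      isUnit_one)).ge.trans (Submodule.span_mono ?_))
    intro x hx
    simp only [Set.mem_insert_iff, Set.mem_singleton_iff] at hx ⊢
    tauto

theorem rays_rotate (h : S.rays = {u, v, w}) : S.rays = {v, w, u} := by
  rw [h]; ext; simp only [Finset.mem_insert, Finset.mem_singleton]; tauto

theorem isUnit_iff_of_pos {a : ℤ} (h : 0 < a) : IsUnit a ↔ a = 1 := by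
  rw [Int.isUnit_iff]; omega

theorem isWeightedProjectivePlane_of_singCount_zero (h3 : S.rays.card = 3)
    (h : S.singCount = 0) : S.IsWeightedProjectivePlane 1 1 1 := by
  obtain ⟨u, v, w, hr, h1, h2, h3⟩ := exists_triangle h3
  rw [singCount_eq hr h1 h2 h3] at h
  simp only [isUnit_iff_of_pos h1, isUnit_iff_of_pos h2, isUnit_iff_of_pos h3] at h
  obtain ⟨a, b, c⟩ : det u v = 1 ∧ det v w = 1 ∧ det w u = 1 := by
    split_ifs at h <;> omega
  have := isWeightedProjectivePlane_of_det_eq_one hr a h2 h3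
  rwa [b, c] at this

theorem isWeightedProjectivePlane_of_singCount_one (h3 : S.rays.card = 3)
    (h : S.singCount = 1) : ∃ n : ℕ, 2 ≤ n ∧ S.IsWeightedProjectivePlane 1 1 n := by
  have key : ∀ u v w, S.rays = {u, v, w} → 0 < det w u → det u v = 1 → det v w = 1 →
      det w u ≠ 1 → ∃ n : ℕ, 2 ≤ n ∧ S.IsWeightedProjectivePlane 1 1 n := by
    intro u v w hr h3 a b c
    have := isWeightedProjectivePlane_of_det_eq_one hr a (by omega) h3
    rw [b] at this
    exact ⟨_, by omega, this⟩
  obtain ⟨u, v, w, hr, h1, h2, h3⟩ := exists_triangle h3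
  rw [singCount_eq hr h1 h2 h3] at h
  simp only [isUnit_iff_of_pos h1, isUnit_iff_of_pos h2, isUnit_iff_of_pos h3] at h
  split_ifs at h with a b c c b c c
  all_goals first
    | omega
    | exact key u v w hr h3 a b c
    | exact key w u v (rays_rotate (rays_rotate hr)) h2 c a b
    | exact key v w u (rays_rotate hr) h1 b c a

theorem isWeightedProjectivePlane_of_singCount_two (h3 : S.rays.card = 3)
    (h : S.singCount = 2) : (∃ p q : ℕ, 0 < p ∧ 0 < q ∧ S.IsWeightedProjectivePlane 1 p q) ∧
      ∃ u v, S.Cone u v ∧ IsUnit (det u v) := by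
  have key : ∀ u v w, S.rays = {u, v, w} → 0 < det v w → 0 < det w u → det u v = 1 →
      (∃ p q : ℕ, 0 < p ∧ 0 < q ∧ S.IsWeightedProjectivePlane 1 p q) ∧
      ∃ u v, S.Cone u v ∧ IsUnit (det u v) := by
    intro u v w hr h2 h3 a
    exact ⟨⟨_, _, by omega, by omega, isWeightedProjectivePlane_of_det_eq_one hr a h2 h3⟩,
      u, v, cone_of_rays_eq hr (by omega), by rw [a]; exact isUnit_one⟩
  obtain ⟨u, v, w, hr, h1, h2, h3⟩ := exists_triangle h3
  rw [singCount_eq hr h1 h2 h3] at h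
  simp only [isUnit_iff_of_pos h1, isUnit_iff_of_pos h2, isUnit_iff_of_pos h3] at h
  by_cases a : det u v = 1
  · exact key u v w hr h2 h3 a
  by_cases b : det v w = 1
  · exact key v w u (rays_rotate hr) h3 h1 b
  by_cases c : det w u = 1
  · exact key w u v (rays_rotate (rays_rotate hr)) h1 h2 c
  · rw [if_neg a, if_neg b, if_neg c] at h
    omega

theorem not_isUnit_of_singCount_three (h3 : S.rays.card = 3) (h : S.singCount = 3)
    (hc : S.Cone x y) : ¬IsUnit (det x y) := by
  intro hx
  wlog hpos : 0 < det x y generalizing x y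
  · exact this hc.symm (isUnit_det_swap.mp hx) (hc.exists_pos.resolve_left hpos)
  obtain ⟨u, v, w, hr, h1, h2, h3⟩ := exists_triangle h3
  obtain ⟨z, hz⟩ : ∃ z, S.rays = {x, y, z} := by
    have hxr := hc.left
    have hyr := hc.right
    have hne := hc.ne
    simp only [hr, Finset.mem_insert, Finset.mem_singleton] at hxr hyr
    rcases hxr with rfl | rfl | rfl <;> rcases hyr with rfl | rfl | rfl
    · exact absurd rfl hne
    · exact ⟨w, hr⟩
    · exact ⟨v, by rw [hr, Finset.pair_comm]⟩
    · exact ⟨w, by rw [hr, Finset.insert_comm]⟩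
    · exact absurd rfl hne
    · exact ⟨u, rays_rotate hr⟩
    · exact ⟨v, rays_rotate (rays_rotate hr)⟩
    · exact ⟨u, by rw [rays_rotate hr, Finset.insert_comm]⟩
    · exact absurd rfl hne
  have hp := det_pos_of_rays_eq hz hpos
  rw [singCount_eq hz hpos hp.1 hp.2, if_pos hx] at h
  split_ifs at h <;> omega

/-- One big curve meets the other two already on the smooth surface `A`, so two of the three cones
of `S` are smooth. -/
theorem IsMinRes.singCount_le_one (hA : IsMinRes A S) (h3 : S.rays.card = 3)
    (hn : ∀ u ∈ A.rays, A.si u ≠ -1) : S.singCount ≤ 1 := by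
  obtain ⟨u, e, f, he, hf, -, hbig, -⟩ := (hA.isThree h3).exists_center hn
  rw [hA.big_eq h3] at hbig
  have key : ∀ e f, A.Cone u e → A.Cone u f → S.rays = {u, e, f} → 0 < det u e →
      S.singCount ≤ 1 := by
    intro e f he hf hr hpos
    have hp := det_pos_of_rays_eq hr hpos
    rw [singCount_eq hr hpos hp.1 hp.2, if_pos (hA.1 u e he), if_pos (hA.1 f u hf.symm)]
    split_ifs <;> simp
  rcases he.exists_pos with h | h
  · exact key e f he hf hbig h
  · have hr : S.rays = {e, u, f} := by rw [hbig, Finset.insert_comm]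
    have := (det_pos_of_rays_eq hr h).1
    exact key f e hf he (by rw [hbig, Finset.pair_comm]) this

end Singularities

/-- The invariant is carried along with the existence of the cascade, so that the singular points of
`S` can decide which model is reached. -/
theorem IsMinRes.cascade (hA : IsMinRes A S) (h3 : S.rays.card = 3)
    (hu : ∃ u ∈ A.rays, A.si u = -1) :
    (S.CascadeToStd1 ∧ A.HasAdjNonneg) ∨
      ((S.CascadeToStd2 ∨ S.CascadeTo3A2) ∧ ¬A.HasAdjNonneg) := by
  obtain ⟨T, C, hST, hC, hC3, huC, hb⟩ := (hA.isThree h3).exists_cascade hu hA h3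
  have hiff := hST.hasAdjNonneg_iff hA hC
  rcases hC3.hasForm_of_basic huC hb with ⟨n, hn, hform⟩ | ⟨n, hn, hform⟩ | hform
  · exact Or.inl ⟨⟨n, T, hn, hST, C, hC, hform⟩, hiff.mpr (hform.hasAdjNonneg hn)⟩
  · refine Or.inr ⟨Or.inl ⟨n, T, hn, hST, C, hC, hform⟩, fun h => ?_⟩
    refine hform.not_hasAdjNonneg hC3 (fun π hI => ?_) (hiff.mp h)
    obtain ⟨y, hy, h1, h2, -⟩ := hI.exists_data hC3.1
    exact ⟨y, hy, h1, h2⟩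
  · exact Or.inr ⟨Or.inr ⟨T, hST, C, hC, hform⟩, fun h =>
      hform.not_hasAdjNonneg hC3 (fun π hI => hI.exists_neg_one) (hiff.mp h)⟩

end ToricSurface
end ToricCascade

/-! ### Assembly of the theorem. -/

theorem mainTheorem4 (S : ToricSurface) (hS : S.IsLogDelPezzo) (hρ : S.picardNumber = 1) :
    -- Part 1
    ((∃ n : ℕ, 1 ≤ n ∧ S.IsWeightedProjectivePlane 1 1 n) ∨
      S.CascadeToStd1 ∨ S.CascadeToStd2 ∨ S.CascadeTo3A2) ∧
    -- Part 2
    (∀ T : ToricSurface, S.AdmitsCascadeTo T →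
      (∀ n : ℤ, 2 ≤ n → T.IsStd1 n →
        ∀ S' : ToricSurface, IsMinRes S' S → S'.HasForm (-n) FiberI (n - 1) FiberF0) ∧
      (∀ n : ℤ, 2 ≤ n → T.IsStd2 n →
        ∀ S' : ToricSurface, IsMinRes S' S → S'.HasForm (-n) FiberI (n - 2) FiberI) ∧
      (T.Is3A2 →
        ∀ S' : ToricSurface, IsMinRes S' S →
          ∃ n m : ℤ, 2 ≤ n ∧ 2 ≤ m ∧ S'.HasForm (-n) FiberI (-m) FiberII)) ∧
    -- Part 3
    (¬ S.IsBasic → S.CascadeToStd1 ∨ S.CascadeToStd2 ∨ S.CascadeTo3A2) ∧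
    (S.singCount = 0 → S.IsWeightedProjectivePlane 1 1 1) ∧
    (S.singCount = 1 → ∃ n : ℕ, 2 ≤ n ∧ S.IsWeightedProjectivePlane 1 1 n) ∧
    (S.singCount = 2 →
      (∃ p q : ℕ, 0 < p ∧ 0 < q ∧ S.IsWeightedProjectivePlane 1 p q) ∧ S.CascadeToStd1) ∧
    (S.singCount = 3 → S.CascadeToStd2 ∨ S.CascadeTo3A2) := by
  have h3 : S.rays.card = 3 := by rw [← S.picardNumber_add_two, hρ]
  obtain ⟨A, hA⟩ := S.exists_isMinRes
  have hcas : (∃ u ∈ A.rays, A.si u = -1) →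
      S.CascadeToStd1 ∨ S.CascadeToStd2 ∨ S.CascadeTo3A2 := by
    intro hu
    rcases hA.cascade h3 hu with h | h
    · exact Or.inl h.1
    · exact Or.inr h.1
  refine ⟨?_, ?_, ?_, isWeightedProjectivePlane_of_singCount_zero h3,
    isWeightedProjectivePlane_of_singCount_one h3, ?_, ?_⟩
  · by_cases hu : ∃ u ∈ A.rays, A.si u = -1
    · exact Or.inr (hcas hu)
    · push Not at hu
      exact Or.inl (hA.isWeightedProjectivePlane h3 hu)
  · intro T hT
    exact ⟨fun n hn h S' hS' => hT.hasForm_std1 hn h hS',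
      fun n hn h S' hS' => hT.hasForm_std2 hn h hS', fun h S' hS' => hT.hasForm_3A2 h hS'⟩
  · intro hb
    apply hcas
    by_contra! hu
    -- Without `(-1)`-curves the basic condition is vacuous.
    exact hb ⟨A, hA, hA.1.basicCondition_iff.mpr fun u v huv h => absurd h (hu u huv.left)⟩
  · intro h2
    obtain ⟨hP, u, v, hc, hunit⟩ := isWeightedProjectivePlane_of_singCount_two h3 h2
    refine ⟨hP, ?_⟩
    have hu : ∃ u ∈ A.rays, A.si u = -1 := by
      by_contra! hn
      have := hA.singCount_le_one h3 hn
      omega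
    rcases hA.cascade h3 hu with h | h
    · exact h.1
    · exact absurd (hA.hasAdjNonneg h3 hc hunit) h.2
  · intro h4
    have hnot : ¬A.HasAdjNonneg := fun h => by
      obtain ⟨u, v, hc, hunit⟩ := hA.exists_smooth_cone h3 h
      exact not_isUnit_of_singCount_three h3 h4 hc hunit
    have hu : ∃ u ∈ A.rays, A.si u = -1 := by
      by_contra! hn
      exact hnot ((hA.isThree h3).hasAdjNonneg_of_forall_ne hn)
    rcases hA.cascade h3 hu with h | h
    · exact absurd h.2 hnot
    · exact h.1
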